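/- Let $K$ be a field and let $A$ be a finite-dimensional $\mathbb{Z}$-graded $K$-algebra with a triangular decomposition $(A^-,T,A^+)$. That is, $A^-,T,A^+$ are graded subalgebras of $A$ such that: the multiplication map $A^-\otimes_K T\otimes_K A^+\to A$ is bijective; $T$ is concentrated in degree $0$, $A^+$ in degrees $\ge 0$ and $A^-$ in degrees $\le 0$; $A^+_0=K=A^-_0$; $A^{\pm}T=TA^{\pm}$; and $\mathrm{End}_T(S)=K$ for every simple $T$-module $S$. Put $B^{+}=A^{+}T$. The opposite algebra $A^{\mathrm{op}}$, with reversed grading, carries the opposite decomposition $((A^+)^{\mathrm{op}},T^{\mathrm{op}},(A^-)^{\mathrm{op}})$. For a graded algebra $R$ let $\mathcal{G}(R)$ be the category of finitely generated graded left $R$-modules with grading-preserving morphisms, and let $\mathrm{Irr}\,\mathcal{G}(R)$ be the set of isomorphism classes of its simple objects. For $M\in\mathcal{G}(R)$ let $M^*=\mathrm{Hom}_K(M,K)\in\mathcal{G}(R^{\mathrm{op}})$, where $(M^*)_i$ is the set of functionals that vanish on $M_j$ for all $j\ne i$. Suppose that $T$ is semisimple. For $\lambda\in\mathrm{Irr}\,\mathcal{G}(T)$,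 which is concentrated in a single degree $\deg\lambda$, let $\Delta(\lambda)=A\otimes_{B^+}\lambda$, where $B^+$ acts on $\lambda$ through its projection $B^+\to T$ onto degree $0$, and let $\nabla(\lambda)=\Delta(\lambda^*)^*$, where $\Delta(\lambda^*)$ is formed in $\mathcal{G}(A^{\mathrm{op}})$ with respect to the opposite decomposition. Let $L(\lambda)$ be the (simple) head of $\Delta(\lambda)$, and let $P(\lambda)$ be the projective cover of $L(\lambda)$ in $\mathcal{G}(A)$. Order $\mathrm{Irr}\,\mathcal{G}(T)$ by $\lambda<\mu\iff\deg\lambda<\deg\mu$. An object $M\in\mathcal{G}(A)$ has highest weight $\lambda$ if $[M:L(\lambda)]=1$ and $[M:L(\mu)]\neq0$ implies $\mu\le\lambda$. It is tilting if it has a finite filtration in $\mathcal{G}(A)$ with all successive quotients isomorphic to objects $\Delta(\mu)$, and also one with all successive quotients isomorphic to objects $\nabla(\mu)$. Suppose that $A$ is self-injective, i.e. injective as a left module over itself. Then there are permutations $\nu$, $\dagger$ and $h$ of $\mathrm{Irr}\,\mathcal{G}(T)$ such that, for all $\lambda$, $\mathrm{Soc}\,P(\lambda)\simeq L(\nu(\lambda))$,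 $\mathrm{Soc}\,\Delta(\lambda)\simeq L(\lambda^{\dagger})$, and $P(\lambda)$ has highest weight $\lambda^h$. For $\lambda\in\mathrm{Irr}\,\mathcal{G}(T)$ put $$T(\lambda):=P(\nu^{-1}(\lambda^{\dagger}))=P(\lambda^{h^{-1}}).$$ Then $T(\lambda)$ is an indecomposable tilting object of $\mathcal{G}(A)$ of highest weight $\lambda$, and there are an injection $\Delta(\lambda)\hookrightarrow T(\lambda)$ and a surjection $T(\lambda)\twoheadrightarrow\nabla(\lambda)$ in $\mathcal{G}(A)$. The map $\lambda\mapsto T(\lambda)$ is a bijection from $\mathrm{Irr}\,\mathcal{G}(T)$ onto the set of isomorphism classes of indecomposable tilting objects of $\mathcal{G}(A)$. In particular, every indecomposable tilting object of highest weight $\lambda$ is isomorphic to $T(\lambda)$. -/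

import Mathlib

universe u

open scoped TensorProduct
open CategoryTheory

namespace GradedTilting

section Gradings

/-- A criterion for a family of subspaces to be a grading, in terms of projections. -/
theorem isInternal_of_proj {K V : Type*} [Field K] [AddCommGroup V] [Module K V]
    (G : ℤ → Submodule K V) (p : ℤ → V →ₗ[K] V)
    (h1 : ∀ i, ∀ v ∈ G i, p i v = v)
    (h2 : ∀ i j, i ≠ j → ∀ v ∈ G j, p i v = 0)
    (h3 : ⨆ i, G i = ⊤) : DirectSum.IsInternal G := by
  rw [DirectSum.isInternal_submodule_iff_iSupIndep_and_iSup_eq_top]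
  refine ⟨?_, h3⟩
  intro i
  rw [Submodule.disjoint_def]
  intro v hv hv'
  have hle : (⨆ j, ⨆ (_ : j ≠ i), G j) ≤ LinearMap.ker (p i) :=
    iSup_le fun j => iSup_le fun hj => fun w hw => h2 i j (Ne.symm hj) w hw
  rw [← h1 i v hv]
  exact hle hv'

/-- The grading on the opposite algebra: the grading is reversed. -/
def opGrading {K A : Type*} [Field K] [Ring A] [Algebra K A] (𝒜 : ℤ → Submodule K A) :
    ℤ → Submodule K Aᵐᵒᵖ :=
  fun i => (𝒜 (-i)).comap (MulOpposite.opLinearEquiv K (M := A)).symm.toLinearMap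

theorem mem_opGrading {K A : Type*} [Field K] [Ring A] [Algebra K A] (𝒜 : ℤ → Submodule K A)
    (i : ℤ) (x : Aᵐᵒᵖ) : x ∈ opGrading 𝒜 i ↔ x.unop ∈ 𝒜 (-i) := Iff.rfl

/-- The grading on a subalgebra induced by a grading on the algebra. -/
def subGrading {K A : Type*} [Field K] [Ring A] [Algebra K A] (𝒜 : ℤ → Submodule K A)
    (S : Subalgebra K A) : ℤ → Submodule K S :=
  fun i => (𝒜 i).comap S.val.toLinearMap

theorem mem_subGrading {K A : Type*} [Field K] [Ring A] [Algebra K A] (𝒜 : ℤ → Submodule K A)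
    (S : Subalgebra K A) (i : ℤ) (x : S) : x ∈ subGrading 𝒜 S i ↔ (x : A) ∈ 𝒜 i := Iff.rfl

instance opGrading.gradedMonoid {K A : Type*} [Field K] [Ring A] [Algebra K A]
    (𝒜 : ℤ → Submodule K A) [GradedAlgebra 𝒜] : SetLike.GradedMonoid (opGrading 𝒜) where
  one_mem := by
    rw [mem_opGrading]
    simpa using SetLike.GradedOne.one_mem (A := 𝒜)
  mul_mem := by
    intro i j x y hx hy
    rw [mem_opGrading] at *
    have := SetLike.GradedMul.mul_mem hy hx
    rw [MulOpposite.unop_mul, neg_add_rev]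
    exact this

theorem opGrading.isInternal {K A : Type*} [Field K] [Ring A] [Algebra K A]
    (𝒜 : ℤ → Submodule K A) [GradedAlgebra 𝒜] : DirectSum.IsInternal (opGrading 𝒜) := by
  refine isInternal_of_proj _ (fun i => (MulOpposite.opLinearEquiv K (M := A)).toLinearMap ∘ₗ
    GradedAlgebra.proj 𝒜 (-i) ∘ₗ (MulOpposite.opLinearEquiv K (M := A)).symm.toLinearMap) ?_ ?_ ?_
  · intro i v hv
    rw [mem_opGrading] at hv
    simp [GradedAlgebra.proj_apply, DirectSum.decompose_of_mem_same 𝒜 hv]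
  · intro i j hij v hv
    rw [mem_opGrading] at hv
    have hne : -j ≠ -i := fun h => hij (neg_injective h).symm
    simp [GradedAlgebra.proj_apply, DirectSum.decompose_of_mem_ne 𝒜 hv hne]
  · rw [eq_top_iff]
    intro v _
    have key : ∀ a : A, MulOpposite.op a ∈ ⨆ i, opGrading 𝒜 i := by
      intro a
      induction a using DirectSum.Decomposition.inductionOn 𝒜 with
      | zero => simp
      | @homogeneous i m =>
        refine Submodule.mem_iSup_of_mem (-i) ?_
        rw [mem_opGrading]
        simp
      | add m m' h h' => rw [MulOpposite.op_add]; exact Submodule.add_mem _ h h'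
    exact key v.unop

noncomputable instance opGrading.gradedAlgebra {K A : Type*} [Field K] [Ring A] [Algebra K A]
    (𝒜 : ℤ → Submodule K A) [GradedAlgebra 𝒜] : GradedAlgebra (opGrading 𝒜) :=
  DirectSum.IsInternal.gradedAlgebra (opGrading.isInternal 𝒜)

end Gradings

/-- An object of the category `𝒢(R)` of finitely generated graded left modules over a graded
`K`-algebra `R` with homogeneous components `ℛ i`. -/
structure GrMod {K R : Type u} [Field K] [Ring R] [Algebra K R] (ℛ : ℤ → Submodule K R) where
  carrier : Type u
  [addCommGroup : AddCommGroup carrier]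
  [baseModule : Module K carrier]
  [module : Module R carrier]
  [tower : IsScalarTower K R carrier]
  grading : ℤ → Submodule K carrier
  isInternal : DirectSum.IsInternal grading
  smul_mem : ∀ (i j : ℤ) (r : R) (m : carrier), r ∈ ℛ i → m ∈ grading j → r • m ∈ grading (i + j)
  finite : Module.Finite R carrier

namespace GrMod

section General

variable {K R : Type u} [Field K] [Ring R] [Algebra K R] {ℛ : ℤ → Submodule K R}

instance : CoeSort (GrMod ℛ) (Type u) := ⟨GrMod.carrier⟩

attribute [instance] GrMod.addCommGroup GrMod.baseModule GrMod.module GrMod.tower GrMod.finite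

noncomputable instance (M : GrMod ℛ) : DirectSum.Decomposition M.grading :=
  M.isInternal.chooseDecomposition

/-- Morphisms in `𝒢(R)`: `R`-linear maps preserving the grading. -/
@[ext]
structure Hom (M N : GrMod ℛ) where
  toLin : M →ₗ[R] N
  map_mem : ∀ (i : ℤ) (m : M), m ∈ M.grading i → toLin m ∈ N.grading i

instance : Category (GrMod ℛ) where
  Hom := Hom
  id M := ⟨LinearMap.id, fun _ _ h => h⟩
  comp f g := ⟨g.toLin ∘ₗ f.toLin, fun i m h => g.map_mem i _ (f.map_mem i m h)⟩

/-- Graded submodules, i.e. subobjects in `𝒢(R)`. -/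
structure GrSub (M : GrMod ℛ) extends Submodule R M where
  isHomogeneous : toSubmodule.IsHomogeneous M.grading

/-- Projection onto the homogeneous component of degree `i`. -/
noncomputable def proj (M : GrMod ℛ) (i : ℤ) : M →ₗ[K] M :=
  (M.grading i).subtype ∘ₗ DirectSum.component K ℤ (fun j => M.grading j) i ∘ₗ
    (DirectSum.decomposeLinearEquiv M.grading).toLinearMap

theorem proj_apply (M : GrMod ℛ) (i : ℤ) (m : M) :
    M.proj i m = (DirectSum.decompose M.grading m i : M) := rfl

theorem proj_same (M : GrMod ℛ) {i : ℤ} {m : M} (h : m ∈ M.grading i) : M.proj i m = m :=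
  DirectSum.decompose_of_mem_same M.grading h

theorem proj_ne (M : GrMod ℛ) {i j : ℤ} {m : M} (h : m ∈ M.grading i) (hij : i ≠ j) :
    M.proj j m = 0 :=
  DirectSum.decompose_of_mem_ne M.grading h hij

theorem proj_mem (M : GrMod ℛ) (i : ℤ) (m : M) : M.proj i m ∈ M.grading i :=
  (DirectSum.decompose M.grading m i).2

theorem exists_sum_proj (M : GrMod ℛ) (m : M) : ∃ s : Finset ℤ, ∑ i ∈ s, M.proj i m = m := by
  classical
  exact ⟨_, DirectSum.sum_support_decompose M.grading m⟩

theorem finite_base [FiniteDimensional K R] (M : GrMod ℛ) : FiniteDimensional K M :=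
  Module.Finite.trans R M

/-- A graded submodule, as an object of `𝒢(R)`. -/
def ofSub [FiniteDimensional K R] {M : GrMod ℛ} (N : M.GrSub) : GrMod ℛ where
  carrier := N.toSubmodule
  grading i := (M.grading i).comap (N.toSubmodule.subtype.restrictScalars K)
  isInternal := by
    refine isInternal_of_proj _
      (fun i => (M.proj i).restrict (p := N.toSubmodule.restrictScalars K)
        (q := N.toSubmodule.restrictScalars K) fun m hm => N.isHomogeneous i hm) ?_ ?_ ?_
    · intro i v hv
      exact Subtype.ext (M.proj_same hv)
    · intro i j hij v hv
      exact Subtype.ext (M.proj_ne hv hij.symm)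
    · rw [eq_top_iff]
      intro v _
      obtain ⟨s, hs⟩ := M.exists_sum_proj v.1
      have : v = ∑ i ∈ s, (⟨M.proj i v.1, N.isHomogeneous i v.2⟩ : N.toSubmodule) := by
        apply Subtype.ext
        rw [AddSubmonoidClass.coe_finsetSum]
        exact hs.symm
      rw [this]
      exact Submodule.sum_mem _ fun i _ => Submodule.mem_iSup_of_mem i (M.proj_mem i v.1)
  smul_mem i j r m hr hm := M.smul_mem i j r m hr hm
  finite := by
    have := M.finite_base
    have : IsNoetherian R M := isNoetherian_of_tower K inferInstance
    infer_instance

/-- The quotient by a graded submodule, as an object of `𝒢(R)`. -/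
def quot {M : GrMod ℛ} (N : M.GrSub) : GrMod ℛ where
  carrier := M ⧸ N.toSubmodule
  grading i := (M.grading i).map (N.toSubmodule.mkQ.restrictScalars K)
  isInternal := by
    refine isInternal_of_proj _
      (fun i => (N.toSubmodule.restrictScalars K).mapQ (N.toSubmodule.restrictScalars K)
        (M.proj i) fun m hm => N.isHomogeneous i hm) ?_ ?_ ?_
    · rintro i _ ⟨v, hv, rfl⟩
      exact congrArg N.toSubmodule.mkQ (M.proj_same hv)
    · rintro i j hij _ ⟨v, hv, rfl⟩
      exact (congrArg N.toSubmodule.mkQ (M.proj_ne hv hij.symm)).trans (map_zero _)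
    · rw [← Submodule.map_iSup, M.isInternal.submodule_iSup_eq_top, Submodule.map_top,
        LinearMap.range_eq_top]
      exact N.toSubmodule.mkQ_surjective
  smul_mem := by
    rintro i j r _ hr ⟨v, hv, rfl⟩
    exact ⟨r • v, M.smul_mem i j r v hr hv, rfl⟩
  finite := inferInstance

/-- The preimage of `N` in the graded module `N'`. -/
def GrSub.within [FiniteDimensional K R] {M : GrMod ℛ} (N N' : M.GrSub) : (ofSub N').GrSub where
  toSubmodule := N.toSubmodule.comap N'.toSubmodule.subtype
  isHomogeneous := by
    intro i x hx
    obtain ⟨s, hs⟩ := (ofSub N').exists_sum_proj x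
    have hval : ∀ y : ofSub N', ((ofSub N').proj i y : ofSub N').1 = M.proj i y.1 := by
      intro y
      induction y using DirectSum.Decomposition.inductionOn (ofSub N').grading with
      | zero => exact ((congrArg Subtype.val (map_zero ((ofSub N').proj i))).trans
          (map_zero (M.proj i)).symm)
      | @homogeneous j m =>
        by_cases hij : j = i
        · subst hij
          rw [(ofSub N').proj_same m.2]
          exact (M.proj_same (i := j) (m := m.1.1) m.2).symm
        · rw [(ofSub N').proj_ne m.2 hij]
          exact (M.proj_ne (i := j) (m := m.1.1) m.2 hij).symm
      | add m m' h h' =>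
        rw [map_add]
        refine Eq.trans ?_ (map_add (M.proj i) m.1 m'.1).symm
        rw [← h, ← h']
        rfl
    change ((ofSub N').proj i x : ofSub N').1 ∈ N.toSubmodule
    rw [hval]
    exact N.isHomogeneous i hx

/-- The subquotient `N' / N` for graded submodules `N ≤ N'` of `M`. -/
def subquot [FiniteDimensional K R] {M : GrMod ℛ} (N' N : M.GrSub) : GrMod ℛ :=
  quot (N.within N')

/-- Simple objects of `𝒢(R)`. -/
def IsSimple (M : GrMod ℛ) : Prop :=
  Nontrivial M ∧ ∀ N : M.GrSub, N.toSubmodule = ⊥ ∨ N.toSubmodule = ⊤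

/-- Indecomposable objects of `𝒢(R)`. -/
def IsIndecomposable (M : GrMod ℛ) : Prop :=
  Nontrivial M ∧ ∀ N N' : M.GrSub, IsCompl N.toSubmodule N'.toSubmodule →
    N.toSubmodule = ⊥ ∨ N'.toSubmodule = ⊥

/-- Maximal (proper) graded submodules. -/
def GrSub.IsMaximal {M : GrMod ℛ} (N : M.GrSub) : Prop :=
  N.toSubmodule ≠ ⊤ ∧ ∀ N' : M.GrSub, N.toSubmodule ≤ N'.toSubmodule →
    N'.toSubmodule = N.toSubmodule ∨ N'.toSubmodule = ⊤

/-- The radical in `𝒢(R)`: the intersection of all maximal subobjects. -/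
def radical (M : GrMod ℛ) : M.GrSub where
  toSubmodule := sInf {N | ∃ N' : M.GrSub, N'.IsMaximal ∧ N'.toSubmodule = N}
  isHomogeneous := by
    intro i x hx
    change x ∈ sInf _ at hx
    rw [Submodule.mem_sInf] at hx ⊢
    rintro N ⟨N', hN', rfl⟩
    exact N'.isHomogeneous i (hx _ ⟨N', hN', rfl⟩)

/-- The head `Hd M = M / Rad M`. -/
def head (M : GrMod ℛ) : GrMod ℛ := quot M.radical

/-- The socle in `𝒢(R)`: the sum of all simple subobjects. -/
def socle [FiniteDimensional K R] (M : GrMod ℛ) : M.GrSub where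
  toSubmodule := ⨆ N : {N : M.GrSub // (ofSub N).IsSimple}, N.1.toSubmodule
  isHomogeneous := by
    intro i x hx
    change x ∈ iSup _ at hx
    change M.proj i x ∈ iSup _
    induction hx using Submodule.iSup_induction' with
    | mem N y hy => exact Submodule.mem_iSup_of_mem N (N.1.isHomogeneous i hy)
    | zero => rw [map_zero]; exact Submodule.zero_mem _
    | add y z _ _ hy hz => rw [map_add]; exact Submodule.add_mem _ hy hz

/-- `Soc M` as an object of `𝒢(R)`. -/
def soc [FiniteDimensional K R] (M : GrMod ℛ) : GrMod ℛ := ofSub M.socle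

/-- `P` is a projective cover of `S` in `𝒢(R)`: `P` is projective and there is an epimorphism
`P ⟶ S` whose kernel is superfluous. -/
def IsProjectiveCover (P S : GrMod ℛ) : Prop :=
  Projective P ∧ ∃ π : P ⟶ S, Function.Surjective π.toLin ∧
    ∀ N : P.GrSub, N.toSubmodule ⊔ LinearMap.ker π.toLin = ⊤ → N.toSubmodule = ⊤

/-- The graded dual `M^*` as a module over `R'`, where `φ : R' → Rᵐᵒᵖ` is a homomorphism which is
compatible with the reversed grading on `Rᵐᵒᵖ`:
`(M^*)_i` consists of the functionals vanishing on all `M_j`, `j ≠ i`,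
and `(r' • f)(m) = f(φ(r') m)`. -/
def dual [FiniteDimensional K R] {R' : Type u} [Ring R'] [Algebra K R'] [FiniteDimensional K R']
    {ℛ' : ℤ → Submodule K R'} (φ : R' →ₐ[K] Rᵐᵒᵖ)
    (hφ : ∀ i, ∀ r ∈ ℛ' i, φ r ∈ opGrading ℛ i) (M : GrMod ℛ) : GrMod ℛ' :=
  letI : Module R' (Module.Dual K M) :=
    { smul := fun r f => f ∘ₗ (Algebra.lsmul K K M (φ r).unop)
      one_smul := fun f => by
        ext m; change f ((φ 1).unop • m) = f m; simp
      mul_smul := fun r s f => by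
        ext m
        change f ((φ (r * s)).unop • m) = f ((φ s).unop • ((φ r).unop • m))
        rw [map_mul, MulOpposite.unop_mul, mul_smul]
      smul_zero := fun r => LinearMap.zero_comp _
      smul_add := fun r f g => LinearMap.add_comp _ _ _
      add_smul := fun r s f => by
        ext m
        change f ((φ (r + s)).unop • m) = f ((φ r).unop • m) + f ((φ s).unop • m)
        rw [map_add, MulOpposite.unop_add, add_smul, map_add]
      zero_smul := fun f => by
        ext m
        change f ((φ 0).unop • m) = 0
        simp }
  haveI tower : IsScalarTower K R' (Module.Dual K M) := ⟨fun c r f => by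
    ext m
    change f ((φ (c • r)).unop • m) = c • f ((φ r).unop • m)
    rw [map_smul φ, MulOpposite.unop_smul, smul_assoc, map_smul f]⟩
  { carrier := Module.Dual K M
    grading := fun i =>
      { carrier := {f | ∀ j, j ≠ i → ∀ m ∈ M.grading j, f m = 0}
        zero_mem' := fun _ _ _ _ => rfl
        add_mem' := fun {f g} hf hg j hj m hm => by
          rw [LinearMap.add_apply, hf j hj m hm, hg j hj m hm, add_zero]
        smul_mem' := fun c f hf j hj m hm => by
          rw [LinearMap.smul_apply, hf j hj m hm, smul_zero] }
    isInternal := by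
      classical
      refine isInternal_of_proj _ (fun i => LinearMap.lcomp K K (M.proj i)) ?_ ?_ ?_
      · intro i f hf
        ext m
        change f (M.proj i m) = f m
        induction m using DirectSum.Decomposition.inductionOn M.grading with
        | zero => simp
        | @homogeneous j m =>
          by_cases h : j = i
          · subst h; rw [M.proj_same m.2]
          · rw [M.proj_ne m.2 h, map_zero, hf j h m m.2]
        | add m m' h h' => rw [map_add, map_add, map_add, h, h']
      · intro i j hij f hf
        ext m
        exact hf i hij _ (M.proj_mem i m)
      · rw [eq_top_iff]
        intro f _
        have := M.finite_base
        let b := Module.finBasis K M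
        choose s hs using fun k => M.exists_sum_proj (b k)
        let t : Finset ℤ := Finset.univ.biUnion s
        have hz : ∀ k, ∀ i ∉ s k, M.proj i (b k) = 0 := by
          intro k i hi
          rw [← hs k, map_sum]
          exact Finset.sum_eq_zero fun j hj =>
            M.proj_ne (M.proj_mem j _) (fun h => hi (h ▸ hj))
        have hf : f = ∑ i ∈ t, f ∘ₗ M.proj i := by
          refine b.ext fun k => ?_
          rw [LinearMap.sum_apply]
          simp only [LinearMap.comp_apply]
          rw [← map_sum]
          congr 1
          conv_lhs => rw [← hs k]
          refine Finset.sum_subset (fun i hi => Finset.mem_biUnion.2 ⟨k, Finset.mem_univ _, hi⟩) ?_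
          intro i _ hi
          exact hz k i hi
        rw [hf]
        refine Submodule.sum_mem _ fun i _ => Submodule.mem_iSup_of_mem i ?_
        intro j hj m hm
        rw [LinearMap.comp_apply, M.proj_ne hm hj, map_zero]
    smul_mem := by
      intro i j r f hr hf k hk m hm
      have h := M.smul_mem (-i) k _ m (hφ i r hr) hm
      exact hf (-i + k) (by omega) _ h
    finite := by
      have := M.finite_base
      exact Module.Finite.of_restrictScalars_finite K R' (Module.Dual K M) }

/-- Scalar restriction along a homomorphism of graded algebras. -/
def restrict [FiniteDimensional K R] {R' : Type u} [Ring R'] [Algebra K R']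
    {ℛ' : ℤ → Submodule K R'} (φ : R' →ₐ[K] R) (hφ : ∀ i, ∀ r ∈ ℛ' i, φ r ∈ ℛ i)
    (M : GrMod ℛ) : GrMod ℛ' :=
  letI : Module R' M := Module.compHom M φ.toRingHom
  haveI : IsScalarTower K R' M := ⟨fun c r m => by
    change φ (c • r) • m = c • (φ r • m)
    rw [map_smul, smul_assoc]⟩
  { carrier := M
    grading := M.grading
    isInternal := M.isInternal
    smul_mem := fun i j r m hr hm => M.smul_mem i j (φ r) m (hφ i r hr) hm
    finite := by
      have := M.finite_base
      exact Module.Finite.of_restrictScalars_finite K R' M }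

end General

section Induction

variable {K A : Type u} [Field K] [Ring A] [Algebra K A] {𝒜 : ℤ → Submodule K A}
  {B : Subalgebra K A}

/-- The relations `ab ⊗ m = a ⊗ bm` that define `A ⊗_B M` as a quotient of `A ⊗_K M`. -/
def relations (M : GrMod (subGrading 𝒜 B)) : Submodule A (A ⊗[K] M) :=
  Submodule.span A {x | ∃ (a : A) (b : B) (m : M), x = (a * (b : A)) ⊗ₜ[K] m - a ⊗ₜ[K] (b • m)}

/-- The element `a ⊗ m` of `A ⊗_B M`. -/
def tmulB (M : GrMod (subGrading 𝒜 B)) : A →ₗ[K] M →ₗ[K] ((A ⊗[K] M) ⧸ M.relations) :=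
  (TensorProduct.mk K A M).compr₂ (M.relations.mkQ.restrictScalars K)

theorem tmulB_smul (M : GrMod (subGrading 𝒜 B)) (a : A) (b : B) (m : M) :
    M.tmulB (a * (b : A)) m = M.tmulB a (b • m) :=
  (Submodule.Quotient.eq _).2 (Submodule.subset_span ⟨a, b, m, rfl⟩)

/-- The homogeneous component of degree `d` of `A ⊗_B M`: it is spanned by the `a ⊗ m` with
`deg a + deg m = d`. -/
def inducedGrading (M : GrMod (subGrading 𝒜 B)) (d : ℤ) :
    Submodule K ((A ⊗[K] M) ⧸ M.relations) :=
  Submodule.span K {x | ∃ (i j : ℤ) (a : A) (m : M),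
    a ∈ 𝒜 i ∧ m ∈ M.grading j ∧ i + j = d ∧ x = M.tmulB a m}

theorem proj_smul (M : GrMod (subGrading 𝒜 B)) (i d : ℤ) (b : B) (hb : (b : A) ∈ 𝒜 i) (m : M) :
    M.proj d (b • m) = b • M.proj (d - i) m := by
  induction m using DirectSum.Decomposition.inductionOn M.grading with
  | zero => simp
  | @homogeneous j m =>
    have h := M.smul_mem i j b m hb m.2
    by_cases hd : i + j = d
    · subst hd
      rw [M.proj_same h, M.proj_same (i := i + j - i) (by rw [add_sub_cancel_left]; exact m.2)]
    · rw [M.proj_ne h hd, M.proj_ne m.2 (by omega), smul_zero]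
  | add m m' h h' => rw [smul_add, map_add, map_add, smul_add, h, h']

variable [GradedAlgebra 𝒜]

/-- Auxiliary: `(a, m) ↦` the component of degree `d` of `a ⊗ m`. -/
noncomputable def inducedProjAux (M : GrMod (subGrading 𝒜 B)) (d : ℤ) :
    A →ₗ[K] M →ₗ[K] ((A ⊗[K] M) ⧸ M.relations) :=
  DirectSum.toModule K ℤ _ (fun i => (M.tmulB ∘ₗ (𝒜 i).subtype).compl₂ (M.proj (d - i))) ∘ₗ
    (DirectSum.decomposeLinearEquiv 𝒜).toLinearMap

theorem inducedProjAux_apply (M : GrMod (subGrading 𝒜 B)) (d i : ℤ) (a : A) (ha : a ∈ 𝒜 i)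
    (m : M) : M.inducedProjAux d a m = M.tmulB a (M.proj (d - i) m) := by
  lift a to 𝒜 i using ha
  rw [inducedProjAux, LinearMap.comp_apply]
  have : (DirectSum.decomposeLinearEquiv 𝒜).toLinearMap (a : A) = DirectSum.lof K ℤ _ i a :=
    DirectSum.decompose_coe 𝒜 a
  rw [this, DirectSum.toModule_lof]
  rfl

theorem inducedProjAux_smul (hB : DirectSum.SetLike.IsHomogeneous 𝒜 B) (M : GrMod (subGrading 𝒜 B)) (d : ℤ)
    (a : A) (b : B) (m : M) :
    M.inducedProjAux d (a * (b : A)) m = M.inducedProjAux d a (b • m) := by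
  classical
  induction a using DirectSum.Decomposition.inductionOn 𝒜 with
  | zero => simp
  | @homogeneous i a =>
    have hb : b = ∑ k ∈ (DirectSum.decompose 𝒜 (b : A)).support,
        (⟨DirectSum.decompose 𝒜 (b : A) k, hB k b.2⟩ : B) := by
      apply Subtype.ext
      rw [AddSubmonoidClass.coe_finsetSum]
      exact (DirectSum.sum_support_decompose 𝒜 (b : A)).symm
    rw [hb, AddSubmonoidClass.coe_finsetSum, Finset.mul_sum, Finset.sum_smul, map_sum, map_sum,
      LinearMap.sum_apply]
    refine Finset.sum_congr rfl fun k _ => ?_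
    have hk : ((⟨DirectSum.decompose 𝒜 (b : A) k, hB k b.2⟩ : B) : A) ∈ 𝒜 k :=
      (DirectSum.decompose 𝒜 (b : A) k).2
    rw [M.inducedProjAux_apply d (i + k) _ (SetLike.GradedMul.mul_mem a.2 hk),
      M.inducedProjAux_apply d i _ a.2, tmulB_smul, proj_smul M k _ _ hk,
      sub_sub]
  | add a a' h h' => rw [add_mul, map_add, map_add, LinearMap.add_apply, LinearMap.add_apply, h, h']

/-- The projection onto the component of degree `d` of `A ⊗_B M`. -/
noncomputable def inducedProj (hB : DirectSum.SetLike.IsHomogeneous 𝒜 B) (M : GrMod (subGrading 𝒜 B))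
    (d : ℤ) : ((A ⊗[K] M) ⧸ M.relations) →ₗ[K] ((A ⊗[K] M) ⧸ M.relations) :=
  (M.relations.restrictScalars K).liftQ (TensorProduct.lift (M.inducedProjAux d)) (by
    intro x hx
    change x ∈ Submodule.span A _ at hx
    have key : ∀ a : A, TensorProduct.lift (M.inducedProjAux d) (a • x) = 0 := by
      induction hx using Submodule.span_induction with
      | mem x hx =>
        obtain ⟨a, b, m, rfl⟩ := hx
        intro a'
        rw [smul_sub, TensorProduct.smul_tmul', TensorProduct.smul_tmul', map_sub,
          TensorProduct.lift.tmul, TensorProduct.lift.tmul, smul_eq_mul, smul_eq_mul, ← mul_assoc,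
          inducedProjAux_smul hB, sub_self]
      | zero => simp
      | add x y _ _ hx hy => intro a; rw [smul_add, map_add, hx, hy, add_zero]
      | smul c x _ hx => intro a; rw [smul_smul]; exact hx _
    simpa using key 1)

theorem inducedProj_tmulB (hB : DirectSum.SetLike.IsHomogeneous 𝒜 B) (M : GrMod (subGrading 𝒜 B))
    (d i : ℤ) (a : A) (ha : a ∈ 𝒜 i) (m : M) :
    M.inducedProj hB d (M.tmulB a m) = M.tmulB a (M.proj (d - i) m) := by
  rw [← M.inducedProjAux_apply d i a ha m]
  exact TensorProduct.lift.tmul _ _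

/-- The induced module `A ⊗_B M`, with its standard grading. -/
def induce [FiniteDimensional K A] (hB : DirectSum.SetLike.IsHomogeneous 𝒜 B)
    (M : GrMod (subGrading 𝒜 B)) : GrMod 𝒜 where
  carrier := (A ⊗[K] M) ⧸ M.relations
  grading := M.inducedGrading
  isInternal := by
    refine isInternal_of_proj _ (M.inducedProj hB) ?_ ?_ ?_
    · intro d v hv
      have : M.inducedGrading d ≤ LinearMap.eqLocus (M.inducedProj hB d) LinearMap.id := by
        refine Submodule.span_le.2 ?_
        rintro _ ⟨i, j, a, m, ha, hm, rfl, rfl⟩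
        change M.inducedProj hB (i + j) (M.tmulB a m) = M.tmulB a m
        rw [M.inducedProj_tmulB hB _ i a ha, M.proj_same (by rw [add_sub_cancel_left]; exact hm)]
      exact this hv
    · intro d e hde v hv
      have : M.inducedGrading e ≤ LinearMap.ker (M.inducedProj hB d) := by
        refine Submodule.span_le.2 ?_
        rintro _ ⟨i, j, a, m, ha, hm, rfl, rfl⟩
        change M.inducedProj hB d (M.tmulB a m) = 0
        rw [M.inducedProj_tmulB hB _ i a ha, M.proj_ne hm (by omega), map_zero]
      exact this hv
    · rw [eq_top_iff]
      intro v hv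
      clear hv
      obtain ⟨x, rfl⟩ := M.relations.mkQ_surjective v
      induction x using TensorProduct.induction_on with
      | zero => rw [map_zero]; exact Submodule.zero_mem _
      | tmul a m =>
        change M.tmulB a m ∈ _
        induction a using DirectSum.Decomposition.inductionOn 𝒜 with
        | zero => rw [map_zero]; exact Submodule.zero_mem _
        | @homogeneous i a =>
          induction m using DirectSum.Decomposition.inductionOn M.grading with
          | zero => rw [map_zero]; exact Submodule.zero_mem _
          | @homogeneous j m =>
            exact Submodule.mem_iSup_of_mem (i + j)
              (Submodule.subset_span ⟨i, j, a, m, a.2, m.2, rfl, rfl⟩)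
          | add m m' h h' => rw [map_add]; exact Submodule.add_mem _ h h'
        | add a a' h h' =>
          rw [map_add, LinearMap.add_apply]; exact Submodule.add_mem _ h h'
      | add x y hx hy => rw [map_add]; exact Submodule.add_mem _ hx hy
  smul_mem := by
    intro i j r v hr hv
    induction hv using Submodule.span_induction with
    | mem x hx =>
      obtain ⟨k, l, a, m, ha, hm, rfl, rfl⟩ := hx
      refine Submodule.subset_span ⟨i + k, l, r * a, m, SetLike.GradedMul.mul_mem hr ha, hm,
        by ring, rfl⟩
    | zero => rw [smul_zero]; exact Submodule.zero_mem _
    | add x y _ _ hx hy => rw [smul_add]; exact Submodule.add_mem _ hx hy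
    | smul c x _ hx => rw [smul_comm]; exact Submodule.smul_mem _ c hx
  finite := by
    have : FiniteDimensional K B := inferInstance
    have := M.finite_base
    have : Module.Finite K ((A ⊗[K] M) ⧸ M.relations) :=
      Module.Finite.of_surjective (M.relations.mkQ.restrictScalars K) M.relations.mkQ_surjective
    exact Module.Finite.of_restrictScalars_finite K A _

end Induction

end GrMod

section Triangular

variable {K A : Type u} [Field K] [Ring A] [Algebra K A]

/-- The multiplication map `X ⊗ Y ⊗ Z → A` for subalgebras `X`, `Y`, `Z` of `A`. -/
def tripleMul (X Y Z : Subalgebra K A) : (X ⊗[K] Y) ⊗[K] Z →ₗ[K] A :=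
  LinearMap.mul' K A ∘ₗ TensorProduct.map
    (LinearMap.mul' K A ∘ₗ TensorProduct.map X.val.toLinearMap Y.val.toLinearMap)
    Z.val.toLinearMap

theorem tripleMul_tmul (X Y Z : Subalgebra K A) (x : X) (y : Y) (z : Z) :
    tripleMul X Y Z ((x ⊗ₜ y) ⊗ₜ z) = x * y * z := rfl

/-- A triple `(A⁻, T, A⁺)` of graded subalgebras of `A` such that multiplication
`A⁻ ⊗ T ⊗ A⁺ → A` is bijective, `T` is in degree zero, `A⁺` (resp. `A⁻`) is in non-negative (resp.
non-positive) degrees with degree zero component `K`, and `A⁺ T = T A⁺`, `A⁻ T = T A⁻`. -/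
structure PreTriangularDecomposition (𝒜 : ℤ → Submodule K A) [GradedAlgebra 𝒜] where
  neg : Subalgebra K A
  mid : Subalgebra K A
  pos : Subalgebra K A
  neg_homogeneous : DirectSum.SetLike.IsHomogeneous 𝒜 neg
  pos_homogeneous : DirectSum.SetLike.IsHomogeneous 𝒜 pos
  mul_bijective : Function.Bijective (tripleMul neg mid pos)
  mid_le : ∀ a ∈ mid, a ∈ 𝒜 0
  neg_supp : ∀ i > 0, ∀ a ∈ neg, a ∈ 𝒜 i → a = 0
  pos_supp : ∀ i < 0, ∀ a ∈ pos, a ∈ 𝒜 i → a = 0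
  neg_zero : ∀ a ∈ neg, a ∈ 𝒜 0 → a ∈ (⊥ : Subalgebra K A)
  pos_zero : ∀ a ∈ pos, a ∈ 𝒜 0 → a ∈ (⊥ : Subalgebra K A)
  neg_comm : Subalgebra.toSubmodule neg * Subalgebra.toSubmodule mid =
    Subalgebra.toSubmodule mid * Subalgebra.toSubmodule neg
  pos_comm : Subalgebra.toSubmodule pos * Subalgebra.toSubmodule mid =
    Subalgebra.toSubmodule mid * Subalgebra.toSubmodule pos

/-- A triangular decomposition `(A⁻, T, A⁺)` of the graded algebra `A`: in addition, `T` is a split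
`K`-algebra, that is, `End_T(S) = K` for every simple `T`-module `S`. -/
structure TriangularDecomposition (𝒜 : ℤ → Submodule K A) [GradedAlgebra 𝒜] extends
    PreTriangularDecomposition 𝒜 where
  split : ∀ (S : Type u) [AddCommGroup S] [Module mid S] [IsSimpleModule mid S]
    (f : S →ₗ[mid] S), ∃ c : K, ∀ s : S, f s = algebraMap K mid c • s

namespace PreTriangularDecomposition

variable {𝒜 : ℤ → Submodule K A} [GradedAlgebra 𝒜] (𝒯 : PreTriangularDecomposition 𝒜)

/-- The positive Borel subalgebra `B⁺`, generated by `A⁺` and `T`. -/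
def borel : Subalgebra K A := 𝒯.pos ⊔ 𝒯.mid

theorem toSubmodule_borel : Subalgebra.toSubmodule 𝒯.borel =
    Subalgebra.toSubmodule 𝒯.pos * Subalgebra.toSubmodule 𝒯.mid := by
  apply le_antisymm
  · let S : Subalgebra K A := Submodule.toSubalgebra
      (Subalgebra.toSubmodule 𝒯.pos * Subalgebra.toSubmodule 𝒯.mid)
      (by
        simpa using Submodule.mul_mem_mul (M := Subalgebra.toSubmodule 𝒯.pos)
          (N := Subalgebra.toSubmodule 𝒯.mid) (one_mem 𝒯.pos) (one_mem 𝒯.mid))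
      (by
        intro x y hx hy
        have h := Submodule.mul_mem_mul hx hy
        have e : (Subalgebra.toSubmodule 𝒯.pos * Subalgebra.toSubmodule 𝒯.mid) *
            (Subalgebra.toSubmodule 𝒯.pos * Subalgebra.toSubmodule 𝒯.mid) =
            Subalgebra.toSubmodule 𝒯.pos * Subalgebra.toSubmodule 𝒯.mid := by
          rw [mul_assoc, ← mul_assoc (Subalgebra.toSubmodule 𝒯.mid), ← 𝒯.pos_comm,
            mul_assoc (Subalgebra.toSubmodule 𝒯.pos) (Subalgebra.toSubmodule 𝒯.mid),
            Subalgebra.isIdempotentElem_toSubmodule 𝒯.mid, ← mul_assoc,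
            Subalgebra.isIdempotentElem_toSubmodule 𝒯.pos]
        rwa [e] at h)
    have : 𝒯.borel ≤ S := by
      refine sup_le ?_ ?_
      · intro x hx
        change x ∈ Subalgebra.toSubmodule 𝒯.pos * Subalgebra.toSubmodule 𝒯.mid
        simpa using Submodule.mul_mem_mul (M := Subalgebra.toSubmodule 𝒯.pos)
          (N := Subalgebra.toSubmodule 𝒯.mid) hx (one_mem 𝒯.mid)
      · intro x hx
        change x ∈ Subalgebra.toSubmodule 𝒯.pos * Subalgebra.toSubmodule 𝒯.mid
        simpa using Submodule.mul_mem_mul (M := Subalgebra.toSubmodule 𝒯.pos)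
          (N := Subalgebra.toSubmodule 𝒯.mid) (one_mem 𝒯.pos) hx
    exact this
  · rw [Submodule.mul_le]
    intro x hx y hy
    exact mul_mem (S := Subalgebra K A) (s := 𝒯.borel) (le_sup_left (a := 𝒯.pos) hx)
      (le_sup_right (a := 𝒯.pos) hy)

theorem borel_homogeneous : DirectSum.SetLike.IsHomogeneous 𝒜 𝒯.borel := by
  intro i b hb
  have hb' : b ∈ Subalgebra.toSubmodule 𝒯.pos * Subalgebra.toSubmodule 𝒯.mid := by
    rw [← toSubmodule_borel]; exact hb
  induction hb' using Submodule.mul_induction_on' with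
  | mem_mul_mem x hx y hy =>
    rw [DirectSum.coe_decompose_mul_of_right_mem_zero 𝒜 (𝒯.mid_le y hy)]
    exact mul_mem (le_sup_left (a := 𝒯.pos) (𝒯.pos_homogeneous i hx))
      (le_sup_right (a := 𝒯.pos) hy)
  | add x hx y hy hx' hy' =>
    rw [← toSubmodule_borel] at hx hy
    rw [DirectSum.decompose_add]
    exact add_mem (hx' hx) (hy' hy)

theorem borel_zero {b : A} (hb : b ∈ 𝒯.borel) : GradedAlgebra.proj 𝒜 0 b ∈ 𝒯.mid := by
  have hb' : b ∈ Subalgebra.toSubmodule 𝒯.pos * Subalgebra.toSubmodule 𝒯.mid := by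
    rw [← toSubmodule_borel]; exact hb
  induction hb' using Submodule.mul_induction_on' with
  | mem_mul_mem x hx y hy =>
    rw [GradedAlgebra.proj_apply, DirectSum.coe_decompose_mul_of_right_mem_zero 𝒜 (𝒯.mid_le y hy)]
    refine mul_mem ?_ hy
    have := 𝒯.pos_zero _ (𝒯.pos_homogeneous 0 hx) (DirectSum.decompose 𝒜 x 0).2
    exact (bot_le : ⊥ ≤ 𝒯.mid) this
  | add x hx y hy hx' hy' =>
    rw [← toSubmodule_borel] at hx hy
    rw [map_add]
    exact add_mem (hx' hx) (hy' hy)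

theorem borel_supp {b : A} (hb : b ∈ 𝒯.borel) (i : ℤ) (hi : i < 0) :
    GradedAlgebra.proj 𝒜 i b = 0 := by
  have hb' : b ∈ Subalgebra.toSubmodule 𝒯.pos * Subalgebra.toSubmodule 𝒯.mid := by
    rw [← toSubmodule_borel]; exact hb
  induction hb' using Submodule.mul_induction_on' with
  | mem_mul_mem x hx y hy =>
    rw [GradedAlgebra.proj_apply, DirectSum.coe_decompose_mul_of_right_mem_zero 𝒜 (𝒯.mid_le y hy),
      𝒯.pos_supp i hi _ (𝒯.pos_homogeneous i hx) (DirectSum.decompose 𝒜 x i).2, zero_mul]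
  | add x hx y hy hx' hy' =>
    rw [← toSubmodule_borel] at hx hy
    rw [map_add, hx' hx, hy' hy, add_zero]

theorem borel_proj_mul {a b : A} (ha : a ∈ 𝒯.borel) (hb : b ∈ 𝒯.borel) :
    GradedAlgebra.proj 𝒜 0 (a * b) = GradedAlgebra.proj 𝒜 0 a * GradedAlgebra.proj 𝒜 0 b := by
  classical
  have key : ∀ x ∈ 𝒯.borel, ∀ i : ℤ, ∀ c ∈ 𝒜 i, c ∈ 𝒯.borel →
      GradedAlgebra.proj 𝒜 0 (c * x) =
        GradedAlgebra.proj 𝒜 0 c * GradedAlgebra.proj 𝒜 0 x := by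
    intro x hx i c hc hcB
    have h1 : GradedAlgebra.proj 𝒜 0 (c * x) = c * GradedAlgebra.proj 𝒜 (-i) x := by
      have := DirectSum.coe_decompose_mul_add_of_left_mem 𝒜 (j := -i) (b := x) hc
      rw [add_neg_cancel] at this
      exact this
    rw [h1]
    rcases lt_trichotomy i 0 with h | h | h
    · have hc0 : c = 0 := by
        rw [← 𝒯.borel_supp hcB i h]
        exact (DirectSum.decompose_of_mem_same 𝒜 hc).symm
      simp [hc0]
    · subst h
      congr 1
      exact (DirectSum.decompose_of_mem_same 𝒜 hc).symm
    · rw [𝒯.borel_supp hx (-i) (by omega)]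
      have : GradedAlgebra.proj 𝒜 0 c = 0 := DirectSum.decompose_of_mem_ne 𝒜 hc (by omega)
      rw [this, mul_zero, zero_mul]
  have hs := DirectSum.sum_support_decompose 𝒜 a
  rw [← hs, Finset.sum_mul, map_sum, map_sum, Finset.sum_mul]
  exact Finset.sum_congr rfl fun i _ =>
    key b hb i _ (DirectSum.decompose 𝒜 a i).2 (𝒯.borel_homogeneous i ha)

/-- The projection `B⁺ → T` onto the component of degree zero. -/
noncomputable def borelProj : 𝒯.borel →ₐ[K] 𝒯.mid where
  toFun b := ⟨GradedAlgebra.proj 𝒜 0 b, 𝒯.borel_zero b.2⟩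
  map_one' := Subtype.ext (DirectSum.decompose_of_mem_same 𝒜 SetLike.GradedOne.one_mem)
  map_mul' a b := Subtype.ext (𝒯.borel_proj_mul a.2 b.2)
  map_zero' := Subtype.ext (map_zero _)
  map_add' _ _ := Subtype.ext (map_add _ _ _)
  commutes' c := Subtype.ext
    (DirectSum.decompose_of_mem_same 𝒜 (SetLike.algebraMap_mem_graded 𝒜 c))

theorem borelProj_graded (i : ℤ) (b : 𝒯.borel) (hb : b ∈ subGrading 𝒜 𝒯.borel i) :
    𝒯.borelProj b ∈ subGrading 𝒜 𝒯.mid i := by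
  rw [mem_subGrading] at hb ⊢
  change GradedAlgebra.proj 𝒜 0 (b : A) ∈ 𝒜 i
  by_cases h : i = 0
  · subst h
    exact (DirectSum.decompose 𝒜 (b : A) 0).2
  · have : GradedAlgebra.proj 𝒜 0 (b : A) = 0 := DirectSum.decompose_of_mem_ne 𝒜 hb h
    rw [this]
    exact Submodule.zero_mem _

/-- The category `𝒢(T)`. -/
abbrev TMod : Type (u + 1) := GrMod (subGrading 𝒜 𝒯.mid)

/-- The standard object `Δ(M) = A ⊗_{B⁺} Inf M`, where `Inf M` is the inflation of the graded
`T`-module `M` along the projection `B⁺ → T`. -/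
noncomputable def standard [FiniteDimensional K A] (M : 𝒯.TMod) : GrMod 𝒜 :=
  GrMod.induce 𝒯.borel_homogeneous (GrMod.restrict 𝒯.borelProj 𝒯.borelProj_graded M)

/-- A subalgebra is linearly equivalent to its opposite. -/
def opLinEquiv (S : Subalgebra K A) : S.op ≃ₗ[K] S where
  toFun x := ⟨x.1.unop, x.2⟩
  invFun x := ⟨MulOpposite.op x.1, x.2⟩
  left_inv _ := rfl
  right_inv _ := rfl
  map_add' _ _ := rfl
  map_smul' _ _ := rfl

theorem op_mul_comm {X Y : Subalgebra K A}
    (h : Subalgebra.toSubmodule X * Subalgebra.toSubmodule Y =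
      Subalgebra.toSubmodule Y * Subalgebra.toSubmodule X) :
    Subalgebra.toSubmodule X.op * Subalgebra.toSubmodule Y.op =
      Subalgebra.toSubmodule Y.op * Subalgebra.toSubmodule X.op := by
  have key : ∀ X Y : Subalgebra K A,
      Subalgebra.toSubmodule X * Subalgebra.toSubmodule Y =
        Subalgebra.toSubmodule Y * Subalgebra.toSubmodule X →
      Subalgebra.toSubmodule X.op * Subalgebra.toSubmodule Y.op ≤
        Subalgebra.toSubmodule Y.op * Subalgebra.toSubmodule X.op := by
    intro X Y h
    rw [Submodule.mul_le]
    intro x hx y hy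
    have h1 : y.unop * x.unop ∈ Subalgebra.toSubmodule X * Subalgebra.toSubmodule Y := by
      rw [h]
      exact Submodule.mul_mem_mul hy hx
    have h2 : ∀ z ∈ Subalgebra.toSubmodule X * Subalgebra.toSubmodule Y,
        MulOpposite.op z ∈ Subalgebra.toSubmodule Y.op * Subalgebra.toSubmodule X.op := by
      intro z hz
      induction hz using Submodule.mul_induction_on' with
      | mem_mul_mem a ha b hb =>
        rw [MulOpposite.op_mul]
        exact Submodule.mul_mem_mul (M := Subalgebra.toSubmodule Y.op)
          (N := Subalgebra.toSubmodule X.op) hb ha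
      | add a _ b _ ha hb => rw [MulOpposite.op_add]; exact add_mem ha hb
    exact h2 _ h1
  exact le_antisymm (key X Y h) (key Y X h.symm)

theorem op_homogeneous {S : Subalgebra K A} (hS : DirectSum.SetLike.IsHomogeneous 𝒜 S) :
    DirectSum.SetLike.IsHomogeneous (opGrading 𝒜) S.op := by
  have key : ∀ (i : ℤ) (a : A), ((DirectSum.decompose (opGrading 𝒜) (MulOpposite.op a) i : Aᵐᵒᵖ)) =
      MulOpposite.op (DirectSum.decompose 𝒜 a (-i) : A) := by
    intro i a
    induction a using DirectSum.Decomposition.inductionOn 𝒜 with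
    | zero => simp
    | @homogeneous j a =>
      have ha : MulOpposite.op (a : A) ∈ opGrading 𝒜 (-j) := by
        rw [mem_opGrading, neg_neg]; exact a.2
      by_cases h : j = -i
      · subst h
        rw [neg_neg] at ha
        rw [DirectSum.decompose_of_mem_same _ ha, DirectSum.decompose_of_mem_same _ a.2]
      · rw [DirectSum.decompose_of_mem_ne _ ha (by omega), DirectSum.decompose_of_mem_ne _ a.2 h]
        rfl
    | add a b ha hb =>
      rw [MulOpposite.op_add, DirectSum.decompose_add, DirectSum.decompose_add]
      simp only [DirectSum.add_apply, Submodule.coe_add, MulOpposite.op_add, ha, hb]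
  intro i x hx
  have := key i x.unop
  rw [MulOpposite.op_unop] at this
  rw [this]
  exact hS (-i) hx

/-- The opposite decomposition `((A⁺)ᵒᵖ, Tᵒᵖ, (A⁻)ᵒᵖ)` of `Aᵒᵖ`. -/
def op : PreTriangularDecomposition (opGrading 𝒜) where
  neg := 𝒯.pos.op
  mid := 𝒯.mid.op
  pos := 𝒯.neg.op
  neg_homogeneous := op_homogeneous 𝒯.pos_homogeneous
  pos_homogeneous := op_homogeneous 𝒯.neg_homogeneous
  mul_bijective := by
    let e : (𝒯.pos.op ⊗[K] 𝒯.mid.op) ⊗[K] 𝒯.neg.op ≃ₗ[K] (𝒯.neg ⊗[K] 𝒯.mid) ⊗[K] 𝒯.pos :=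
      (TensorProduct.congr (TensorProduct.congr (opLinEquiv 𝒯.pos) (opLinEquiv 𝒯.mid))
        (opLinEquiv 𝒯.neg)) ≪≫ₗ TensorProduct.comm K _ _ ≪≫ₗ
      TensorProduct.congr (LinearEquiv.refl K _) (TensorProduct.comm K _ _) ≪≫ₗ
      (TensorProduct.assoc K _ _ _).symm
    have h : tripleMul 𝒯.pos.op 𝒯.mid.op 𝒯.neg.op =
        (MulOpposite.opLinearEquiv K (M := A)).toLinearMap ∘ₗ
          tripleMul 𝒯.neg 𝒯.mid 𝒯.pos ∘ₗ e.toLinearMap := by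
      refine TensorProduct.ext_threefold fun x y z => ?_
      apply MulOpposite.unop_injective
      change z.1.unop * (y.1.unop * x.1.unop) = z.1.unop * y.1.unop * x.1.unop
      rw [mul_assoc]
    rw [h]
    exact (MulOpposite.opLinearEquiv K (M := A)).bijective.comp (𝒯.mul_bijective.comp e.bijective)
  mid_le a ha := by
    rw [mem_opGrading, _root_.neg_zero]
    exact 𝒯.mid_le _ ha
  neg_supp i hi a ha h := MulOpposite.unop_injective (𝒯.pos_supp (-i) (by omega) _ ha h)
  pos_supp i hi a ha h := MulOpposite.unop_injective (𝒯.neg_supp (-i) (by omega) _ ha h)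
  neg_zero a ha h := by
    rw [mem_opGrading, _root_.neg_zero] at h
    obtain ⟨c, hc⟩ := Algebra.mem_bot.1 (𝒯.pos_zero _ ha h)
    exact Algebra.mem_bot.2 ⟨c, MulOpposite.unop_injective hc⟩
  pos_zero a ha h := by
    rw [mem_opGrading, _root_.neg_zero] at h
    obtain ⟨c, hc⟩ := Algebra.mem_bot.1 (𝒯.neg_zero _ ha h)
    exact Algebra.mem_bot.2 ⟨c, MulOpposite.unop_injective hc⟩
  neg_comm := op_mul_comm 𝒯.pos_comm
  pos_comm := op_mul_comm 𝒯.neg_comm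

/-- The identification of `Tᵒᵖ ⊆ Aᵒᵖ` with the opposite algebra of `T`. -/
def opMidHom : 𝒯.op.mid →ₐ[K] (𝒯.mid)ᵐᵒᵖ where
  toFun x := MulOpposite.op ⟨x.1.unop, x.2⟩
  map_one' := rfl
  map_mul' _ _ := rfl
  map_zero' := rfl
  map_add' _ _ := rfl
  commutes' _ := rfl

theorem opMidHom_graded (i : ℤ) (x : 𝒯.op.mid) (h : x ∈ subGrading (opGrading 𝒜) 𝒯.op.mid i) :
    𝒯.opMidHom x ∈ opGrading (subGrading 𝒜 𝒯.mid) i := h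

/-- The standard duality `𝒢(T) → 𝒢(Tᵒᵖ)`. -/
def dualT [FiniteDimensional K A] (M : 𝒯.TMod) : 𝒯.op.TMod :=
  GrMod.dual 𝒯.opMidHom 𝒯.opMidHom_graded M

/-- The identity `A → (Aᵒᵖ)ᵒᵖ`. -/
def opOpHom (K A : Type u) [Field K] [Ring A] [Algebra K A] : A →ₐ[K] Aᵐᵒᵖᵐᵒᵖ where
  toFun a := MulOpposite.op (MulOpposite.op a)
  map_one' := rfl
  map_mul' _ _ := rfl
  map_zero' := rfl
  map_add' _ _ := rfl
  commutes' _ := rfl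

/-- The standard duality `𝒢(Aᵒᵖ) → 𝒢(A)`. -/
def dualOp [FiniteDimensional K A] (M : GrMod (opGrading 𝒜)) : GrMod 𝒜 :=
  GrMod.dual (opOpHom K A) (fun i a h => by
    rw [mem_opGrading, mem_opGrading, neg_neg]; exact h) M

/-- The costandard object `∇(M) = Δ(M^*)^*`, where the inner `Δ` is formed with respect to the
opposite triangular decomposition of `Aᵒᵖ`. -/
noncomputable def costandard [FiniteDimensional K A] (M : 𝒯.TMod) : GrMod 𝒜 :=
  dualOp (𝒯.op.standard (𝒯.dualT M))

end PreTriangularDecomposition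

end Triangular

namespace GrMod

variable {K R : Type u} [Field K] [Ring R] [Algebra K R] [FiniteDimensional K R]
  {ℛ : ℤ → Submodule K R}

/-- A composition series `0 = F 0 ⊂ F 1 ⊂ ⋯ ⊂ F n = M` in `𝒢(R)`. -/
structure CompSeries (M : GrMod ℛ) where
  length : ℕ
  F : Fin (length + 1) → M.GrSub
  bot : (F 0).toSubmodule = ⊥
  top : (F (Fin.last length)).toSubmodule = ⊤
  le : ∀ i : Fin length, (F i.castSucc).toSubmodule ≤ (F i.succ).toSubmodule
  simple : ∀ i : Fin length, (subquot (F i.succ) (F i.castSucc)).IsSimple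

/-- The number of factors of a composition series that are isomorphic to `S`. -/
noncomputable def CompSeries.count {M : GrMod ℛ} (c : M.CompSeries) (S : GrMod ℛ) : ℕ :=
  Nat.card {i : Fin c.length // Nonempty (subquot (c.F i.succ) (c.F i.castSucc) ≅ S)}

open Classical in
/-- The multiplicity `[M : S]` of a simple object `S` in `M`: the number of factors isomorphic to
`S` in a composition series of `M`. Every object has a composition series, because it is
finite-dimensional, and the choice does not matter, by the Jordan-Hölder theorem. -/
noncomputable def multiplicity (M S : GrMod ℛ) : ℕ :=
  if h : Nonempty M.CompSeries then h.some.count S else 0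

end GrMod

namespace PreTriangularDecomposition

variable {K A : Type u} [Field K] [Ring A] [Algebra K A] {𝒜 : ℤ → Submodule K A} [GradedAlgebra 𝒜]

/-- `Irr 𝒢(T)`, the set of isomorphism classes of simple objects of `𝒢(T)`. -/
def Irr (𝒯 : PreTriangularDecomposition 𝒜) : Type (u + 1) :=
  Quotient ((isIsomorphicSetoid 𝒯.TMod).comap
    (Subtype.val : {M : 𝒯.TMod // M.IsSimple} → 𝒯.TMod))

/-- A simple object in the isomorphism class `l`. -/
noncomputable def rep (𝒯 : PreTriangularDecomposition 𝒜) (l : 𝒯.Irr) : 𝒯.TMod :=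
  (Quotient.out l).1

/-- The degree of `l ∈ Irr 𝒢(T)`. Since `T` is in degree zero, a simple object of `𝒢(T)` is
concentrated in a single degree, so that the following set has exactly one element. -/
noncomputable def deg (𝒯 : PreTriangularDecomposition 𝒜) (l : 𝒯.Irr) : ℤ :=
  sSup {i | (𝒯.rep l).grading i ≠ ⊥}

/-- The partial order on `Irr 𝒢(T)`: `l < m` if and only if `deg l < deg m`. -/
instance (𝒯 : PreTriangularDecomposition 𝒜) : PartialOrder 𝒯.Irr where
  le l m := l = m ∨ 𝒯.deg l < 𝒯.deg m
  lt l m := 𝒯.deg l < 𝒯.deg m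
  le_refl l := Or.inl rfl
  le_trans l m n := by
    rintro (rfl | h) (rfl | h')
    · exact Or.inl rfl
    · exact Or.inr h'
    · exact Or.inr h
    · exact Or.inr (h.trans h')
  le_antisymm l m := by
    rintro (rfl | h) (h' | h')
    · rfl
    · rfl
    · exact h'.symm
    · exact absurd h h'.asymm
  lt_iff_le_not_ge l m := by
    constructor
    · intro h
      refine ⟨Or.inr h, ?_⟩
      rintro (rfl | h')
      · exact lt_irrefl _ h
      · exact lt_asymm h h'
    · rintro ⟨rfl | h, h'⟩
      · exact absurd (Or.inl rfl) h'
      · exact h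

variable [FiniteDimensional K A] (𝒯 : PreTriangularDecomposition 𝒜)

/-- The standard object `Δ(l)`. In general it is obtained from the projective cover of `l` in
`𝒢(T)`, which is `l` itself for semisimple `T`. -/
noncomputable def Delta (l : 𝒯.Irr) : GrMod 𝒜 := 𝒯.standard (𝒯.rep l)

/-- The costandard object `∇(l)`. In general it is obtained from the injective hull of `l` in
`𝒢(T)`, which is `l` itself for semisimple `T`. -/
noncomputable def Nabla (l : 𝒯.Irr) : GrMod 𝒜 := 𝒯.costandard (𝒯.rep l)

/-- The simple object `L(l)`, the head of `Δ(l)`. -/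
noncomputable def L (l : 𝒯.Irr) : GrMod 𝒜 := (𝒯.Delta l).head

/-- `M` has highest weight `l`. -/
def HasHighestWeight (M : GrMod 𝒜) (l : 𝒯.Irr) : Prop :=
  (∀ m : 𝒯.Irr, M.multiplicity (𝒯.L m) ≠ 0 → m ≤ l) ∧ M.multiplicity (𝒯.L l) = 1

/-- `M` has a standard filtration `M = F 0 ⊇ F 1 ⊇ ⋯ ⊇ F s = 0`, with factors `Δ(l_i)`. -/
def IsStandardlyFiltered (M : GrMod 𝒜) : Prop :=
  ∃ (s : ℕ) (F : Fin (s + 1) → M.GrSub),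
    (F 0).toSubmodule = ⊤ ∧ (F (Fin.last s)).toSubmodule = ⊥ ∧
    ∀ i : Fin s, (F i.succ).toSubmodule ≤ (F i.castSucc).toSubmodule ∧
      ∃ l : 𝒯.Irr, Nonempty (GrMod.subquot (F i.castSucc) (F i.succ) ≅ 𝒯.Delta l)

/-- `M` has a costandard filtration `0 = F 0 ⊆ F 1 ⊆ ⋯ ⊆ F s = M`, with factors `∇(l_i)`. -/
def IsCostandardlyFiltered (M : GrMod 𝒜) : Prop :=
  ∃ (s : ℕ) (F : Fin (s + 1) → M.GrSub),
    (F 0).toSubmodule = ⊥ ∧ (F (Fin.last s)).toSubmodule = ⊤ ∧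
    ∀ i : Fin s, (F i.castSucc).toSubmodule ≤ (F i.succ).toSubmodule ∧
      ∃ l : 𝒯.Irr, Nonempty (GrMod.subquot (F i.succ) (F i.castSucc) ≅ 𝒯.Nabla l)

/-- Tilting objects: those with a standard and a costandard filtration. -/
def IsTilting (M : GrMod 𝒜) : Prop :=
  𝒯.IsStandardlyFiltered M ∧ 𝒯.IsCostandardlyFiltered M

end PreTriangularDecomposition

end GradedTilting

open GradedTilting

/-! The proof turns tilting into two dimension counts. By the triangular decomposition, `Δ(λ)` is
`A⁻ ⊗ λ` over `A⁻`, and dually `∇(λ)` is cofree over `A⁺`. Since `T` is semisimple, the converse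
holds for filtrations: in an object free over `A⁻`, a simple `T`-submodule `λ` of the highest
nonzero component generates a copy of `Δ(λ)`, and the quotient is again free; an object cofree over
`A⁺` maps onto `∇(λ)` with cofree kernel. Hence standardly filtered means free over `A⁻`, and
costandardly filtered means cofree over `A⁺` (`isStandardlyFiltered_of_isFree`,
`isCostandardlyFiltered_of_isCofree` and their converses). Both conditions are the equality cases of
general inequalities, `dim X ≤ dim A⁻ · dim (X / A⁻_{<0} X)` and `dim X ≤ dim A⁺ · dim {x | A⁺_{>0}
x = 0}`. So their stability under summands, extensions and the removal of a `Δ` or a `∇` is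
arithmetic.

`A` is visibly free over `A⁻`. It is also free as a right `A⁺`-module, so if `A` is self-injective
it is injective over `A⁺`, and counting dimensions makes it cofree (`isCofree_self`). The
indecomposable projectives are summands of shifts of `A`, hence tilting.

An indecomposable projective `P` is also injective, so any two nonzero subobjects of it meet.
Freeness then forces its highest component to be a single simple `T`-module, because independent
`T`-submodules there would generate independent subobjects (`topIs_of_isUniform`). For `P(λ)` this
module is `λ^h`. It gives the highest weight, an embedding `Δ(λ^h) → P(λ)` and a surjection `P(λ) →
∇(λ^h)`. Comparing socles gives `ν(λ) = (λ^h)^†`, which is why the two descriptions of `T(λ)` agree.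
The maps `h` and `†` are injective because an indecomposable injective is determined by any nonzero
subobject. The map `h` is surjective because every `λ` occurs in the top component of a shift of `A`
(`exists_isPIM_topIs`), and `†` is surjective because it commutes with shifts and `T` has finitely
many simple modules (`dag_surjective`).

Finally, let `X` be indecomposable tilting with `λ` in its top component, and let `Q` be the
indecomposable projective with top component `λ`. Injectivity of `Q` extends a map from the top part
of `X` to `f : X → Q`, and projectivity of `Q` lifts `Q → ∇(λ)` through `X → ∇(λ)` to `g : Q → X`.
Then `f ∘ g` is the identity on the top component of `Q`, hence bijective by Fitting's lemma, and `X
≅ Q` (`exists_iso_of_isTilting`). -/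

set_option linter.unusedSectionVars false

namespace GradedTilting

namespace GrMod

/-! ### Graded modules: subobjects, Fitting's lemma, injectivity and projectivity. -/

section Toolkit

variable {K R : Type u} [Field K] [Ring R] [Algebra K R] {ℛ : ℤ → Submodule K R}

@[simp] theorem comp_toLin {M N P : GrMod ℛ} (f : M ⟶ N) (g : N ⟶ P) :
    (f ≫ g).toLin = g.toLin ∘ₗ f.toLin := rfl

theorem hom_ext {M N : GrMod ℛ} {f g : M ⟶ N} (h : f.toLin = g.toLin) : f = g :=
  Hom.ext h

/-- Two additive maps agreeing on homogeneous elements are equal. -/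
theorem homogeneous_induction {M : GrMod ℛ} {p : M → Prop} (h0 : p 0)
    (hh : ∀ i, ∀ m ∈ M.grading i, p m) (ha : ∀ m m', p m → p m' → p (m + m')) (m : M) : p m := by
  induction m using DirectSum.Decomposition.inductionOn M.grading with
  | zero => exact h0
  | @homogeneous i m => exact hh i m m.2
  | add m m' h h' => exact ha m m' h h'

theorem proj_of_mem (M : GrMod ℛ) {i j : ℤ} {m : M} (h : m ∈ M.grading i) :
    M.proj j m = if i = j then m else 0 := by
  split_ifs with hij
  · subst hij; exact M.proj_same h
  · exact M.proj_ne h hij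

/-- An `R`-linear map that shifts degrees by `n` commutes with the projections. -/
theorem map_proj_shift {M N : GrMod ℛ} (f : M →ₗ[R] N) (n : ℤ)
    (hf : ∀ i, ∀ m ∈ M.grading i, f m ∈ N.grading (i + n)) (i : ℤ) (m : M) :
    f (M.proj i m) = N.proj (i + n) (f m) := by
  induction m using homogeneous_induction with
  | h0 => simp
  | hh j m hm =>
    rw [M.proj_of_mem hm, N.proj_of_mem (hf j m hm)]
    by_cases h : j = i
    · simp [h]
    · rw [if_neg h, if_neg (by omega), map_zero]
  | ha m m' h h' => simp [map_add, h, h']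

theorem map_proj {M N : GrMod ℛ} (f : M ⟶ N) (i : ℤ) (m : M) :
    f.toLin (M.proj i m) = N.proj i (f.toLin m) := by
  have := map_proj_shift f.toLin 0 (fun i m h => by rw [add_zero]; exact f.map_mem i m h) i m
  rwa [add_zero] at this

theorem ext_proj {M : GrMod ℛ} {m m' : M} (h : ∀ i, M.proj i m = M.proj i m') : m = m' := by
  obtain ⟨s, hs⟩ := M.exists_sum_proj (m - m')
  rw [← sub_eq_zero, ← hs]
  exact Finset.sum_eq_zero fun i _ => by rw [map_sub, h, sub_self]

theorem mem_grading_of_proj {M : GrMod ℛ} {i : ℤ} {m : M}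
    (h : ∀ j, j ≠ i → M.proj j m = 0) : m ∈ M.grading i := by
  have : m = M.proj i m := ext_proj fun j => by
    rw [M.proj_of_mem (M.proj_mem i m)]
    split_ifs with hj
    · rw [hj]
    · exact h j (Ne.symm hj)
  rw [this]
  exact M.proj_mem i m

theorem exists_grading_ne_bot (M : GrMod ℛ) [Nontrivial M] : ∃ i, M.grading i ≠ ⊥ := by
  by_contra! h
  obtain ⟨m, hm⟩ := exists_ne (0 : M)
  refine hm (ext_proj fun i => ?_)
  have := M.proj_mem i m
  rw [h i, Submodule.mem_bot] at this
  rw [this, map_zero]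

theorem finite_grading_ne_bot [FiniteDimensional K R] (M : GrMod ℛ) :
    {i | M.grading i ≠ ⊥}.Finite := by
  have := M.finite_base
  have h := (DirectSum.isInternal_submodule_iff_iSupIndep_and_iSup_eq_top _).1 M.isInternal
  exact WellFoundedGT.finite_ne_bot_of_iSupIndep h.1

/-- The largest degree in which a nonzero object is nonzero. -/
theorem exists_top_degree [FiniteDimensional K R] (M : GrMod ℛ) [Nontrivial M] :
    ∃ d, M.grading d ≠ ⊥ ∧ ∀ i, d < i → M.grading i = ⊥ := by
  obtain ⟨d, hd, hmax⟩ := Set.exists_max_image _ id M.finite_grading_ne_bot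
    M.exists_grading_ne_bot
  exact ⟨d, hd, fun i hi => by_contra fun h => absurd (hmax i h) (not_le.2 hi)⟩

/-- A submodule closed under the projections, as a graded submodule. -/
def GrSub.mk' {M : GrMod ℛ} (N : Submodule R M) (h : ∀ i, ∀ m ∈ N, M.proj i m ∈ N) : M.GrSub :=
  ⟨N, fun i _ hm => h i _ hm⟩

theorem GrSub.proj_mem {M : GrMod ℛ} (N : M.GrSub) (i : ℤ) {m : M} (h : m ∈ N.toSubmodule) :
    M.proj i m ∈ N.toSubmodule := N.isHomogeneous i h

theorem GrSub.ext' {M : GrMod ℛ} {N N' : M.GrSub} (h : N.toSubmodule = N'.toSubmodule) :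
    N = N' := by
  cases N; cases N'; congr

def botSub (M : GrMod ℛ) : M.GrSub := GrSub.mk' ⊥ fun i m hm => by
  rw [(Submodule.mem_bot R).1 hm, map_zero]; exact zero_mem _

def topSub (M : GrMod ℛ) : M.GrSub := GrSub.mk' ⊤ fun _ _ _ => trivial

def supSub {M : GrMod ℛ} (N N' : M.GrSub) : M.GrSub :=
  GrSub.mk' (N.toSubmodule ⊔ N'.toSubmodule) fun i m hm => by
    obtain ⟨x, hx, y, hy, rfl⟩ := Submodule.mem_sup.1 hm
    rw [map_add]
    exact Submodule.add_mem_sup (N.proj_mem i hx) (N'.proj_mem i hy)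

def comapSub {M N : GrMod ℛ} (f : M ⟶ N) (N' : N.GrSub) : M.GrSub :=
  GrSub.mk' (N'.toSubmodule.comap f.toLin) fun i m hm => by
    rw [Submodule.mem_comap, map_proj]; exact N'.proj_mem i hm

def mapSub {M N : GrMod ℛ} (f : M ⟶ N) (M' : M.GrSub) : N.GrSub :=
  GrSub.mk' (M'.toSubmodule.map f.toLin) fun i _ hm => by
    obtain ⟨m, hm, rfl⟩ := hm
    exact ⟨M.proj i m, M'.proj_mem i hm, map_proj f i m⟩

def kerSub {M N : GrMod ℛ} (f : M ⟶ N) : M.GrSub :=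
  GrSub.mk' (LinearMap.ker f.toLin) fun i m hm => by
    rw [LinearMap.mem_ker, map_proj, LinearMap.mem_ker.1 hm, map_zero]

def rangeSub {M N : GrMod ℛ} (f : M ⟶ N) : N.GrSub :=
  GrSub.mk' (LinearMap.range f.toLin) fun i _ hm => by
    obtain ⟨m, rfl⟩ := hm
    exact ⟨M.proj i m, map_proj f i m⟩

@[simp] theorem kerSub_toSubmodule {M N : GrMod ℛ} (f : M ⟶ N) :
    (kerSub f).toSubmodule = LinearMap.ker f.toLin := rfl

@[simp] theorem rangeSub_toSubmodule {M N : GrMod ℛ} (f : M ⟶ N) :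
    (rangeSub f).toSubmodule = LinearMap.range f.toLin := rfl

@[simp] theorem comapSub_toSubmodule {M N : GrMod ℛ} (f : M ⟶ N) (N' : N.GrSub) :
    (comapSub f N').toSubmodule = N'.toSubmodule.comap f.toLin := rfl

@[simp] theorem mapSub_toSubmodule {M N : GrMod ℛ} (f : M ⟶ N) (N' : M.GrSub) :
    (mapSub f N').toSubmodule = N'.toSubmodule.map f.toLin := rfl

@[simp] theorem supSub_toSubmodule {M : GrMod ℛ} (N N' : M.GrSub) :
    (supSub N N').toSubmodule = N.toSubmodule ⊔ N'.toSubmodule := rfl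

/-- The linear equivalence underlying an isomorphism. -/
def isoEquiv {M N : GrMod ℛ} (e : M ≅ N) : M ≃ₗ[R] N :=
  LinearEquiv.ofLinearMap e.hom.toLin e.inv.toLin
    (congrArg Hom.toLin e.inv_hom_id) (congrArg Hom.toLin e.hom_inv_id)

theorem iso_bijective {M N : GrMod ℛ} (e : M ≅ N) : Function.Bijective e.hom.toLin :=
  (isoEquiv e).bijective

theorem inverse_map_mem {M N : GrMod ℛ} (f : M ⟶ N) (e : M ≃ₗ[R] N) (he : ∀ m, e m = f.toLin m)
    (i : ℤ) (n : N) (hn : n ∈ N.grading i) : e.symm n ∈ M.grading i := by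
  refine mem_grading_of_proj fun j hj => e.injective ?_
  rw [he, map_proj, ← he, e.apply_symm_apply, map_zero, N.proj_ne hn hj.symm]

/-- A bijective morphism is an isomorphism. -/
noncomputable def isoOfBijective {M N : GrMod ℛ} (f : M ⟶ N) (hf : Function.Bijective f.toLin) :
    M ≅ N where
  hom := f
  inv := ⟨(LinearEquiv.ofBijective f.toLin hf).symm.toLinearMap,
    inverse_map_mem f _ fun _ => rfl⟩
  hom_inv_id := hom_ext (LinearMap.ext fun x =>
    (LinearEquiv.ofBijective f.toLin hf).symm_apply_apply x)
  inv_hom_id := hom_ext (LinearMap.ext fun x =>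
    (LinearEquiv.ofBijective f.toLin hf).apply_symm_apply x)

def zeroHom (M N : GrMod ℛ) : M ⟶ N := ⟨0, fun i _ _ => zero_mem (N.grading i)⟩

def mkQ {M : GrMod ℛ} (N : M.GrSub) : M ⟶ quot N :=
  ⟨N.toSubmodule.mkQ, fun _ m hm => ⟨m, hm, rfl⟩⟩

theorem mkQ_surjective {M : GrMod ℛ} (N : M.GrSub) : Function.Surjective (mkQ N).toLin :=
  N.toSubmodule.mkQ_surjective

@[simp] theorem ker_mkQ {M : GrMod ℛ} (N : M.GrSub) :
    LinearMap.ker (mkQ N).toLin = N.toSubmodule :=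
  N.toSubmodule.ker_mkQ

/-- The morphism from a quotient induced by a morphism. -/
def liftQ {M N : GrMod ℛ} (S : M.GrSub) (f : M ⟶ N) (h : S.toSubmodule ≤ LinearMap.ker f.toLin) :
    quot S ⟶ N where
  toLin := S.toSubmodule.liftQ f.toLin h
  map_mem := by
    rintro i _ ⟨m, hm, rfl⟩
    exact f.map_mem i m hm

/-- A surjective morphism induces an isomorphism from the quotient by its kernel. -/
noncomputable def quotIso {M N : GrMod ℛ} (S : M.GrSub) (f : M ⟶ N)
    (h : S.toSubmodule = LinearMap.ker f.toLin) (hf : Function.Surjective f.toLin) :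
    quot S ≅ N :=
  isoOfBijective (liftQ S f h.le) ⟨by
    rw [← LinearMap.ker_eq_bot]
    exact Submodule.ker_liftQ_eq_bot _ _ _ h.ge, fun n => by
    obtain ⟨m, rfl⟩ := hf n
    exact ⟨(mkQ S).toLin m, rfl⟩⟩

/-- The quotient map by the range and the zero map agree after `f`, so they are equal. This connects
the categorical `Projective` with lifting along surjections. -/
theorem epi_surjective {M N : GrMod ℛ} (f : M ⟶ N) [Epi f] : Function.Surjective f.toLin := by
  have h : f ≫ mkQ (rangeSub f) = f ≫ zeroHom N (quot (rangeSub f)) :=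
    hom_ext (LinearMap.range_mkQ_comp f.toLin)
  have h2 := congrArg Hom.toLin ((cancel_epi f).1 h)
  rw [← LinearMap.range_eq_top, ← rangeSub_toSubmodule, ← ker_mkQ, h2]
  exact LinearMap.ker_zero

theorem exists_lift_grading {M N : GrMod ℛ} (f : M ⟶ N) (hf : Function.Surjective f.toLin) {i : ℤ}
    {n : N} (hn : n ∈ N.grading i) : ∃ m ∈ M.grading i, f.toLin m = n := by
  obtain ⟨m, rfl⟩ := hf n
  exact ⟨M.proj i m, M.proj_mem i m, by rw [map_proj, N.proj_same hn]⟩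

theorem grading_eq_bot_of_surjective {M N : GrMod ℛ} (f : M ⟶ N)
    (hf : Function.Surjective f.toLin) {i : ℤ} (h : M.grading i = ⊥) : N.grading i = ⊥ := by
  rw [eq_bot_iff]
  intro n hn
  obtain ⟨m, hm, rfl⟩ := exists_lift_grading f hf hn
  rw [h, Submodule.mem_bot] at hm
  rw [hm, map_zero]; exact zero_mem _

theorem grading_eq_bot_of_injective {M N : GrMod ℛ} (f : M ⟶ N)
    (hf : Function.Injective f.toLin) {i : ℤ} (h : N.grading i = ⊥) : M.grading i = ⊥ := by
  rw [eq_bot_iff]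
  intro m hm
  have := f.map_mem i m hm
  rw [h, Submodule.mem_bot] at this
  exact hf (this.trans (map_zero _).symm)

/-- If `f ∘ g` is bijective and the middle object is indecomposable, then `g` is bijective. -/
theorem IsIndecomposable.bijective_of_comp {M X : GrMod ℛ} (hX : X.IsIndecomposable) [Nontrivial M]
    (g : M ⟶ X) (f : X ⟶ M) (h : Function.Bijective (f.toLin ∘ₗ g.toLin)) :
    Function.Bijective g.toLin := by
  have hinj : Function.Injective g.toLin := fun x y hxy => h.1 (congrArg f.toLin hxy)
  refine ⟨hinj, ?_⟩
  have hc : IsCompl (rangeSub g).toSubmodule (kerSub f).toSubmodule := by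
    constructor
    · rw [Submodule.disjoint_def]
      rintro _ ⟨m, rfl⟩ hm
      have : m = 0 := h.1 ((LinearMap.mem_ker.1 hm).trans (map_zero _).symm)
      rw [this, map_zero]
    · rw [codisjoint_iff, eq_top_iff]
      intro x _
      obtain ⟨m, hm⟩ := h.2 (f.toLin x)
      rw [← add_sub_cancel (g.toLin m) x]
      refine Submodule.add_mem_sup ⟨m, rfl⟩ ?_
      rw [kerSub_toSubmodule, LinearMap.mem_ker, map_sub, ← hm]
      exact sub_self _
  rcases hX.2 _ _ hc with h' | h'
  · obtain ⟨m, hm⟩ := exists_ne (0 : M)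
    refine absurd (hinj ?_) hm
    rw [map_zero]
    exact (Submodule.mem_bot R).1 (h' ▸ (⟨m, rfl⟩ : g.toLin m ∈ (rangeSub g).toSubmodule))
  · rw [h'] at hc
    exact LinearMap.range_eq_top.1 (by simpa using hc.sup_eq_top)

/-- Objects in which any two nonzero subobjects meet. -/
def IsUniform (M : GrMod ℛ) : Prop :=
  Nontrivial M ∧ ∀ N N' : M.GrSub, N.toSubmodule ⊓ N'.toSubmodule = ⊥ →
    N.toSubmodule = ⊥ ∨ N'.toSubmodule = ⊥

/-- Objects with exactly one maximal subobject. -/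
def IsLocal (M : GrMod ℛ) : Prop :=
  Nontrivial M ∧ ∀ N N' : M.GrSub, N.toSubmodule ⊔ N'.toSubmodule = ⊤ →
    N.toSubmodule = ⊤ ∨ N'.toSubmodule = ⊤

/-- Relative injectivity with respect to injective morphisms. -/
def HasExtensions (E : GrMod ℛ) : Prop :=
  ∀ {X Y : GrMod ℛ} (i : X ⟶ Y) (f : X ⟶ E), Function.Injective i.toLin →
    ∃ g : Y ⟶ E, ∀ x, g.toLin (i.toLin x) = f.toLin x

/-- Relative projectivity with respect to surjective morphisms. -/
def HasLifts (P : GrMod ℛ) : Prop :=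
  ∀ {X Y : GrMod ℛ} (e : X ⟶ Y) (f : P ⟶ Y), Function.Surjective e.toLin →
    ∃ g : P ⟶ X, ∀ x, e.toLin (g.toLin x) = f.toLin x

theorem HasLifts.projective {P : GrMod ℛ} (hP : P.HasLifts) : Projective P where
  factors f e _ := by
    obtain ⟨g, hg⟩ := hP e f (epi_surjective e)
    exact ⟨g, hom_ext (LinearMap.ext hg)⟩

variable [FiniteDimensional K R]

instance (M : GrMod ℛ) : FiniteDimensional K M := M.finite_base

instance (M : GrMod ℛ) : IsNoetherian R M := isNoetherian_of_tower K inferInstance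

instance (M : GrMod ℛ) : IsArtinian R M := isArtinian_of_tower K inferInstance

def incl {M : GrMod ℛ} (N : M.GrSub) : ofSub N ⟶ M := ⟨N.toSubmodule.subtype, fun _ _ h => h⟩

theorem incl_injective {M : GrMod ℛ} (N : M.GrSub) : Function.Injective (incl N).toLin :=
  Subtype.val_injective

@[simp] theorem range_incl {M : GrMod ℛ} (N : M.GrSub) :
    LinearMap.range (incl N).toLin = N.toSubmodule := N.toSubmodule.range_subtype

theorem incl_mem {M : GrMod ℛ} (N : M.GrSub) (x : ofSub N) :
    (incl N).toLin x ∈ N.toSubmodule := x.2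

/-- Restriction of the codomain to a graded submodule containing the range. -/
def codRestrict {M N : GrMod ℛ} (S : N.GrSub) (f : M ⟶ N) (h : ∀ m, f.toLin m ∈ S.toSubmodule) :
    M ⟶ ofSub S :=
  ⟨f.toLin.codRestrict S.toSubmodule h, fun i m hm => f.map_mem i m hm⟩

theorem codRestrict_injective {M N : GrMod ℛ} (S : N.GrSub) (f : M ⟶ N)
    (h : ∀ m, f.toLin m ∈ S.toSubmodule) (hf : Function.Injective f.toLin) :
    Function.Injective (codRestrict S f h).toLin := fun _ _ hxy =>
  hf (congrArg (incl S).toLin hxy)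

/-- An injective morphism is an isomorphism onto its range. -/
noncomputable def isoRange {M N : GrMod ℛ} (f : M ⟶ N) (hf : Function.Injective f.toLin) :
    M ≅ ofSub (rangeSub f) :=
  isoOfBijective (codRestrict (rangeSub f) f fun m => ⟨m, rfl⟩)
    ⟨codRestrict_injective _ _ _ hf, by rintro ⟨_, m, rfl⟩; exact ⟨m, rfl⟩⟩

/-- A surjection from `N'` onto `X` with kernel `N` identifies the subquotient `N' / N` with
`X`. -/
noncomputable def subquotIso {M X : GrMod ℛ} (N' N : M.GrSub) (f : ofSub N' ⟶ X)
    (hf : Function.Surjective f.toLin)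
    (h : ∀ x : ofSub N', f.toLin x = 0 ↔ (incl N').toLin x ∈ N.toSubmodule) :
    subquot N' N ≅ X :=
  quotIso (N.within N') f (Submodule.ext fun x => (h x).symm) hf

/-- The projection from a graded submodule onto a subquotient. -/
def toSubquot {M : GrMod ℛ} (N' N : M.GrSub) : ofSub N' ⟶ subquot N' N := mkQ (N.within N')

theorem toSubquot_surjective {M : GrMod ℛ} (N' N : M.GrSub) :
    Function.Surjective (toSubquot N' N).toLin := mkQ_surjective _

theorem toSubquot_eq_zero {M : GrMod ℛ} (N' N : M.GrSub) (x : ofSub N') :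
    (toSubquot N' N).toLin x = 0 ↔ (incl N').toLin x ∈ N.toSubmodule :=
  (Submodule.Quotient.mk_eq_zero _)

/-- An endomorphism of an indecomposable object is bijective or nilpotent. -/
theorem IsIndecomposable.bijective_or_nilpotent {M : GrMod ℛ} (hM : M.IsIndecomposable)
    (f : M ⟶ M) : Function.Bijective f.toLin ∨ ∃ n : ℕ, f.toLin ^ n = 0 := by
  obtain ⟨n, hn⟩ := (f.toLin.eventually_isCompl_ker_pow_range_pow).exists_forall_of_atTop
  have hpow : ∀ (k i : ℕ) (j : ℤ) (m : M), (f.toLin ^ k) (M.proj j m) =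
      M.proj j ((f.toLin ^ k) m) := by
    intro k i j m
    induction k with
    | zero => rfl
    | succ k ih => rw [pow_succ', Module.End.mul_apply, Module.End.mul_apply, ih, map_proj]
  -- Fitting decomposition. The exponent is `n + 1` because the kernel of a positive power contains
  -- the kernel of `f`, so its vanishing gives injectivity.
  have h := hM.2
    (GrSub.mk' (LinearMap.ker (f.toLin ^ (n + 1))) fun i m hm => by
      rw [LinearMap.mem_ker, hpow _ 0, LinearMap.mem_ker.1 hm, map_zero])
    (GrSub.mk' (LinearMap.range (f.toLin ^ (n + 1))) fun i _ hm => by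
      obtain ⟨m, rfl⟩ := hm
      exact ⟨M.proj i m, hpow _ 0 _ _⟩) (hn (n + 1) (Nat.le_succ n))
  rcases h with h | h
  · left
    have hinj : Function.Injective f.toLin := by
      rw [← LinearMap.ker_eq_bot, eq_bot_iff]
      intro x hx
      rw [← (show LinearMap.ker (f.toLin ^ (n + 1)) = ⊥ from h), LinearMap.mem_ker, pow_succ,
        Module.End.mul_apply, LinearMap.mem_ker.1 hx, map_zero]
    exact ⟨hinj, IsArtinian.surjective_of_injective_endomorphism f.toLin hinj⟩
  · right
    exact ⟨n + 1, LinearMap.range_eq_bot.1 h⟩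

theorem proj_smul_of_mem {M : GrMod ℛ} {i : ℤ} {r : R} (hr : r ∈ ℛ i) (j : ℤ) (m : M) :
    M.proj (i + j) (r • m) = r • M.proj j m := by
  induction m using homogeneous_induction with
  | h0 => simp
  | hh k m hm =>
    rw [M.proj_of_mem hm, M.proj_of_mem (M.smul_mem i k r m hr hm)]
    by_cases h : k = j
    · simp [h]
    · rw [if_neg h, if_neg (by omega), smul_zero]
  | ha m m' h h' => simp [smul_add, map_add, h, h']

/-- An ungraded injective module is injective in the graded category. -/
theorem hasExtensions_of_injective [GradedAlgebra ℛ] (E : GrMod ℛ) (hE : Module.Injective R E) :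
    E.HasExtensions := by
  intro X Y i f hi
  obtain ⟨h, hh⟩ := hE.out i.toLin hi f.toLin
  -- The ungraded extension `h` is replaced by its degree zero part, the sum over `j` of `proj j ∘ h
  -- ∘ proj j`. The sum is finite since `Y` lives in finitely many degrees.
  let p : ℤ → Y → E := fun j y => E.proj j (h (Y.proj j y))
  have hfin : ∀ y : Y, (Function.support fun j => p j y).Finite := fun y =>
    Y.finite_grading_ne_bot.subset fun j hj hb => hj (by
      have := Y.proj_mem j y
      rw [hb, Submodule.mem_bot] at this
      simp only [p, this, map_zero])
  have hadd : ∀ y y' : Y, ∑ᶠ k, p k (y + y') = ∑ᶠ k, p k y + ∑ᶠ k, p k y' := by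
    intro y y'
    rw [← finsum_add_distrib (hfin y) (hfin y')]
    simp only [p, map_add]
  let g : Y →+ E := AddMonoidHom.mk' (fun y => ∑ᶠ k, p k y) hadd
  have hg : ∀ (j : ℤ) (y : Y), y ∈ Y.grading j → g y = E.proj j (h y) := by
    intro j y hy
    change ∑ᶠ k, p k y = _
    rw [finsum_eq_single _ j]
    · simp only [p, Y.proj_same hy]
    · intro k hk
      simp only [p, Y.proj_ne hy hk.symm, map_zero]
  have hsmul : ∀ (r : R) (y : Y), g (r • y) = r • g y := by
    intro r y
    induction y using homogeneous_induction with
    | h0 => simp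
    | ha y y' h1 h2 => rw [smul_add, map_add, map_add, smul_add, h1, h2]
    | hh j y hy =>
      induction r using DirectSum.Decomposition.inductionOn ℛ with
      | zero => simp
      | add r r' h1 h2 => rw [add_smul, map_add, h1, h2, add_smul]
      | @homogeneous k r =>
        rw [hg j y hy, hg _ _ (Y.smul_mem k j r y r.2 hy), map_smul, proj_smul_of_mem r.2]
  refine ⟨⟨{ toFun := g, map_add' := map_add g, map_smul' := hsmul }, ?_⟩, ?_⟩
  · intro j y hy
    change g y ∈ _
    rw [hg j y hy]
    exact E.proj_mem _ _
  · intro x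
    change g (i.toLin x) = f.toLin x
    induction x using homogeneous_induction with
    | h0 => simp
    | ha y y' h1 h2 => rw [map_add, map_add, map_add, h1, h2]
    | hh j x hx => rw [hg j _ (i.map_mem j x hx), hh, E.proj_same (f.map_mem j x hx)]

/-- If `N` and `N'` meet in zero, `N` embeds in `M / N'`, and the inclusion `N → M` extends to `M /
N'`. The resulting endomorphism of `M` is the identity on `N` and zero on `N'`; being bijective or
nilpotent, it forces one of the two to vanish. -/
theorem IsIndecomposable.isUniform {M : GrMod ℛ} (hM : M.IsIndecomposable)
    (hE : M.HasExtensions) : M.IsUniform := by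
  refine ⟨hM.1, fun N N' hN => ?_⟩
  have hinj : Function.Injective (incl N ≫ mkQ N').toLin := by
    rw [← LinearMap.ker_eq_bot, eq_bot_iff]
    intro x hx
    have hx' : (incl N).toLin x ∈ N'.toSubmodule := (Submodule.Quotient.mk_eq_zero _).1 hx
    have : (incl N).toLin x ∈ N.toSubmodule ⊓ N'.toSubmodule := ⟨x.2, hx'⟩
    rw [hN, Submodule.mem_bot] at this
    exact (Submodule.mem_bot R).2 (incl_injective N (this.trans (map_zero _).symm))
  obtain ⟨g, hg⟩ := hE (incl N ≫ mkQ N') (incl N) hinj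
  have h1 : ∀ x ∈ N.toSubmodule, (mkQ N' ≫ g).toLin x = x := fun x hx => hg ⟨x, hx⟩
  have h2 : ∀ x ∈ N'.toSubmodule, (mkQ N' ≫ g).toLin x = 0 := fun x hx => by
    have : (mkQ N').toLin x = 0 := (Submodule.Quotient.mk_eq_zero _).2 hx
    rw [comp_toLin, LinearMap.comp_apply, this, map_zero]
  rcases hM.bijective_or_nilpotent (mkQ N' ≫ g) with h | ⟨n, h⟩
  · right
    rw [eq_bot_iff]
    exact fun x hx => h.1 ((h2 x hx).trans (map_zero _).symm)
  · left
    rw [eq_bot_iff]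
    intro x hx
    have : ∀ k : ℕ, ((mkQ N' ≫ g).toLin ^ k) x = x := by
      intro k
      induction k with
      | zero => rfl
      | succ k ih => rw [pow_succ, Module.End.mul_apply, h1 x hx, ih]
    rw [Submodule.mem_bot, ← this n, h, LinearMap.zero_apply]

/-- Dual to `IsIndecomposable.isUniform`: if `N + N' = M`, the map `M → M / N` lifts to `N'`, giving
an endomorphism with image in `N'` that is congruent to the identity modulo `N`. -/
theorem IsIndecomposable.isLocal {M : GrMod ℛ} (hM : M.IsIndecomposable)
    (hP : M.HasLifts) : M.IsLocal := by
  refine ⟨hM.1, fun N N' hN => ?_⟩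
  have hsurj : Function.Surjective (incl N' ≫ mkQ N).toLin := by
    intro y
    obtain ⟨x, rfl⟩ := mkQ_surjective N y
    have hx : x ∈ N.toSubmodule ⊔ N'.toSubmodule := hN ▸ Submodule.mem_top
    obtain ⟨a, ha, b, hb, rfl⟩ := Submodule.mem_sup.1 hx
    refine ⟨⟨b, hb⟩, ?_⟩
    have : (mkQ N).toLin a = 0 := (Submodule.Quotient.mk_eq_zero _).2 ha
    rw [map_add, this, zero_add]
    rfl
  obtain ⟨g, hg⟩ := hP (incl N' ≫ mkQ N) (mkQ N) hsurj
  have h1 : ∀ x, (g ≫ incl N').toLin x - x ∈ N.toSubmodule := fun x =>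
    (Submodule.Quotient.eq _).1 (hg x)
  rcases hM.bijective_or_nilpotent (g ≫ incl N') with h | ⟨n, h⟩
  · right
    rw [eq_top_iff]
    intro x _
    obtain ⟨y, rfl⟩ := h.2 x
    exact (g.toLin y).2
  · left
    rw [eq_top_iff]
    intro x _
    have : ∀ (k : ℕ), ((g ≫ incl N').toLin ^ k) x - x ∈ N.toSubmodule := by
      intro k
      induction k with
      | zero => rw [pow_zero, Module.End.one_apply, sub_self]; exact zero_mem _
      | succ k ih =>
        rw [pow_succ', Module.End.mul_apply]
        have := add_mem (h1 (((g ≫ incl N').toLin ^ k) x)) ih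
        rwa [sub_add_sub_cancel] at this
    have h3 := this n
    rw [h, LinearMap.zero_apply, zero_sub] at h3
    exact neg_mem_iff.1 h3

/-- The kernel of `f` meets the nonzero range of `i` trivially, so uniformity kills it. -/
theorem IsUniform.injective_of_comp {S E E' : GrMod ℛ} (hE : E.IsUniform) [Nontrivial S]
    (i : S ⟶ E) (f : E ⟶ E') (hi : Function.Injective i.toLin)
    (h : Function.Injective (f.toLin ∘ₗ i.toLin)) : Function.Injective f.toLin := by
  have := hE.2 (kerSub f) (rangeSub i) (by
    rw [eq_bot_iff]
    rintro _ ⟨hx, x, rfl⟩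
    have : x = 0 := h ((LinearMap.mem_ker.1 hx).trans (map_zero _).symm)
    rw [this, map_zero]; exact zero_mem _)
  rcases this with h' | h'
  · exact LinearMap.ker_eq_bot.1 h'
  · obtain ⟨m, hm⟩ := exists_ne (0 : S)
    refine absurd (hi ?_) hm
    rw [map_zero]
    exact (Submodule.mem_bot R).1 (h' ▸ (⟨m, rfl⟩ : i.toLin m ∈ (rangeSub i).toSubmodule))

/-- Uniqueness of injective hulls. The extensions in the two directions are injective by uniformity,
and an injective endomorphism of an artinian module is surjective. -/
theorem IsUniform.iso {S E E' : GrMod ℛ} (hE : E.IsUniform) (hE' : E'.IsUniform) [Nontrivial S]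
    (h : E.HasExtensions) (h' : E'.HasExtensions) (i : S ⟶ E) (i' : S ⟶ E')
    (hi : Function.Injective i.toLin) (hi' : Function.Injective i'.toLin) : Nonempty (E ≅ E') := by
  obtain ⟨f, hf⟩ := h' i i' hi
  obtain ⟨g, hg⟩ := h i' i hi'
  have hfi : Function.Injective f.toLin := hE.injective_of_comp i f hi fun x y hxy => hi'
    ((hf x).symm.trans (hxy.trans (hf y)))
  have hgi : Function.Injective g.toLin := hE'.injective_of_comp i' g hi' fun x y hxy => hi
    ((hg x).symm.trans (hxy.trans (hg y)))
  refine ⟨isoOfBijective f ⟨hfi, ?_⟩⟩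
  have := IsArtinian.surjective_of_injective_endomorphism (f.toLin ∘ₗ g.toLin) (hfi.comp hgi)
  exact Function.Surjective.of_comp this

theorem eq_bot_of_map_eq_bot {M N : GrMod ℛ} {f : M →ₗ[R] N} (hf : Function.Injective f)
    {S : Submodule R M} (h : S.map f = ⊥) : S = ⊥ :=
  Submodule.map_injective_of_injective hf (h.trans (Submodule.map_bot _).symm)

theorem IsUniform.of_injective {M E : GrMod ℛ} (hE : E.IsUniform) [hM : Nontrivial M] (i : M ⟶ E)
    (hi : Function.Injective i.toLin) : M.IsUniform := by
  refine ⟨hM, fun N N' h => ?_⟩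
  have := hE.2 (mapSub i N) (mapSub i N') (by
    rw [mapSub_toSubmodule, mapSub_toSubmodule, ← Submodule.map_inf _ hi, h, Submodule.map_bot])
  exact this.imp (fun h => eq_bot_of_map_eq_bot hi h)
    (fun h => eq_bot_of_map_eq_bot hi h)

theorem isSimple_of_surjective {M N : GrMod ℛ} (hM : M.IsSimple) [hN : Nontrivial N] (f : M ⟶ N)
    (hf : Function.Surjective f.toLin) : N.IsSimple := by
  refine ⟨hN, fun S => ?_⟩
  rcases hM.2 (comapSub f S) with h | h
  · left
    rw [← Submodule.map_comap_eq_of_surjective hf S.toSubmodule]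
    exact (congrArg (Submodule.map f.toLin) h).trans (Submodule.map_bot _)
  · right
    rw [← Submodule.map_comap_eq_of_surjective hf S.toSubmodule]
    refine (congrArg (Submodule.map f.toLin) h).trans ?_
    rw [Submodule.map_top, LinearMap.range_eq_top.2 hf]

theorem IsSimple.of_iso {M N : GrMod ℛ} (hM : M.IsSimple) (e : M ≅ N) : N.IsSimple := by
  have := hM.1
  have : Nontrivial N := (isoEquiv e).symm.toEquiv.nontrivial
  exact isSimple_of_surjective hM e.hom (iso_bijective e).2

theorem IsSimple.surjective {S N : GrMod ℛ} (hS : S.IsSimple) (f : N ⟶ S) (hf : f.toLin ≠ 0) :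
    Function.Surjective f.toLin := by
  rcases hS.2 (rangeSub f) with h | h
  · exact absurd (LinearMap.range_eq_bot.1 h) hf
  · exact LinearMap.range_eq_top.1 h

theorem IsSimple.ofSub_of_minimal {M : GrMod ℛ} (N : M.GrSub) (h0 : N.toSubmodule ≠ ⊥)
    (h : ∀ N' : M.GrSub, N'.toSubmodule ≤ N.toSubmodule → N'.toSubmodule = ⊥ ∨
      N'.toSubmodule = N.toSubmodule) : (ofSub N).IsSimple := by
  refine ⟨Submodule.nontrivial_iff_ne_bot.2 h0, fun S => ?_⟩
  have hinj := incl_injective N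
  rcases h (mapSub (incl N) S) (by
    rintro _ ⟨x, _, rfl⟩; exact incl_mem N x) with h | h
  · exact Or.inl (eq_bot_of_map_eq_bot hinj h)
  · right
    refine Submodule.map_injective_of_injective hinj ?_
    rw [Submodule.map_top, range_incl]
    exact h

/-- A nonzero graded submodule of least dimension over `K` is simple. -/
theorem exists_simple_sub (M : GrMod ℛ) [Nontrivial M] : ∃ N : M.GrSub, (ofSub N).IsSimple := by
  classical
  have hex : ∃ n, ∃ N : M.GrSub, N.toSubmodule ≠ ⊥ ∧
      Module.finrank K (N.toSubmodule.restrictScalars K) = n :=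
    ⟨_, M.topSub, top_ne_bot, rfl⟩
  obtain ⟨N, h0, hn⟩ := Nat.find_spec hex
  refine ⟨N, IsSimple.ofSub_of_minimal N h0 fun N' hN' => or_iff_not_imp_left.2 fun h => ?_⟩
  have hle := Nat.find_min' hex ⟨N', h, rfl⟩
  rw [← hn] at hle
  exact Submodule.restrictScalars_injective K R M (Submodule.eq_of_le_of_finrank_le hN' hle)

/-- The socle of a uniform object is its unique simple subobject. -/
theorem IsUniform.soc_iso {M S : GrMod ℛ} (hM : M.IsUniform) (hS : S.IsSimple) (i : S ⟶ M)
    (hi : Function.Injective i.toLin) : Nonempty (M.soc ≅ S) := by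
  have hr : (ofSub (rangeSub i)).IsSimple := hS.of_iso (isoRange i hi)
  have : M.socle = rangeSub i := by
    apply GrSub.ext'
    change ⨆ N : {N : M.GrSub // (ofSub N).IsSimple}, N.1.toSubmodule = _
    refine le_antisymm (iSup_le fun N => ?_) (le_iSup_of_le ⟨rangeSub i, hr⟩ le_rfl)
    have hN := N.2
    have h0 : N.1.toSubmodule ≠ ⊥ := Submodule.nontrivial_iff_ne_bot.1 hN.1
    have h1 : (rangeSub i).toSubmodule ≠ ⊥ := Submodule.nontrivial_iff_ne_bot.1 hr.1
    rcases hN.2 ((rangeSub i).within N.1) with h | h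
    · exfalso
      rcases hM.2 N.1 (rangeSub i) (by
        rw [eq_bot_iff]
        rintro x ⟨hx, hx'⟩
        have : (⟨x, hx⟩ : N.1.toSubmodule) ∈ ((rangeSub i).within N.1).toSubmodule := hx'
        rw [h] at this
        exact congrArg (incl N.1).toLin ((Submodule.mem_bot R).1 this)) with h | h
      · exact h0 h
      · exact h1 h
    · intro x hx
      have : (⟨x, hx⟩ : N.1.toSubmodule) ∈ ((rangeSub i).within N.1).toSubmodule := h ▸ trivial
      exact this
  exact ⟨(eqToIso (congrArg ofSub this)).trans (isoRange i hi).symm⟩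

/-- The projection onto a direct summand. -/
theorem exists_proj_of_isCompl {M : GrMod ℛ} (N N' : M.GrSub)
    (h : IsCompl N.toSubmodule N'.toSubmodule) :
    ∃ p : M ⟶ ofSub N, (∀ x, p.toLin ((incl N).toLin x) = x) ∧
      ∀ x ∈ N'.toSubmodule, p.toLin x = 0 := by
  have hb : Function.Bijective (incl N ≫ mkQ N').toLin := by
    constructor
    · rw [← LinearMap.ker_eq_bot, eq_bot_iff]
      intro x hx
      have hx' : (incl N).toLin x ∈ N'.toSubmodule := (Submodule.Quotient.mk_eq_zero _).1 hx
      have := Submodule.disjoint_def.1 h.disjoint _ x.2 hx'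
      exact (Submodule.mem_bot R).2 (incl_injective N (this.trans (map_zero _).symm))
    · intro y
      obtain ⟨x, rfl⟩ := mkQ_surjective N' y
      obtain ⟨a, ha, b, hb, rfl⟩ := Submodule.mem_sup.1 (h.sup_eq_top ▸ Submodule.mem_top (x := x))
      refine ⟨⟨a, ha⟩, ?_⟩
      have : (mkQ N').toLin b = 0 := (Submodule.Quotient.mk_eq_zero _).2 hb
      rw [map_add, this, add_zero]
      rfl
  let e := isoOfBijective _ hb
  refine ⟨mkQ N' ≫ e.inv, fun x => ?_, fun x hx => ?_⟩
  · exact LinearMap.congr_fun (congrArg Hom.toLin e.hom_inv_id) x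
  · have : (mkQ N').toLin x = 0 := (Submodule.Quotient.mk_eq_zero _).2 hx
    rw [comp_toLin, LinearMap.comp_apply, this, map_zero]

/-- An indecomposable direct summand whose idempotent has a prescribed property. -/
theorem exists_indecomposable_summand (Q : GrMod ℛ) (C : (Q →ₗ[R] Q) → Prop)
    (h0 : ¬ C 0) (h1 : C LinearMap.id) (hadd : ∀ e e', C (e + e') → C e ∨ C e') :
    ∃ (P : GrMod ℛ) (i : P ⟶ Q) (p : Q ⟶ P), (∀ x, p.toLin (i.toLin x) = x) ∧
      P.IsIndecomposable ∧ C (i.toLin ∘ₗ p.toLin) := by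
  classical
  -- A summand of least dimension whose idempotent satisfies `C` is chosen. If it splits, additivity
  -- of `C` passes the property to one of the two parts, which by minimality is everything.
  have hex : ∃ n, ∃ (P : GrMod ℛ) (i : P ⟶ Q) (p : Q ⟶ P), (∀ x, p.toLin (i.toLin x) = x) ∧
      C (i.toLin ∘ₗ p.toLin) ∧ Module.finrank K P = n :=
    ⟨_, Q, 𝟙 Q, 𝟙 Q, fun _ => rfl, h1, rfl⟩
  obtain ⟨P, i, p, hip, hC, hn⟩ := Nat.find_spec hex
  refine ⟨P, i, p, hip, ⟨?_, ?_⟩, hC⟩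
  · by_contra hP
    rw [not_nontrivial_iff_subsingleton] at hP
    refine h0 ?_
    convert hC
    ext x
    rw [LinearMap.comp_apply, Subsingleton.elim (p.toLin x) 0, map_zero, LinearMap.zero_apply]
  · have key : ∀ N N' : P.GrSub, IsCompl N.toSubmodule N'.toSubmodule →
        ∀ q : P ⟶ ofSub N, (∀ x, q.toLin ((incl N).toLin x) = x) →
        C (i.toLin ∘ₗ ((incl N).toLin ∘ₗ q.toLin) ∘ₗ p.toLin) → N'.toSubmodule = ⊥ := by
      intro N N' hNN q hq hCN
      have hle := Nat.find_min' hex ⟨ofSub N, incl N ≫ i, p ≫ q, fun x => by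
        rw [comp_toLin, comp_toLin, LinearMap.comp_apply, LinearMap.comp_apply, hip, hq], hCN, rfl⟩
      rw [← hn] at hle
      have htop : N.toSubmodule.restrictScalars K = ⊤ :=
        Submodule.eq_top_of_finrank_eq (le_antisymm (Submodule.finrank_le _) hle)
      rw [Submodule.restrictScalars_eq_top_iff] at htop
      rw [htop] at hNN
      exact eq_bot_of_top_isCompl hNN
    intro N N' hNN
    obtain ⟨q, hq, hq'⟩ := exists_proj_of_isCompl N N' hNN
    obtain ⟨r, hr, hr'⟩ := exists_proj_of_isCompl N' N hNN.symm
    have hsum : (incl N).toLin ∘ₗ q.toLin + (incl N').toLin ∘ₗ r.toLin = LinearMap.id := by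
      ext x
      obtain ⟨a, ha, b, hb, rfl⟩ := Submodule.mem_sup.1 (hNN.sup_eq_top ▸ Submodule.mem_top (x := x))
      have e1 : q.toLin a = ⟨a, ha⟩ := hq ⟨a, ha⟩
      have e2 : r.toLin b = ⟨b, hb⟩ := hr ⟨b, hb⟩
      simp only [LinearMap.add_apply, LinearMap.comp_apply, map_add, hq' b hb, hr' a ha, e1, e2,
        add_zero, zero_add, map_zero, LinearMap.id_apply]
      rfl
    have hC' : C (i.toLin ∘ₗ ((incl N).toLin ∘ₗ q.toLin) ∘ₗ p.toLin +
        i.toLin ∘ₗ ((incl N').toLin ∘ₗ r.toLin) ∘ₗ p.toLin) := by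
      rw [← LinearMap.comp_add, ← LinearMap.add_comp, hsum, LinearMap.id_comp]
      exact hC
    exact (hadd _ _ hC').symm.imp (key N' N hNN.symm r hr) (key N N' hNN q hq)

theorem HasExtensions.retract {P Q : GrMod ℛ} (hQ : Q.HasExtensions) (i : P ⟶ Q) (p : Q ⟶ P)
    (h : ∀ x, p.toLin (i.toLin x) = x) : P.HasExtensions := by
  intro X Y j f hj
  obtain ⟨g, hg⟩ := hQ j (f ≫ i) hj
  exact ⟨g ≫ p, fun x => (congrArg p.toLin (hg x)).trans (h _)⟩

theorem HasLifts.retract {P Q : GrMod ℛ} (hQ : Q.HasLifts) (i : P ⟶ Q) (p : Q ⟶ P)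
    (h : ∀ x, p.toLin (i.toLin x) = x) : P.HasLifts := by
  intro X Y e f he
  obtain ⟨g, hg⟩ := hQ e (p ≫ f) he
  exact ⟨i ≫ g, fun x => (hg (i.toLin x)).trans (congrArg f.toLin (h x))⟩

end Toolkit

end GrMod

end GradedTilting

/-! ### Freeness over `A⁻` and cofreeness over `A⁺` by counting dimensions. -/

namespace GradedTilting

open Module

theorem exists_grading_bound {K A : Type*} [Field K] [Ring A] [Algebra K A] [FiniteDimensional K A]
    (𝒜 : ℤ → Submodule K A) [GradedAlgebra 𝒜] : ∃ N : ℕ, ∀ i : ℤ, 𝒜 i ≠ ⊥ → |i| ≤ N := by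
  have h := (DirectSum.isInternal_submodule_iff_iSupIndep_and_iSup_eq_top _).1
    (DirectSum.Decomposition.isInternal 𝒜)
  have hf : {i | 𝒜 i ≠ ⊥}.Finite := WellFoundedGT.finite_ne_bot_of_iSupIndep h.1
  obtain ⟨B, hB⟩ := (hf.image fun i => |i|.toNat).bddAbove
  refine ⟨B, fun i hi => ?_⟩
  have : |i|.toNat ≤ B := hB ⟨i, hi, rfl⟩
  omega

theorem finrank_sup_of_disjoint {K V : Type*} [Field K] [AddCommGroup V] [Module K V]
    [FiniteDimensional K V] {p q : Submodule K V} (h : Disjoint p q) :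
    finrank K ↥(p ⊔ q) = finrank K p + finrank K q := by
  have := Submodule.finrank_sup_add_finrank_inf_eq p q
  rwa [h.eq_bot, finrank_bot, add_zero] at this

theorem finrank_map_of_injective {K V W : Type*} [Field K] [AddCommGroup V] [Module K V]
    [AddCommGroup W] [Module K W] {f : V →ₗ[K] W} (p : Submodule K V) (hf : Function.Injective f) :
    finrank K (p.map f) = finrank K p :=
  (Submodule.equivMapOfInjective f hf p).finrank_eq.symm

theorem finrank_map_add_finrank_inf_ker {K V W : Type*} [Field K] [AddCommGroup V] [Module K V]
    [FiniteDimensional K V] [AddCommGroup W] [Module K W] (f : V →ₗ[K] W) (p : Submodule K V) :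
    finrank K (p.map f) + finrank K ↥(p ⊓ LinearMap.ker f) = finrank K p := by
  have := LinearMap.finrank_range_add_finrank_ker (f.domRestrict p)
  rw [LinearMap.range_domRestrict, LinearMap.ker_domRestrict] at this
  rw [← this, ← finrank_map_of_injective _ p.subtype_injective, Submodule.map_comap_subtype]

namespace PreTriangularDecomposition

section Linear

variable {K A : Type u} [Field K] [Ring A] [Algebra K A] [FiniteDimensional K A]
  {𝒜 : ℤ → Submodule K A} [GradedAlgebra 𝒜] (𝒯 : PreTriangularDecomposition 𝒜)

section Act

variable {X W : Type*} [AddCommGroup X] [Module K X] [Module A X] [IsScalarTower K A X]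
  [AddCommGroup W] [Module K W]

/-- The map `S ⊗ W → X`, `s ⊗ w ↦ s φ(w)`. -/
noncomputable def act (S : Subalgebra K A) (φ : W →ₗ[K] X) : S ⊗[K] W →ₗ[K] X :=
  TensorProduct.lift (LinearMap.mk₂ K (fun (s : S) w => (s : A) • φ w)
    (fun s s' w => by simp [add_smul]) (fun c s w => by simp)
    (fun s w w' => by simp) (fun c s w => by rw [map_smul, smul_algebra_smul_comm]))

@[simp] theorem act_tmul (S : Subalgebra K A) (φ : W →ₗ[K] X) (s : S) (w : W) :
    act S φ (s ⊗ₜ w) = (s : A) • φ w := rfl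

theorem act_smul_mem_range (S : Subalgebra K A) (φ : W →ₗ[K] X) {a : A} (ha : a ∈ S) {x : X}
    (hx : x ∈ LinearMap.range (act S φ)) : a • x ∈ LinearMap.range (act S φ) := by
  obtain ⟨z, rfl⟩ := hx
  induction z using TensorProduct.induction_on with
  | zero => simp
  | tmul s w => exact ⟨(⟨a, ha⟩ * s) ⊗ₜ w, by simp [mul_smul]⟩
  | add z z' h h' => rw [map_add, smul_add]; exact add_mem h h'

end Act

variable (X : Type*) [AddCommGroup X] [Module K X] [Module A X] [IsScalarTower K A X]

/-- The span of `a x` for `a ∈ A⁻` of negative degree. -/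
def negRad : Submodule K X :=
  Submodule.span K {x | ∃ i < 0, ∃ a ∈ 𝒯.neg, a ∈ 𝒜 i ∧ ∃ y : X, a • y = x}

/-- The elements annihilated by all elements of `A⁺` of positive degree. -/
def posSoc : Submodule K X where
  carrier := {x | ∀ i > 0, ∀ a ∈ 𝒯.pos, a ∈ 𝒜 i → a • x = 0}
  zero_mem' := fun _ _ _ _ _ => smul_zero _
  add_mem' := fun hx hy i hi a ha hai => by rw [smul_add, hx i hi a ha hai, hy i hi a ha hai, add_zero]
  smul_mem' := fun c x hx i hi a ha hai => by
    rw [smul_algebra_smul_comm, hx i hi a ha hai, smul_zero]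

variable {X}

theorem smul_mem_negRad {i : ℤ} (hi : i < 0) {a : A} (ha : a ∈ 𝒯.neg) (hai : a ∈ 𝒜 i) (x : X) :
    a • x ∈ 𝒯.negRad X := Submodule.subset_span ⟨i, hi, a, ha, hai, x, rfl⟩

/-- Nakayama's lemma for `A⁻`. -/
theorem eq_top_of_sup_negRad (Y : Submodule K X) (hY : ∀ a ∈ 𝒯.neg, ∀ y ∈ Y, a • y ∈ Y)
    (h : Y ⊔ 𝒯.negRad X = ⊤) : Y = ⊤ := by
  -- `F k` is spanned by what elements of `A⁻` of degree at most `k` produce. Writing `X` as `Y`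
  -- plus `negRad X` lowers `k` by one modulo `Y`, and `F k` vanishes once `k` is below all degrees
  -- of `A`.
  let F : ℤ → Submodule K X := fun k =>
    Submodule.span K {x | ∃ i ≤ k, ∃ a ∈ 𝒯.neg, a ∈ 𝒜 i ∧ ∃ y : X, a • y = x}
  have hF0 : F 0 = ⊤ := eq_top_iff.2 fun x _ => Submodule.subset_span
    ⟨0, le_rfl, 1, one_mem _, SetLike.GradedOne.one_mem, x, one_smul A x⟩
  have hstep : ∀ k, F k ≤ Y ⊔ F (k - 1) := by
    intro k
    refine Submodule.span_le.2 ?_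
    rintro _ ⟨i, hi, a, ha, hai, x, rfl⟩
    obtain ⟨y, hy, z, hz, rfl⟩ := Submodule.mem_sup.1 (h ▸ Submodule.mem_top (x := x))
    rw [smul_add]
    refine Submodule.add_mem_sup (hY a ha y hy) ?_
    change z ∈ Submodule.span K _ at hz
    induction hz using Submodule.span_induction with
    | mem z hz =>
      obtain ⟨j, hj, b, hb, hbj, w, rfl⟩ := hz
      exact Submodule.subset_span ⟨i + j, by omega, a * b, mul_mem ha hb,
        SetLike.GradedMul.mul_mem hai hbj, w, mul_smul a b w⟩
    | zero => rw [smul_zero]; exact zero_mem _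
    | add z z' _ _ hz hz' => rw [smul_add]; exact add_mem hz hz'
    | smul c z _ hz => rw [smul_algebra_smul_comm]; exact Submodule.smul_mem _ c hz
  have hall : ∀ n : ℕ, Y ⊔ F (-n) = ⊤ := by
    intro n
    induction n with
    | zero => simp [hF0]
    | succ n ih =>
      rw [eq_top_iff, ← ih]
      refine sup_le le_sup_left ?_
      have := hstep (-n)
      rwa [show (-n - 1 : ℤ) = -((n + 1 : ℕ) : ℤ) by push_cast; ring] at this
  obtain ⟨N, hN⟩ := exists_grading_bound 𝒜
  have hbot : F (-((N + 1 : ℕ) : ℤ)) = ⊥ := by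
    rw [eq_bot_iff]
    refine Submodule.span_le.2 ?_
    rintro _ ⟨i, hi, a, ha, hai, x, rfl⟩
    have : 𝒜 i = ⊥ := by
      by_contra hne
      have := hN i hne
      rw [abs_le] at this
      push_cast at hi
      omega
    rw [this, Submodule.mem_bot] at hai
    rw [hai, zero_smul]
    exact zero_mem _
  have := hall (N + 1)
  rwa [hbot, sup_bot_eq] at this

/-- Nakayama's lemma applied to the range, which is stable under `A⁻` and contains the range of `φ`.
-/
theorem act_surjective {W : Type*} [AddCommGroup W] [Module K W] (φ : W →ₗ[K] X)
    (h : LinearMap.range φ ⊔ 𝒯.negRad X = ⊤) : Function.Surjective (act 𝒯.neg φ) := by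
  rw [← LinearMap.range_eq_top]
  refine 𝒯.eq_top_of_sup_negRad _ (fun a ha x hx => act_smul_mem_range 𝒯.neg φ ha hx) ?_
  rw [eq_top_iff, ← h]
  refine sup_le_sup_right ?_ _
  rintro _ ⟨w, rfl⟩
  exact ⟨1 ⊗ₜ w, by simp⟩

/-- `A⁻` is spanned by the scalars and the elements of negative degree. -/
theorem smul_mem_sup_negRad (V : Submodule K X) {a : A} (ha : a ∈ 𝒯.neg) {x : X} (hx : x ∈ V) :
    a • x ∈ V ⊔ 𝒯.negRad X := by
  classical
  rw [← DirectSum.sum_support_decompose 𝒜 a, Finset.sum_smul]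
  refine Submodule.sum_mem _ fun i _ => ?_
  have h1 := 𝒯.neg_homogeneous i ha
  have h2 := (DirectSum.decompose 𝒜 a i).2
  rcases lt_trichotomy i 0 with h | h | h
  · exact Submodule.mem_sup_right (𝒯.smul_mem_negRad h h1 h2 x)
  · subst h
    obtain ⟨c, hc⟩ := Algebra.mem_bot.1 (𝒯.neg_zero _ h1 h2)
    rw [← hc, algebraMap_smul]
    exact Submodule.mem_sup_left (V.smul_mem c hx)
  · rw [𝒯.neg_supp i h _ h1 h2, zero_smul]
    exact zero_mem _

variable (X) in
/-- Freeness over `A⁻`, in terms of dimensions. -/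
def IsFree : Prop :=
  finrank K X + finrank K 𝒯.neg * finrank K (𝒯.negRad X) = finrank K 𝒯.neg * finrank K X

variable (X) in
/-- Cofreeness over `A⁺`, in terms of dimensions. -/
def IsCofree : Prop := finrank K X = finrank K 𝒯.pos * finrank K (𝒯.posSoc X)

variable [FiniteDimensional K X]

variable (X) in
-- A complement `W` of `negRad X` generates `X`, so `dim X ≤ dim A⁻ · dim W`. `IsFree` is the case
-- of equality; the term with `negRad X` stands on the left to avoid subtraction of natural numbers.
theorem finrank_add_negRad_le :
    finrank K X + finrank K 𝒯.neg * finrank K (𝒯.negRad X) ≤ finrank K 𝒯.neg * finrank K X := by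
  obtain ⟨W, hW⟩ := Submodule.exists_isCompl (𝒯.negRad X)
  have hs := 𝒯.act_surjective W.subtype (by rw [Submodule.range_subtype, hW.symm.sup_eq_top])
  have h1 := LinearMap.finrank_le_finrank_of_surjective hs
  rw [finrank_tensorProduct] at h1
  have h2 := Submodule.finrank_add_eq_of_isCompl hW
  rw [← h2, mul_add]
  omega

/-- The range of `φ` is enlarged to a complement `V` of `negRad X`. Then `A⁻ ⊗ V → X` is a
surjection between spaces of equal dimension, and `A⁻ ⊗ W → A⁻ ⊗ V` is injective by flatness over
`K`. -/
theorem act_injective (hX : 𝒯.IsFree X) {W : Type*} [AddCommGroup W] [Module K W] (φ : W →ₗ[K] X)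
    (hφ : Function.Injective φ) (h : Disjoint (LinearMap.range φ) (𝒯.negRad X)) :
    Function.Injective (act 𝒯.neg φ) := by
  obtain ⟨V, hV, hc⟩ := h.exists_isCompl
  have hs := 𝒯.act_surjective V.subtype (by rw [Submodule.range_subtype, hc.sup_eq_top])
  have h2 := Submodule.finrank_add_eq_of_isCompl hc
  have hX' : finrank K X + finrank K 𝒯.neg * finrank K (𝒯.negRad X) =
    finrank K 𝒯.neg * finrank K X := hX
  have hi : Function.Injective (act 𝒯.neg V.subtype) := by
    rw [LinearMap.injective_iff_surjective_of_finrank_eq_finrank]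
    · exact hs
    · rw [finrank_tensorProduct]
      have : finrank K 𝒯.neg * finrank K V + finrank K 𝒯.neg * finrank K (𝒯.negRad X) =
        finrank K 𝒯.neg * finrank K X := by rw [← mul_add, h2]
      omega
  let ψ : W →ₗ[K] V := φ.codRestrict V fun w => hV ⟨w, rfl⟩
  have hψ : Function.Injective ψ := fun x y hxy => hφ (congrArg Subtype.val hxy)
  have : act 𝒯.neg φ = act 𝒯.neg V.subtype ∘ₗ ψ.lTensor 𝒯.neg :=
    TensorProduct.ext' fun s w => rfl
  rw [this]
  exact hi.comp (Module.Flat.lTensor_preserves_injective_linearMap ψ hψ)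

/-- The range of `φ` spans `X` modulo `negRad X`, so `negRad X` has codimension at most `dim W`.
This is the inequality opposite to `finrank_add_negRad_le`. -/
theorem isFree_of_act {W : Type*} [AddCommGroup W] [Module K W] [FiniteDimensional K W]
    (φ : W →ₗ[K] X)
    (hs : Function.Surjective (act 𝒯.neg φ))
    (hd : finrank K X = finrank K 𝒯.neg * finrank K W) : 𝒯.IsFree X := by
  refine le_antisymm (𝒯.finrank_add_negRad_le X) ?_
  have htop : LinearMap.range φ ⊔ 𝒯.negRad X = ⊤ := by
    refine Submodule.eq_top_iff'.2 fun x => ?_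
    obtain ⟨z, rfl⟩ := hs x
    induction z using TensorProduct.induction_on with
    | zero => simp
    | tmul s w => exact 𝒯.smul_mem_sup_negRad _ s.2 ⟨w, rfl⟩
    | add z z' h h' => rw [map_add]; exact add_mem h h'
  have h1 := Submodule.finrank_add_le_finrank_add_finrank (LinearMap.range φ) (𝒯.negRad X)
  rw [htop, finrank_top] at h1
  have h2 := LinearMap.finrank_range_le φ
  calc finrank K 𝒯.neg * finrank K X
      ≤ finrank K 𝒯.neg * (finrank K W + finrank K (𝒯.negRad X)) := Nat.mul_le_mul_left _ (by omega)
    _ = _ := by rw [mul_add, hd]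

/-- With a linear retraction `π` onto `posSoc X`, the map `x ↦ (y ↦ π (y x))` embeds `X` into the
linear maps from `A⁺` to `posSoc X`. For `z ≠ 0`, a homogeneous `y` of largest degree with `y z ≠ 0`
puts `y z` into `posSoc X`, where `π` does not kill it. -/
theorem finrank_le_posSoc : finrank K X ≤ finrank K 𝒯.pos * finrank K (𝒯.posSoc X) := by
  obtain ⟨C, hC⟩ := Submodule.exists_isCompl (𝒯.posSoc X)
  obtain ⟨π, hπ⟩ := (𝒯.posSoc X).subtype.exists_leftInverse_of_injective
    (LinearMap.ker_eq_bot.2 Subtype.val_injective)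
  have hπ' : ∀ x, π x = 0 → x ∈ 𝒯.posSoc X → x = 0 := fun x h hx => by
    have := LinearMap.congr_fun hπ ⟨x, hx⟩
    exact congrArg Subtype.val (this.symm.trans h)
  let Φ : X →ₗ[K] (𝒯.pos →ₗ[K] 𝒯.posSoc X) := LinearMap.mk₂ K (fun x y => π ((y : A) • x))
    (fun x x' y => by rw [smul_add, map_add])
    (fun c x y => by rw [smul_algebra_smul_comm, map_smul])
    (fun x y y' => by rw [Subalgebra.coe_add, add_smul, map_add])
    (fun c x y => by rw [Subalgebra.coe_smul, smul_assoc, map_smul])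
  have hinj : Function.Injective Φ := by
    rw [← LinearMap.ker_eq_bot, eq_bot_iff]
    intro z hz
    have hz' : ∀ y ∈ 𝒯.pos, π (y • z) = 0 := fun y hy =>
      LinearMap.congr_fun (LinearMap.mem_ker.1 hz) ⟨y, hy⟩
    by_contra hne
    let D : Set ℤ := {i | ∃ y ∈ 𝒯.pos, y ∈ 𝒜 i ∧ y • z ≠ 0}
    obtain ⟨N, hN⟩ := exists_grading_bound 𝒜
    have hD : D.Finite := (Set.finite_Icc (-(N : ℤ)) N).subset fun i ⟨y, _, hyi, hyz⟩ =>
      abs_le.1 (hN i fun hb => hyz (by rw [hb, Submodule.mem_bot] at hyi; rw [hyi, zero_smul]))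
    have h0 : D.Nonempty := ⟨0, 1, one_mem _, SetLike.GradedOne.one_mem, by
      rw [one_smul]; exact hne⟩
    obtain ⟨i, ⟨y, hy, hyi, hyz⟩, hmax⟩ := Set.exists_max_image D id hD h0
    refine hyz (hπ' _ (hz' y hy) fun j hj a ha haj => ?_)
    by_contra hne'
    have := hmax (j + i) ⟨a * y, mul_mem ha hy, SetLike.GradedMul.mul_mem haj hyi, by
      rwa [mul_smul]⟩
    simp only [id] at this
    omega
  have := LinearMap.finrank_le_finrank_of_injective hinj
  rwa [Module.finrank_linearMap] at this

section Summand

variable {P : Type*} [AddCommGroup P] [Module K P] [Module A P] [IsScalarTower K A P]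
  [FiniteDimensional K P]

theorem map_negRad_le (f : P →ₗ[A] X) :
    (𝒯.negRad P).map (f.restrictScalars K) ≤ 𝒯.negRad X := by
  rw [negRad, Submodule.map_span, Submodule.span_le]
  rintro _ ⟨_, ⟨i, hi, a, ha, hai, y, rfl⟩, rfl⟩
  exact 𝒯.smul_mem_negRad hi ha hai (f y) |> fun h => by
    rw [← map_smul] at h; exact h

theorem map_mem_posSoc (f : P →ₗ[A] X) {x : P} (hx : x ∈ 𝒯.posSoc P) : f x ∈ 𝒯.posSoc X :=
  fun i hi a ha hai => by rw [← map_smul, hx i hi a ha hai, map_zero]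

theorem mem_posSoc_of_injective (f : P →ₗ[A] X) (hf : Function.Injective f) {x : P}
    (hx : f x ∈ 𝒯.posSoc X) : x ∈ 𝒯.posSoc P :=
  fun i hi a ha hai => hf (by rw [map_smul, hx i hi a ha hai, map_zero])

theorem finrank_add_ker (i : P →ₗ[A] X) (p : X →ₗ[A] P) (h : ∀ x, p (i x) = x) :
    finrank K P + finrank K (LinearMap.ker p) = finrank K X := by
  have := LinearMap.finrank_range_add_finrank_ker (p.restrictScalars K)
  rw [LinearMap.range_eq_top.2 (fun x => ⟨i x, h x⟩ : Function.Surjective (p.restrictScalars K)),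
    finrank_top] at this
  exact this

/-- `negRad X` lies in the sum of the radicals of `P` and `ker p`. The inequalities for these two
add up to the equality for `X`, so neither is strict. -/
theorem IsFree.summand (hX : 𝒯.IsFree X) (i : P →ₗ[A] X) (p : X →ₗ[A] P) (h : ∀ x, p (i x) = x) :
    𝒯.IsFree P := by
  have : FiniteDimensional K (LinearMap.ker p) :=
    inferInstanceAs (FiniteDimensional K (LinearMap.ker (p.restrictScalars K)))
  have h1 := 𝒯.finrank_add_negRad_le P
  have h2 := 𝒯.finrank_add_negRad_le (LinearMap.ker p)
  have h3 := finrank_add_ker (K := K) i p h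
  have hle : 𝒯.negRad X ≤ (𝒯.negRad P).map (i.restrictScalars K) ⊔
      (𝒯.negRad (LinearMap.ker p)).map ((LinearMap.ker p).subtype.restrictScalars K) := by
    rw [negRad, Submodule.span_le]
    rintro _ ⟨j, hj, a, ha, haj, y, rfl⟩
    have hk : y - i (p y) ∈ LinearMap.ker p := by
      rw [LinearMap.mem_ker, map_sub, h, sub_self]
    have : a • y = i (a • p y) + (LinearMap.ker p).subtype (a • ⟨y - i (p y), hk⟩) := by
      rw [map_smul, map_smul, ← smul_add]
      congr 1
      exact (add_sub_cancel _ _).symm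
    rw [this]
    exact Submodule.add_mem_sup ⟨_, 𝒯.smul_mem_negRad hj ha haj _, rfl⟩
      ⟨_, 𝒯.smul_mem_negRad hj ha haj _, rfl⟩
  have h4 := Submodule.finrank_mono hle
  have h5 := Submodule.finrank_add_le_finrank_add_finrank ((𝒯.negRad P).map (i.restrictScalars K))
    ((𝒯.negRad (LinearMap.ker p)).map ((LinearMap.ker p).subtype.restrictScalars K))
  have h6 := Submodule.finrank_map_le (i.restrictScalars K) (𝒯.negRad P)
  have h7 := Submodule.finrank_map_le ((LinearMap.ker p).subtype.restrictScalars K)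
    (𝒯.negRad (LinearMap.ker p))
  have hX' : _ = _ := hX
  have h8 : finrank K 𝒯.neg * finrank K (𝒯.negRad X) ≤ finrank K 𝒯.neg * finrank K (𝒯.negRad P) +
      finrank K 𝒯.neg * finrank K (𝒯.negRad (LinearMap.ker p)) := by
    rw [← mul_add]
    exact Nat.mul_le_mul_left _ (by omega)
  rw [← h3, mul_add] at hX'
  unfold IsFree
  omega

/-- As for freeness: the socles of the two summands are independent inside `posSoc X`, and equality
for the sum forces equality for each. -/
theorem IsCofree.summand (hX : 𝒯.IsCofree X) (i : P →ₗ[A] X) (p : X →ₗ[A] P)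
    (h : ∀ x, p (i x) = x) : 𝒯.IsCofree P := by
  have : FiniteDimensional K (LinearMap.ker p) :=
    inferInstanceAs (FiniteDimensional K (LinearMap.ker (p.restrictScalars K)))
  have h1 := 𝒯.finrank_le_posSoc (X := P)
  have h2 := 𝒯.finrank_le_posSoc (X := LinearMap.ker p)
  have h3 := finrank_add_ker (K := K) i p h
  have hi : Function.Injective i := Function.LeftInverse.injective h
  have hle : (𝒯.posSoc P).map (i.restrictScalars K) ⊔
      (𝒯.posSoc (LinearMap.ker p)).map ((LinearMap.ker p).subtype.restrictScalars K) ≤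
      𝒯.posSoc X := by
    rw [sup_le_iff]
    constructor
    · rintro _ ⟨x, hx, rfl⟩; exact 𝒯.map_mem_posSoc i hx
    · rintro _ ⟨x, hx, rfl⟩; exact 𝒯.map_mem_posSoc (LinearMap.ker p).subtype hx
  have hdisj : Disjoint ((𝒯.posSoc P).map (i.restrictScalars K))
      ((𝒯.posSoc (LinearMap.ker p)).map ((LinearMap.ker p).subtype.restrictScalars K)) := by
    rw [Submodule.disjoint_def]
    rintro _ ⟨x, _, rfl⟩ ⟨y, _, hy⟩
    have : p (i x) = 0 := by
      rw [← show (LinearMap.ker p).subtype y = i x from hy]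
      exact y.2
    rw [h] at this
    rw [this, map_zero]
  have h4 := Submodule.finrank_mono hle
  rw [finrank_sup_of_disjoint hdisj,
    finrank_map_of_injective _ hi,
    finrank_map_of_injective _ Subtype.val_injective] at h4
  have h5 := Nat.mul_le_mul_left (finrank K 𝒯.pos) h4
  have hX' : _ = _ := hX
  rw [mul_add] at h5
  unfold IsCofree
  omega

instance (N : Submodule A X) : FiniteDimensional K N :=
  inferInstanceAs (FiniteDimensional K (N.restrictScalars K))

instance (N : Submodule A X) : FiniteDimensional K (X ⧸ N) :=
  Module.Finite.of_surjective (N.mkQ.restrictScalars K) N.mkQ_surjective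

theorem finrank_quotient_add (N : Submodule A X) :
    finrank K (X ⧸ N) + finrank K N = finrank K X := by
  have := LinearMap.finrank_range_add_finrank_ker (N.mkQ.restrictScalars K)
  have hr : LinearMap.range (N.mkQ.restrictScalars K) = ⊤ :=
    LinearMap.range_eq_top.2 N.mkQ_surjective
  rw [hr, finrank_top] at this
  rw [← this]
  congr 1
  refine (LinearEquiv.ofEq (N.restrictScalars K) _ ?_).finrank_eq
  ext x
  exact (Submodule.Quotient.mk_eq_zero N).symm

theorem ker_mkQ_restrictScalars (N : Submodule A X) :
    LinearMap.ker (N.mkQ.restrictScalars K) = N.restrictScalars K := by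
  ext x
  exact Submodule.Quotient.mk_eq_zero N

theorem map_mkQ_negRad (N : Submodule A X) :
    (𝒯.negRad X).map (N.mkQ.restrictScalars K) = 𝒯.negRad (X ⧸ N) := by
  refine le_antisymm (𝒯.map_negRad_le N.mkQ) ?_
  rw [negRad, Submodule.span_le]
  rintro _ ⟨j, hj, a, ha, haj, y, rfl⟩
  obtain ⟨y, rfl⟩ := N.mkQ_surjective y
  exact ⟨a • y, 𝒯.smul_mem_negRad hj ha haj y, map_smul N.mkQ a y⟩

/-- `negRad X` maps onto the radical of the quotient and contains that of `N`, so its dimension is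
at least the sum of theirs; the other inequality always holds. -/
theorem IsFree.extension (N : Submodule A X) (h1 : 𝒯.IsFree N) (h2 : 𝒯.IsFree (X ⧸ N)) :
    𝒯.IsFree X := by
  have h3 := finrank_quotient_add (K := K) N
  have h4 := finrank_map_add_finrank_inf_ker (N.mkQ.restrictScalars K) (𝒯.negRad X)
  rw [map_mkQ_negRad, ker_mkQ_restrictScalars] at h4
  have h5 : finrank K (𝒯.negRad N) ≤ finrank K ↥(𝒯.negRad X ⊓ N.restrictScalars K) := by
    rw [← finrank_map_of_injective (f := N.subtype.restrictScalars K) _ N.subtype_injective]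
    refine Submodule.finrank_mono (le_inf (𝒯.map_negRad_le N.subtype) ?_)
    rintro _ ⟨x, _, rfl⟩
    exact x.2
  refine le_antisymm (𝒯.finrank_add_negRad_le X) ?_
  have h6 : _ = _ := h1
  have h7 : _ = _ := h2
  have h8 := Nat.mul_le_mul_left (finrank K 𝒯.neg) h5
  rw [← h3, ← h4, mul_add, mul_add]
  omega

/-- Forming `posSoc` is left exact, which bounds `posSoc X` from above by the two outer terms;
`finrank_le_posSoc` bounds it from below. -/
theorem IsCofree.extension (N : Submodule A X) (h1 : 𝒯.IsCofree N) (h2 : 𝒯.IsCofree (X ⧸ N)) :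
    𝒯.IsCofree X := by
  have h3 := finrank_quotient_add (K := K) N
  have h4 := finrank_map_add_finrank_inf_ker (N.mkQ.restrictScalars K) (𝒯.posSoc X)
  rw [ker_mkQ_restrictScalars] at h4
  have h5 : finrank K ((𝒯.posSoc X).map (N.mkQ.restrictScalars K)) ≤
      finrank K (𝒯.posSoc (X ⧸ N)) := by
    refine Submodule.finrank_mono ?_
    rintro _ ⟨x, hx, rfl⟩
    exact 𝒯.map_mem_posSoc N.mkQ hx
  have h6 : finrank K ↥(𝒯.posSoc X ⊓ N.restrictScalars K) ≤ finrank K (𝒯.posSoc N) := by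
    rw [← finrank_map_of_injective (f := N.subtype.restrictScalars K) _ N.subtype_injective]
    refine Submodule.finrank_mono ?_
    rintro x ⟨hx, hxN⟩
    exact ⟨⟨x, hxN⟩, 𝒯.mem_posSoc_of_injective N.subtype N.subtype_injective hx, rfl⟩
  refine le_antisymm 𝒯.finrank_le_posSoc ?_
  rw [← h3, ← h4, show finrank K (X ⧸ N) = _ from h2, show finrank K N = _ from h1, ← mul_add]
  exact Nat.mul_le_mul_left _ (by omega)

/-- The sum of `negRad X` and the range of `φ` maps onto `negRad (X ⧸ Z)` and loses at most `dim Z`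
in dimension. With `dim Z = dim A⁻ · dim W` this is the bound needed. It allows a copy of `Δ(λ)` to
be divided out. -/
theorem IsFree.quotient (hX : 𝒯.IsFree X) {W : Type*} [AddCommGroup W] [Module K W]
    (φ : W →ₗ[K] X) (hφ : Function.Injective φ) (h : Disjoint (LinearMap.range φ) (𝒯.negRad X))
    (Z : Submodule A X) (hZ : ∀ w, φ w ∈ Z) (hd : finrank K Z = finrank K 𝒯.neg * finrank K W) :
    𝒯.IsFree (X ⧸ Z) := by
  have h3 := finrank_quotient_add (K := K) Z
  have h4 := finrank_map_add_finrank_inf_ker (Z.mkQ.restrictScalars K) (𝒯.negRad X ⊔ LinearMap.range φ)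
  have h5 : (𝒯.negRad X ⊔ LinearMap.range φ).map (Z.mkQ.restrictScalars K) = 𝒯.negRad (X ⧸ Z) := by
    rw [Submodule.map_sup, map_mkQ_negRad, sup_eq_left]
    rintro _ ⟨_, ⟨w, rfl⟩, rfl⟩
    have : Z.mkQ (φ w) = 0 := (Submodule.Quotient.mk_eq_zero Z).2 (hZ w)
    rw [LinearMap.restrictScalars_apply, this]
    exact zero_mem _
  have h6 : finrank K ↥((𝒯.negRad X ⊔ LinearMap.range φ) ⊓ LinearMap.ker (Z.mkQ.restrictScalars K)) ≤
      finrank K Z := by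
    rw [ker_mkQ_restrictScalars]
    exact Submodule.finrank_mono inf_le_right
  rw [h5, finrank_sup_of_disjoint h.symm, LinearMap.finrank_range_of_inj hφ] at h4
  refine le_antisymm (𝒯.finrank_add_negRad_le _) ?_
  have h7 : _ = _ := hX
  have h8 := Nat.mul_le_mul_left (finrank K 𝒯.neg) (h4.ge.trans (Nat.add_le_add_left h6 _))
  rw [← h3] at h7
  simp only [mul_add] at h7 h8
  omega

/-- `posSoc N` lies in the kernel of `π` on `posSoc X`, so it is smaller than `posSoc X` by at least
`dim W`. It serves for the kernel of a surjection onto `∇(λ)`. -/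
theorem IsCofree.kernel (hX : 𝒯.IsCofree X) {W : Type*} [AddCommGroup W] [Module K W]
    [FiniteDimensional K W]
    (π : X →ₗ[K] W) (hπ : (𝒯.posSoc X).map π = ⊤) (N : Submodule A X) (hN : ∀ x ∈ N, π x = 0)
    (hd : finrank K N + finrank K 𝒯.pos * finrank K W = finrank K X) : 𝒯.IsCofree N := by
  have h4 := finrank_map_add_finrank_inf_ker π (𝒯.posSoc X)
  rw [hπ, finrank_top] at h4
  have h5 : finrank K (𝒯.posSoc N) ≤ finrank K ↥(𝒯.posSoc X ⊓ LinearMap.ker π) := by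
    rw [← finrank_map_of_injective (f := N.subtype.restrictScalars K) _ N.subtype_injective]
    refine Submodule.finrank_mono ?_
    rintro _ ⟨x, hx, rfl⟩
    exact ⟨𝒯.map_mem_posSoc N.subtype hx, hN _ x.2⟩
  refine le_antisymm 𝒯.finrank_le_posSoc ?_
  have h7 : _ = _ := hX
  have h8 := Nat.mul_le_mul_left (finrank K 𝒯.pos) (h4.le.trans' (Nat.add_le_add_left h5 _))
  simp only [mul_add] at h8
  omega

end Summand

end Linear

end PreTriangularDecomposition

end GradedTilting

namespace GradedTilting

open Module

namespace PreTriangularDecomposition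

variable {K A : Type u} [Field K] [Ring A] [Algebra K A] [FiniteDimensional K A]
  {𝒜 : ℤ → Submodule K A} [GradedAlgebra 𝒜] (𝒯 : PreTriangularDecomposition 𝒜)

/-! ### Consequences of the triangular decomposition for `A` itself. -/

section Decomposition

/-- Multiplication `T ⊗ A⁺ → A`. -/
noncomputable def midPos : 𝒯.mid ⊗[K] 𝒯.pos →ₗ[K] A := act 𝒯.mid 𝒯.pos.val.toLinearMap

theorem midPos_tmul (t : 𝒯.mid) (y : 𝒯.pos) : 𝒯.midPos (t ⊗ₜ y) = t * y := rfl

theorem act_midPos_bijective : Function.Bijective (act 𝒯.neg 𝒯.midPos) := by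
  have h : act 𝒯.neg 𝒯.midPos =
      tripleMul 𝒯.neg 𝒯.mid 𝒯.pos ∘ₗ (TensorProduct.assoc K 𝒯.neg 𝒯.mid 𝒯.pos).symm.toLinearMap := by
    apply LinearMap.ext
    intro z
    obtain ⟨z, rfl⟩ := (TensorProduct.assoc K 𝒯.neg 𝒯.mid 𝒯.pos).surjective z
    rw [LinearMap.comp_apply, LinearEquiv.coe_coe, LinearEquiv.symm_apply_apply]
    refine LinearMap.congr_fun (f := act 𝒯.neg 𝒯.midPos ∘ₗ
      (TensorProduct.assoc K 𝒯.neg 𝒯.mid 𝒯.pos).toLinearMap) ?_ z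
    refine TensorProduct.ext_threefold fun x y z => ?_
    exact (mul_assoc (x : A) y z).symm
  rw [h]
  exact 𝒯.mul_bijective.comp (TensorProduct.assoc K 𝒯.neg 𝒯.mid 𝒯.pos).symm.bijective

theorem finrank_eq : finrank K A =
    finrank K 𝒯.neg * (finrank K 𝒯.mid * finrank K 𝒯.pos) := by
  rw [← (LinearEquiv.ofBijective _ 𝒯.act_midPos_bijective).finrank_eq, finrank_tensorProduct,
    finrank_tensorProduct]

theorem isFree_self : 𝒯.IsFree A :=
  𝒯.isFree_of_act 𝒯.midPos 𝒯.act_midPos_bijective.2 (by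
    rw [finrank_tensorProduct]; exact 𝒯.finrank_eq)

theorem range_midPos : LinearMap.range 𝒯.midPos = Subalgebra.toSubmodule 𝒯.borel := by
  rw [toSubmodule_borel, 𝒯.pos_comm]
  apply le_antisymm
  · rintro _ ⟨z, rfl⟩
    induction z using TensorProduct.induction_on with
    | zero => simp
    | tmul t y => exact Submodule.mul_mem_mul t.2 y.2
    | add z z' h h' => rw [map_add]; exact add_mem h h'
  · rw [Submodule.mul_le]
    intro t ht y hy
    exact ⟨⟨t, ht⟩ ⊗ₜ ⟨y, hy⟩, rfl⟩

/-- `B⁺` is the image of `T ⊗ A⁺`, so `A⁻ ⊗ B⁺` has dimension at most `dim A`, while its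
multiplication map to `A` is onto. -/
theorem act_borel_bijective : Function.Bijective (act 𝒯.neg 𝒯.borel.val.toLinearMap) := by
  have hs : Function.Surjective (act 𝒯.neg 𝒯.borel.val.toLinearMap) := by
    intro a
    obtain ⟨z, rfl⟩ := 𝒯.act_midPos_bijective.2 a
    rw [← LinearMap.mem_range]
    induction z using TensorProduct.induction_on with
    | zero => simp
    | tmul x w =>
      have hw : 𝒯.midPos w ∈ 𝒯.borel := by
        have : 𝒯.midPos w ∈ LinearMap.range 𝒯.midPos := ⟨w, rfl⟩
        rwa [range_midPos] at this
      exact ⟨x ⊗ₜ ⟨_, hw⟩, rfl⟩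
    | add z z' h h' => rw [map_add]; exact add_mem h h'
  refine ⟨?_, hs⟩
  have h1 : finrank K (𝒯.neg ⊗[K] 𝒯.borel) ≤ finrank K A := by
    rw [finrank_tensorProduct, 𝒯.finrank_eq, ← finrank_tensorProduct (R := K) (M := 𝒯.mid)]
    refine Nat.mul_le_mul_left _ ?_
    have := LinearMap.finrank_range_le 𝒯.midPos
    rwa [range_midPos] at this
  have h2 := LinearMap.finrank_le_finrank_of_surjective hs
  exact (LinearMap.injective_iff_surjective_of_finrank_eq_finrank (le_antisymm h1 h2)).2 hs

noncomputable def negBorelEquiv : 𝒯.neg ⊗[K] 𝒯.borel ≃ₗ[K] A :=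
  LinearEquiv.ofBijective _ 𝒯.act_borel_bijective

theorem negBorelEquiv_tmul (x : 𝒯.neg) (b : 𝒯.borel) : 𝒯.negBorelEquiv (x ⊗ₜ b) = x * b := rfl

/-- The identification `A ≅ A⁻ ⊗ B⁺` respects right multiplication by `B⁺`; this is what makes the
inverse in `inducedInvAux` compatible with the tensor relations. -/
theorem negBorelEquiv_symm_mul (a : A) (b : 𝒯.borel) : 𝒯.negBorelEquiv.symm (a * b) =
    (LinearMap.mulRight K b).lTensor 𝒯.neg (𝒯.negBorelEquiv.symm a) := by
  rw [LinearEquiv.symm_apply_eq]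
  obtain ⟨z, rfl⟩ := 𝒯.negBorelEquiv.surjective a
  rw [LinearEquiv.symm_apply_apply]
  induction z using TensorProduct.induction_on with
  | zero => simp
  | tmul x c =>
    rw [LinearMap.lTensor_tmul, negBorelEquiv_tmul, negBorelEquiv_tmul, mul_assoc]
    rfl
  | add z z' h h' => rw [map_add, map_add, add_mul, h, h', map_add]

theorem negBorelEquiv_symm_neg (x : 𝒯.neg) : 𝒯.negBorelEquiv.symm (x : A) = x ⊗ₜ 1 := by
  rw [LinearEquiv.symm_apply_eq, negBorelEquiv_tmul, OneMemClass.coe_one, mul_one]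

end Decomposition

/-! ### The highest nonzero degree. -/

section TopDegree

variable {X : GrMod 𝒜} {d : ℤ}

theorem mem_posSoc_of_top (h : ∀ i, d < i → X.grading i = ⊥) {x : X} (hx : x ∈ X.grading d) :
    x ∈ 𝒯.posSoc X := by
  intro i hi a _ hai
  have := X.smul_mem i d a x hai hx
  rwa [h _ (by omega), Submodule.mem_bot] at this

/-- If `a` has degree `i < 0`, the component of `a y` in degree `d` is `a` times the component of
`y` in degree `d - i > d`, which is zero. -/
theorem proj_negRad_of_top (h : ∀ i, d < i → X.grading i = ⊥) {x : X} (hx : x ∈ 𝒯.negRad X) :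
    X.proj d x = 0 := by
  have : 𝒯.negRad X ≤ LinearMap.ker (X.proj d) := by
    rw [negRad, Submodule.span_le]
    rintro _ ⟨i, hi, a, _, hai, y, rfl⟩
    change X.proj d (a • y) = 0
    have h1 := GrMod.proj_smul_of_mem hai (d - i) y
    rw [add_sub_cancel] at h1
    have h2 := X.proj_mem (d - i) y
    rw [h _ (by omega), Submodule.mem_bot] at h2
    rw [h1, h2, smul_zero]
  exact this hx

theorem disjoint_negRad_of_top (h : ∀ i, d < i → X.grading i = ⊥) :
    Disjoint (X.grading d) (𝒯.negRad X) := by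
  rw [Submodule.disjoint_def]
  intro x hx hx'
  rw [← X.proj_same hx]
  exact 𝒯.proj_negRad_of_top h hx'

end TopDegree

/-! ### Induced modules: `A ⊗_{B⁺} N` is `A⁻ ⊗ N`. -/

section Induced

variable (N : GrMod (subGrading 𝒜 𝒯.borel))

variable {N} in
theorem smul_tmulB (a a' : A) (m : N) : a • N.tmulB a' m = N.tmulB (a * a') m := rfl

theorem act_tmulB_surjective : Function.Surjective (act 𝒯.neg (N.tmulB 1)) := by
  rw [← LinearMap.range_eq_top]
  refine Submodule.eq_top_iff'.2 fun v => ?_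
  obtain ⟨z, rfl⟩ := Submodule.mkQ_surjective _ v
  induction z using TensorProduct.induction_on with
  | zero => rw [map_zero]; exact zero_mem _
  | tmul a m =>
    change N.tmulB a m ∈ _
    obtain ⟨z, rfl⟩ := 𝒯.negBorelEquiv.surjective a
    induction z using TensorProduct.induction_on with
    | zero => simp
    | tmul x b =>
      rw [negBorelEquiv_tmul, N.tmulB_smul]
      exact ⟨x ⊗ₜ (b • m), by rw [act_tmul, smul_tmulB, mul_one]⟩
    | add z z' h h' => rw [map_add, map_add, LinearMap.add_apply]; exact add_mem h h'
  | add z z' h h' => rw [map_add]; exact add_mem h h'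

/-- Writing `a` as a sum of products `x b` with `x ∈ A⁻` and `b ∈ B⁺`, it sends `a ⊗ m` to the sum
of the `x ⊗ b m`. On `A ⊗_{B⁺} N` it becomes a left inverse of `A⁻ ⊗ N → A ⊗_{B⁺} N`. -/
noncomputable def inducedInvAux : A ⊗[K] N →ₗ[K] 𝒯.neg ⊗[K] N :=
  TensorProduct.lift (LinearMap.mk₂ K
    (fun a m => ((LinearMap.toSpanSingleton 𝒯.borel N m).restrictScalars K).lTensor 𝒯.neg
      (𝒯.negBorelEquiv.symm a))
    (fun a a' m => by rw [map_add, map_add])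
    (fun c a m => by rw [map_smul, map_smul])
    (fun a m m' => by
      rw [← LinearMap.add_apply, ← LinearMap.lTensor_add]
      congr 2
      ext b
      exact smul_add _ _ _)
    (fun c a m => by
      rw [← LinearMap.smul_apply, ← LinearMap.lTensor_smul]
      congr 2
      ext b
      exact smul_algebra_smul_comm _ _ _))

variable {N}

theorem inducedInvAux_tmul (a : A) (m : N) : 𝒯.inducedInvAux N (a ⊗ₜ m) =
    ((LinearMap.toSpanSingleton 𝒯.borel N m).restrictScalars K).lTensor 𝒯.neg
      (𝒯.negBorelEquiv.symm a) := rfl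

theorem inducedInvAux_relation (a : A) (b : 𝒯.borel) (m : N) :
    𝒯.inducedInvAux N ((a * b) ⊗ₜ m) = 𝒯.inducedInvAux N (a ⊗ₜ (b • m)) := by
  rw [inducedInvAux_tmul, inducedInvAux_tmul, negBorelEquiv_symm_mul, ← LinearMap.comp_apply,
    ← LinearMap.lTensor_comp]
  congr 2
  ext c
  exact mul_smul c b m

theorem inducedInvAux_eq_zero {x : A ⊗[K] N} (hx : x ∈ N.relations) :
    𝒯.inducedInvAux N x = 0 := by
  have key : ∀ a : A, 𝒯.inducedInvAux N (a • x) = 0 := by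
    change x ∈ Submodule.span A _ at hx
    induction hx using Submodule.span_induction with
    | mem x hx =>
      obtain ⟨a, b, m, rfl⟩ := hx
      intro a'
      rw [smul_sub, TensorProduct.smul_tmul', TensorProduct.smul_tmul', smul_eq_mul, smul_eq_mul,
        ← mul_assoc, map_sub, inducedInvAux_relation, sub_self]
    | zero => simp
    | add x y _ _ hx hy => intro a; rw [smul_add, map_add, hx, hy, add_zero]
    | smul c x _ hx => intro a; rw [smul_smul]; exact hx _
  have := key 1
  rwa [one_smul] at this

theorem act_tmulB_injective : Function.Injective (act 𝒯.neg (N.tmulB 1)) := by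
  let Φ : (A ⊗[K] N) ⧸ N.relations →ₗ[K] 𝒯.neg ⊗[K] N :=
    (N.relations.restrictScalars K).liftQ (𝒯.inducedInvAux N) fun x hx =>
      𝒯.inducedInvAux_eq_zero hx
  have h : Φ ∘ₗ act 𝒯.neg (N.tmulB 1) = LinearMap.id := by
    refine TensorProduct.ext' fun x m => ?_
    rw [LinearMap.comp_apply, act_tmul, smul_tmulB, mul_one]
    change 𝒯.inducedInvAux N ((x : A) ⊗ₜ m) = x ⊗ₜ m
    rw [inducedInvAux_tmul, negBorelEquiv_symm_neg, LinearMap.lTensor_tmul]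
    congr 1
    exact one_smul _ m
  exact Function.LeftInverse.injective (g := Φ) fun x => LinearMap.congr_fun h x

/-- The universal property of the induced module. -/
noncomputable def inducedDesc {X : Type*} [AddCommGroup X] [Module K X] [Module A X]
    [IsScalarTower K A X] (ι : N →ₗ[K] X) (h : ∀ (b : 𝒯.borel) (m : N), ι (b • m) = (b : A) • ι m) :
    (A ⊗[K] N) ⧸ N.relations →ₗ[A] X :=
  N.relations.liftQ
    (TensorProduct.AlgebraTensorModule.lift (LinearMap.toSpanSingleton A (N →ₗ[K] X) ι)) (by
      refine Submodule.span_le.2 ?_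
      rintro _ ⟨a, b, m, rfl⟩
      refine LinearMap.mem_ker.2 ((map_sub _ _ _).trans (sub_eq_zero.2 ?_))
      change (a * (b : A)) • ι m = a • ι (b • m)
      rw [mul_smul, h])

theorem inducedDesc_tmulB {X : Type*} [AddCommGroup X] [Module K X] [Module A X]
    [IsScalarTower K A X] (ι : N →ₗ[K] X) (h : ∀ (b : 𝒯.borel) (m : N), ι (b • m) = (b : A) • ι m)
    (m : N) : 𝒯.inducedDesc ι h (N.tmulB 1 m) = ι m :=
  one_smul A (ι m)

end Induced

/-! ### Standard objects: size, top component and universal property. -/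

section Standard

variable (M : 𝒯.TMod)

/-- The inflation of a graded `T`-module to `B⁺`. -/
noncomputable abbrev inflate : GrMod (subGrading 𝒜 𝒯.borel) :=
  GrMod.restrict 𝒯.borelProj 𝒯.borelProj_graded M

/-- The canonical map `M → Δ(M)`, `m ↦ 1 ⊗ m`. -/
noncomputable def unit : M →ₗ[K] 𝒯.standard M := (𝒯.inflate M).tmulB 1

variable {M}

theorem borel_smul_unit (b : 𝒯.borel) (m : M) :
    (b : A) • 𝒯.unit M m = 𝒯.unit M (𝒯.borelProj b • m) := by
  have := (𝒯.inflate M).tmulB_smul 1 b m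
  rw [one_mul] at this
  refine Eq.trans ?_ this
  refine (smul_tmulB 𝒯 (N := 𝒯.inflate M) (b : A) 1 m).trans ?_
  rw [mul_one]

theorem mid_le_borel : 𝒯.mid ≤ 𝒯.borel := le_sup_right

theorem pos_le_borel : 𝒯.pos ≤ 𝒯.borel := le_sup_left

theorem borelProj_mid {t : A} (ht : t ∈ 𝒯.mid) : 𝒯.borelProj ⟨t, 𝒯.mid_le_borel ht⟩ = ⟨t, ht⟩ :=
  Subtype.ext (DirectSum.decompose_of_mem_same 𝒜 (𝒯.mid_le t ht))

theorem mid_smul_unit (t : 𝒯.mid) (m : M) : (t : A) • 𝒯.unit M m = 𝒯.unit M (t • m) := by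
  rw [𝒯.borel_smul_unit ⟨t, 𝒯.mid_le_borel t.2⟩ m, 𝒯.borelProj_mid t.2]

theorem unit_mem {i : ℤ} {m : M} (hm : m ∈ M.grading i) :
    𝒯.unit M m ∈ (𝒯.standard M).grading i := by
  have h : (𝒯.inflate M).tmulB 1 m ∈ (𝒯.inflate M).inducedGrading i := Submodule.subset_span ⟨0, i, 1, m, SetLike.GradedOne.one_mem, hm, zero_add i, rfl⟩
  exact h

theorem act_unit_bijective : Function.Bijective (act 𝒯.neg (𝒯.unit M)) :=
  ⟨𝒯.act_tmulB_injective (N := 𝒯.inflate M), 𝒯.act_tmulB_surjective (𝒯.inflate M)⟩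

variable (M) in
theorem finrank_standard : finrank K (𝒯.standard M) = finrank K 𝒯.neg * finrank K M := by
  have h := (LinearEquiv.ofBijective (act 𝒯.neg (𝒯.unit M)) 𝒯.act_unit_bijective).finrank_eq
  rw [finrank_tensorProduct] at h
  exact h.symm

variable (M) in
theorem isFree_standard : 𝒯.IsFree (𝒯.standard M) :=
  𝒯.isFree_of_act (𝒯.unit M) 𝒯.act_unit_bijective.2 (𝒯.finrank_standard M)

theorem unit_injective : Function.Injective (𝒯.unit M) := by
  rw [injective_iff_map_eq_zero]
  intro m hm
  -- If `A` is the zero ring then `T` is zero and so is `M`; otherwise `1 ⊗ m` vanishes only for `m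
  -- = 0`.
  by_cases h1 : (1 : 𝒯.neg) = 0
  · have h2 : (1 : A) = 0 := congrArg Subtype.val h1
    have h3 : (1 : 𝒯.mid) = 0 := Subtype.ext h2
    rw [← one_smul 𝒯.mid m, h3, zero_smul]
  · obtain ⟨f, hf⟩ := Module.Projective.exists_dual_ne_zero K h1
    have h2 : ((1 : 𝒯.neg) ⊗ₜ[K] m : 𝒯.neg ⊗[K] M) = 0 := by
      refine 𝒯.act_unit_bijective.1 ?_
      rw [act_tmul, hm, smul_zero, map_zero]
    have h3 := congrArg (TensorProduct.lid K M ∘ f.rTensor M) h2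
    simp only [Function.comp_apply, LinearMap.rTensor_tmul, TensorProduct.lid_tmul, map_zero,
      smul_eq_zero] at h3
    exact h3.resolve_left hf

/-- The degrees of `Δ(M)` are bounded by those of `M`, and the top component is `M`. -/
theorem proj_standard {d : ℤ} (h : ∀ i, d < i → M.grading i = ⊥) (v : 𝒯.standard M) :
    (∀ i, d < i → (𝒯.standard M).proj i v = 0) ∧
      (𝒯.standard M).proj d v ∈ LinearMap.range (𝒯.unit M) := by
  classical
  obtain ⟨z, rfl⟩ := 𝒯.act_unit_bijective.2 v
  induction z using TensorProduct.induction_on with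
  | zero => simp
  | add z z' h1 h2 =>
    rw [map_add]
    refine ⟨fun i hi => ?_, ?_⟩
    · rw [map_add, h1.1 i hi, h2.1 i hi, add_zero]
    · rw [map_add]; exact add_mem h1.2 h2.2
  | tmul x m =>
    rw [act_tmul]
    induction m using GrMod.homogeneous_induction with
    | h0 => simp
    | ha m m' h1 h2 =>
      rw [map_add, smul_add]
      refine ⟨fun i hi => ?_, ?_⟩
      · rw [map_add, h1.1 i hi, h2.1 i hi, add_zero]
      · rw [map_add]; exact add_mem h1.2 h2.2
    | hh j m hm =>
      by_cases hj : d < j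
      · rw [h j hj, Submodule.mem_bot] at hm
        simp [hm]
      -- In degrees at least `d` only the degree zero part of `x` contributes, since `x` has degrees
      -- at most `0` and `m` has degree `j ≤ d`. That part is a scalar.
      have key : ∀ i, d ≤ i → (𝒯.standard M).proj i ((x : A) • 𝒯.unit M m) =
          if i = j then (DirectSum.decompose 𝒜 (x : A) 0 : A) • 𝒯.unit M m else 0 := by
        intro i hi
        conv_lhs => rw [← DirectSum.sum_support_decompose 𝒜 (x : A), Finset.sum_smul, map_sum]
        have e : ∀ k, (𝒯.standard M).proj i ((DirectSum.decompose 𝒜 (x : A) k : A) • 𝒯.unit M m) =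
            if k = 0 then (if i = j then (DirectSum.decompose 𝒜 (x : A) 0 : A) • 𝒯.unit M m else 0)
              else 0 := by
          intro k
          have hk := (DirectSum.decompose 𝒜 (x : A) k).2
          have hk' := 𝒯.neg_homogeneous k x.2
          rw [GrMod.proj_of_mem _ ((𝒯.standard M).smul_mem k j _ _ hk (𝒯.unit_mem hm))]
          rcases lt_trichotomy k 0 with h0 | h0 | h0
          · rw [if_neg (by omega), if_neg h0.ne]
          · subst h0
            simp only [zero_add, if_true, eq_comm]
          · have h00 : (DirectSum.decompose 𝒜 (x : A) k : A) = 0 := 𝒯.neg_supp k h0 _ hk' hk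
            rw [h00, zero_smul, ite_self, if_neg h0.ne']
        rw [Finset.sum_congr rfl fun k _ => e k, Finset.sum_ite_eq']
        split_ifs with h1 h2 h2
        · rfl
        · rfl
        · rw [DFinsupp.notMem_support_iff] at h1
          rw [h1]; simp
        · rfl
      refine ⟨fun i hi => ?_, ?_⟩
      · rw [key i hi.le, if_neg (by omega)]
      · rw [key d le_rfl]
        split_ifs
        · obtain ⟨c, hc⟩ := Algebra.mem_bot.1 (𝒯.neg_zero _ (𝒯.neg_homogeneous 0 x.2)
            (DirectSum.decompose 𝒜 (x : A) 0).2)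
          rw [← hc, algebraMap_smul]
          exact Submodule.smul_mem _ _ ⟨m, rfl⟩
        · exact zero_mem _

theorem standard_grading_eq_bot {d : ℤ} (h : ∀ i, d < i → M.grading i = ⊥) {i : ℤ} (hi : d < i) :
    (𝒯.standard M).grading i = ⊥ := by
  rw [eq_bot_iff]
  intro v hv
  rw [Submodule.mem_bot, ← (𝒯.standard M).proj_same hv]
  exact (𝒯.proj_standard h v).1 i hi

theorem standard_grading_le {d : ℤ} (h : ∀ i, d < i → M.grading i = ⊥) :
    (𝒯.standard M).grading d ≤ LinearMap.range (𝒯.unit M) := by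
  intro v hv
  rw [← (𝒯.standard M).proj_same hv]
  exact (𝒯.proj_standard h v).2

section Desc

variable {X : Type*} [AddCommGroup X] [Module K X] [Module A X] [IsScalarTower K A X]

/-- On `posSoc X` the algebra `A⁺` acts through its degree zero part, which consists of scalars. So
`B⁺ = A⁺ T` acts on the image of `ι` through its projection to `T`. -/
theorem borel_smul_of_posSoc (ι : M →ₗ[K] X) (hT : ∀ (t : 𝒯.mid) (m : M), ι (t • m) = (t : A) • ι m)
    (hpos : ∀ m, ι m ∈ 𝒯.posSoc X) (b : 𝒯.borel) (m : M) :
    (b : A) • ι m = ι (𝒯.borelProj b • m) := by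
  classical
  obtain ⟨b, hb⟩ := b
  have hb' : b ∈ Subalgebra.toSubmodule 𝒯.pos * Subalgebra.toSubmodule 𝒯.mid := by
    rw [← toSubmodule_borel]; exact hb
  induction hb' using Submodule.mul_induction_on' with
  | mem_mul_mem y hy t ht =>
    have e : 𝒯.borelProj ⟨y * t, hb⟩ = 𝒯.borelProj ⟨y, 𝒯.pos_le_borel hy⟩ * ⟨t, ht⟩ := by
      rw [← 𝒯.borelProj_mid ht, ← map_mul]; rfl
    rw [e, mul_smul, mul_smul, ← hT ⟨t, ht⟩ m]
    generalize (⟨t, ht⟩ : 𝒯.mid) • m = n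
    have h0 := 𝒯.pos_homogeneous 0 hy
    obtain ⟨c, hc⟩ := Algebra.mem_bot.1 (𝒯.pos_zero _ h0 (DirectSum.decompose 𝒜 y 0).2)
    have e2 : 𝒯.borelProj ⟨y, 𝒯.pos_le_borel hy⟩ = algebraMap K 𝒯.mid c := Subtype.ext hc.symm
    rw [e2, algebraMap_smul, map_smul]
    conv_lhs => rw [← DirectSum.sum_support_decompose 𝒜 y, Finset.sum_smul]
    have e3 : ∀ k, (DirectSum.decompose 𝒜 y k : A) • ι n = if k = 0 then c • ι n else 0 := by
      intro k
      have hk := (DirectSum.decompose 𝒜 y k).2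
      have hk' := 𝒯.pos_homogeneous k hy
      rcases lt_trichotomy k 0 with h0 | h0 | h0
      · have h00 : (DirectSum.decompose 𝒜 y k : A) = 0 := 𝒯.pos_supp k h0 _ hk' hk
        rw [h00, zero_smul, if_neg h0.ne]
      · subst h0
        rw [if_pos rfl, ← hc, algebraMap_smul]
      · rw [if_neg h0.ne']
        exact hpos n k h0 _ hk' hk
    rw [Finset.sum_congr rfl fun k _ => e3 k, Finset.sum_ite_eq']
    split_ifs with h1
    · rfl
    · have := e3 0
      rw [DFinsupp.notMem_support_iff] at h1
      rw [h1, if_pos rfl] at this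
      simpa using this
  | add x hx y hy hx' hy' =>
    rw [← toSubmodule_borel] at hx hy
    have e : (⟨x + y, hb⟩ : 𝒯.borel) = ⟨x, hx⟩ + ⟨y, hy⟩ := rfl
    rw [e, map_add, add_smul, map_add, ← hx' hx, ← hy' hy]
    exact add_smul _ _ _

/-- The universal property of `Δ(M)`. -/
noncomputable def descLin (ι : M →ₗ[K] X) (hT : ∀ (t : 𝒯.mid) (m : M), ι (t • m) = (t : A) • ι m)
    (hpos : ∀ m, ι m ∈ 𝒯.posSoc X) : 𝒯.standard M →ₗ[A] X :=
  𝒯.inducedDesc (N := 𝒯.inflate M) ι fun b m => (𝒯.borel_smul_of_posSoc ι hT hpos b m).symm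

theorem descLin_unit (ι : M →ₗ[K] X)
    (hT : ∀ (t : 𝒯.mid) (m : M), ι (t • m) = (t : A) • ι m)
    (hpos : ∀ m, ι m ∈ 𝒯.posSoc X) (m : M) : 𝒯.descLin ι hT hpos (𝒯.unit M m) = ι m :=
  𝒯.inducedDesc_tmulB (N := 𝒯.inflate M) ι _ m

theorem descLin_act (ι : M →ₗ[K] X)
    (hT : ∀ (t : 𝒯.mid) (m : M), ι (t • m) = (t : A) • ι m)
    (hpos : ∀ m, ι m ∈ 𝒯.posSoc X) (z : 𝒯.neg ⊗[K] M) :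
    𝒯.descLin ι hT hpos (act 𝒯.neg (𝒯.unit M) z) = act 𝒯.neg ι z := by
  induction z using TensorProduct.induction_on with
  | zero => simp
  | tmul x m => rw [act_tmul, act_tmul, map_smul, descLin_unit]
  | add z z' h h' => rw [map_add, map_add, map_add, h, h']

end Desc

/-- The graded version of the universal property of `Δ(M)`. -/
noncomputable def desc {X : GrMod 𝒜} (ι : M →ₗ[K] X)
    (hT : ∀ (t : 𝒯.mid) (m : M), ι (t • m) = (t : A) • ι m) (hpos : ∀ m, ι m ∈ 𝒯.posSoc X)
    (hdeg : ∀ i, ∀ m ∈ M.grading i, ι m ∈ X.grading i) : 𝒯.standard M ⟶ X where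
  toLin := 𝒯.descLin ι hT hpos
  map_mem := by
    intro d v hv
    have : (𝒯.standard M).grading d ≤
        (X.grading d).comap ((𝒯.descLin ι hT hpos).restrictScalars K) := by
      refine Submodule.span_le.2 ?_
      rintro _ ⟨k, l, a, m, ha, hm, rfl, rfl⟩
      exact X.smul_mem k l a _ ha (hdeg l m hm)
    exact this hv

/-- Under `Δ(M) ≅ A⁻ ⊗ M` the morphism becomes `act 𝒯.neg ι`, which freeness makes injective. -/
theorem desc_injective {X : GrMod 𝒜} (ι : M →ₗ[K] X)
    (hT : ∀ (t : 𝒯.mid) (m : M), ι (t • m) = (t : A) • ι m) (hpos : ∀ m, ι m ∈ 𝒯.posSoc X)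
    (hdeg : ∀ i, ∀ m ∈ M.grading i, ι m ∈ X.grading i) (hX : 𝒯.IsFree X)
    (hι : Function.Injective ι) (hd : Disjoint (LinearMap.range ι) (𝒯.negRad X)) :
    Function.Injective (𝒯.desc ι hT hpos hdeg).toLin := by
  have h := 𝒯.act_injective hX ι hι hd
  rw [injective_iff_map_eq_zero]
  intro v hv
  obtain ⟨z, rfl⟩ := 𝒯.act_unit_bijective.2 v
  have : act 𝒯.neg ι z = 0 := (𝒯.descLin_act ι hT hpos z).symm.trans hv
  rw [h (this.trans (map_zero _).symm), map_zero]

end Standard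

end PreTriangularDecomposition

end GradedTilting

/-! ### Heads of local objects. -/

namespace GradedTilting

open Module

namespace GrMod

variable {K R : Type u} [Field K] [Ring R] [Algebra K R] {ℛ : ℤ → Submodule K R}
  [FiniteDimensional K R]

/-- The sum of two proper subobjects is proper, so a maximal proper subobject contains every proper
one and is the radical. -/
theorem IsLocal.radical_spec {M : GrMod ℛ} (hM : M.IsLocal) :
    M.radical.toSubmodule ≠ ⊤ ∧ ∀ N : M.GrSub, N.toSubmodule ≠ ⊤ →
      N.toSubmodule ≤ M.radical.toSubmodule := by
  have := hM.1
  obtain ⟨N, hN, hmax⟩ : ∃ N : M.GrSub, N.toSubmodule ≠ ⊤ ∧ ∀ N' : M.GrSub, N'.toSubmodule ≠ ⊤ →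
      N'.toSubmodule ≤ N.toSubmodule := by
    obtain ⟨S, ⟨N, hN, rfl⟩, hS⟩ := set_has_maximal_iff_noetherian.2
      (inferInstanceAs (IsNoetherian R M))
      {S | ∃ N : M.GrSub, N.toSubmodule ≠ ⊤ ∧ N.toSubmodule = S}
      ⟨⊥, M.botSub, bot_ne_top, rfl⟩
    refine ⟨N, hN, fun N' hN' => ?_⟩
    have h := hS (supSub N N').toSubmodule ⟨supSub N N', fun h => (hM.2 N N' h).elim hN hN', rfl⟩
    rw [supSub_toSubmodule] at h
    exact le_of_le_of_eq le_sup_right (le_sup_left.eq_of_not_lt h).symm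
  have hr : M.radical.toSubmodule = N.toSubmodule := by
    have hNm : N.IsMaximal := ⟨hN, fun N' h => or_iff_not_imp_right.2 fun h' =>
      le_antisymm (hmax N' h') h⟩
    refine le_antisymm (sInf_le ⟨N, hNm, rfl⟩) (le_sInf ?_)
    rintro _ ⟨N', hN', rfl⟩
    rcases hN'.2 N (hmax N' hN'.1) with h | h
    · exact h.le
    · exact absurd h hN
  rw [hr]
  exact ⟨hN, hmax⟩

theorem IsLocal.isSimple_head {M : GrMod ℛ} (hM : M.IsLocal) : M.head.IsSimple := by
  obtain ⟨h1, h2⟩ := hM.radical_spec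
  refine ⟨Submodule.Quotient.nontrivial_iff.2 h1, fun N => ?_⟩
  have hs := mkQ_surjective M.radical
  by_cases h : (comapSub (mkQ M.radical) N).toSubmodule = ⊤
  · right
    rw [← Submodule.map_comap_eq_of_surjective hs N.toSubmodule]
    refine (congrArg (Submodule.map (mkQ M.radical).toLin) h).trans ?_
    rw [Submodule.map_top]
    exact LinearMap.range_eq_top.2 hs
  · left
    rw [eq_bot_iff]
    intro y hy
    obtain ⟨x, rfl⟩ := hs y
    exact (Submodule.mem_bot R).2 ((Submodule.Quotient.mk_eq_zero _).2 (h2 _ h hy))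

theorem IsLocal.head_iso {M S : GrMod ℛ} (hM : M.IsLocal) (hS : S.IsSimple) (f : M ⟶ S)
    (hf : Function.Surjective f.toLin) : Nonempty (M.head ≅ S) := by
  obtain ⟨h1, h2⟩ := hM.radical_spec
  have hne : (kerSub f).toSubmodule ≠ ⊤ := by
    intro h
    have := hS.1
    obtain ⟨y, hy⟩ := exists_ne (0 : S)
    obtain ⟨x, rfl⟩ := hf y
    exact hy (LinearMap.mem_ker.1 (h ▸ Submodule.mem_top : x ∈ (kerSub f).toSubmodule))
  refine ⟨quotIso _ f (le_antisymm ?_ (h2 _ hne)) hf⟩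
  intro x hx
  rcases hS.2 (mapSub f M.radical) with h | h
  · exact (Submodule.mem_bot R).1 (h ▸ (⟨x, hx, rfl⟩ : f.toLin x ∈ (mapSub f M.radical).toSubmodule))
  · refine absurd (eq_top_iff.2 fun z _ => ?_) h1
    have hz : f.toLin z ∈ (mapSub f M.radical).toSubmodule := h ▸ Submodule.mem_top
    obtain ⟨w, hw, hwz⟩ := hz
    rw [← sub_add_cancel z w]
    refine add_mem (h2 _ hne ?_) hw
    rw [kerSub_toSubmodule, LinearMap.mem_ker, map_sub, hwz, sub_self]

end GrMod

namespace PreTriangularDecomposition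

variable {K A : Type u} [Field K] [Ring A] [Algebra K A] [FiniteDimensional K A]
  {𝒜 : ℤ → Submodule K A} [GradedAlgebra 𝒜] (𝒯 : PreTriangularDecomposition 𝒜)

/-! ### Simple objects of `𝒢(T)`: a simple `T`-module together with a degree. -/

section Concentrated

theorem mem_subGrading_mid (t : 𝒯.mid) : t ∈ subGrading 𝒜 𝒯.mid 0 := 𝒯.mid_le t t.2

theorem eq_zero_of_mem_subGrading_mid {t : 𝒯.mid} {i : ℤ} (ht : t ∈ subGrading 𝒜 𝒯.mid i)
    (hi : i ≠ 0) : t = 0 :=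
  Subtype.ext ((DirectSum.decompose_of_mem_same 𝒜 (𝒯.mid_le t t.2)).symm.trans
    (DirectSum.decompose_of_mem_ne 𝒜 ht hi))

/-- A `T`-module, placed in degree `d`. -/
noncomputable def conc (d : ℤ) (V : Type u) [AddCommGroup V] [Module K V] [Module 𝒯.mid V]
    [IsScalarTower K 𝒯.mid V] [Module.Finite 𝒯.mid V] : 𝒯.TMod where
  carrier := V
  grading i := if i = d then ⊤ else ⊥
  isInternal := by
    refine isInternal_of_proj _ (fun i => if i = d then LinearMap.id else 0) ?_ ?_ ?_
    · intro i v hv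
      split_ifs at hv ⊢ with h
      · rfl
      · exact ((Submodule.mem_bot K).1 hv).symm
    · intro i j hij v hv
      by_cases h : i = d
      · rw [if_neg (by omega)] at hv
        rw [(Submodule.mem_bot K).1 hv, map_zero]
      · rw [if_neg h, LinearMap.zero_apply]
    · rw [eq_top_iff]
      exact le_iSup_of_le d (by rw [if_pos rfl])
  smul_mem i j t m ht hm := by
    by_cases h : i = 0
    · subst h
      rw [zero_add]
      split_ifs at hm ⊢
      · trivial
      · rw [(Submodule.mem_bot K).1 hm, smul_zero]; exact zero_mem _
    · rw [𝒯.eq_zero_of_mem_subGrading_mid ht h, zero_smul]; exact zero_mem _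
  finite := inferInstance

theorem mem_conc {d : ℤ} {V : Type u} [AddCommGroup V] [Module K V] [Module 𝒯.mid V]
    [IsScalarTower K 𝒯.mid V] [Module.Finite 𝒯.mid V] (v : 𝒯.conc d V) :
    v ∈ (𝒯.conc d V).grading d := by
  change v ∈ (if d = d then (⊤ : Submodule K V) else ⊥)
  rw [if_pos rfl]; trivial

theorem grading_eq_bot_of_forall_mem {M : 𝒯.TMod} {d : ℤ} (h : ∀ m : M, m ∈ M.grading d) {i : ℤ}
    (hi : i ≠ d) : M.grading i = ⊥ := by
  rw [eq_bot_iff]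
  intro m hm
  rw [Submodule.mem_bot, ← M.proj_same hm, M.proj_ne (h m) hi.symm]

theorem isSimple_conc (d : ℤ) (V : Type u) [AddCommGroup V] [Module K V] [Module 𝒯.mid V]
    [IsScalarTower K 𝒯.mid V] [Module.Finite 𝒯.mid V] [IsSimpleModule 𝒯.mid V] :
    (𝒯.conc d V).IsSimple :=
  ⟨IsSimpleModule.nontrivial 𝒯.mid V,
    fun N => eq_bot_or_eq_top (α := Submodule 𝒯.mid V) N.toSubmodule⟩

/-- As `T` is in degree zero, every homogeneous component is a subobject. -/
theorem exists_degree_of_isSimple {M : 𝒯.TMod} (hM : M.IsSimple) : ∃ d, ∀ m : M, m ∈ M.grading d := by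
  have := hM.1
  obtain ⟨d, hd⟩ := M.exists_grading_ne_bot
  let N : M.GrSub := GrMod.GrSub.mk'
    { carrier := M.grading d
      zero_mem' := zero_mem _
      add_mem' := add_mem
      smul_mem' := fun t m hm => by
        have := M.smul_mem 0 d t m (𝒯.mem_subGrading_mid t) hm
        rwa [zero_add] at this } fun i m hm => by
    have hm' : m ∈ M.grading d := hm
    rw [M.proj_of_mem hm']
    split_ifs
    · exact hm
    · exact zero_mem _
  refine ⟨d, ?_⟩
  rcases hM.2 N with h | h
  · refine absurd (eq_bot_iff.2 fun m hm => ?_) hd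
    have : m ∈ N.toSubmodule := hm
    rw [h] at this
    exact this
  · intro m
    have : m ∈ N.toSubmodule := h ▸ Submodule.mem_top
    exact this

theorem isSimpleModule_of_isSimple {M : 𝒯.TMod} (hM : M.IsSimple) : IsSimpleModule 𝒯.mid M := by
  obtain ⟨d, hd⟩ := 𝒯.exists_degree_of_isSimple hM
  have := hM.1
  rw [isSimpleModule_iff]
  exact
    { exists_pair_ne := ⟨⊥, ⊤, bot_ne_top⟩
      eq_bot_or_eq_top := fun N => hM.2 (GrMod.GrSub.mk' N fun i m hm => by
        rw [M.proj_of_mem (hd m)]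
        split_ifs
        · exact hm
        · exact zero_mem _) }

end Concentrated

section Irr

variable {𝒯}

theorem rep_isSimple (l : 𝒯.Irr) : (𝒯.rep l).IsSimple := (Quotient.out l).2

instance (l : 𝒯.Irr) : IsSimpleModule 𝒯.mid (𝒯.rep l) := 𝒯.isSimpleModule_of_isSimple (rep_isSimple l)

instance (l : 𝒯.Irr) : Nontrivial (𝒯.rep l) := (rep_isSimple l).1

theorem deg_eq_of_forall_mem {l : 𝒯.Irr} {d : ℤ} (h : ∀ m : 𝒯.rep l, m ∈ (𝒯.rep l).grading d) :
    𝒯.deg l = d := by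
  have : {i | (𝒯.rep l).grading i ≠ ⊥} = {d} := by
    ext i
    refine ⟨fun hi => by_contra fun hne => hi (𝒯.grading_eq_bot_of_forall_mem h hne), ?_⟩
    rintro rfl hb
    obtain ⟨m, hm⟩ := exists_ne (0 : 𝒯.rep l)
    have := h m
    rw [hb] at this
    exact hm this
  rw [deg, this, csSup_singleton]

theorem mem_rep {l : 𝒯.Irr} (m : 𝒯.rep l) : m ∈ (𝒯.rep l).grading (𝒯.deg l) := by
  obtain ⟨d, hd⟩ := 𝒯.exists_degree_of_isSimple (rep_isSimple l)
  rw [deg_eq_of_forall_mem hd]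
  exact hd m

/-- An isomorphism class is determined by its degree and its underlying `T`-module, so a `T`-linear
isomorphism suffices once the degrees agree. -/
theorem irr_ext {l m : 𝒯.Irr} (hd : 𝒯.deg l = 𝒯.deg m) (e : 𝒯.rep l ≃ₗ[𝒯.mid] 𝒯.rep m) : l = m := by
  have hiso : Nonempty (𝒯.rep l ≅ 𝒯.rep m) := by
    refine ⟨GrMod.isoOfBijective ⟨e.toLinearMap, fun i x hx => ?_⟩ e.bijective⟩
    by_cases hi : i = 𝒯.deg l
    · subst hi; rw [hd]; exact mem_rep _
    · rw [𝒯.grading_eq_bot_of_forall_mem mem_rep hi, Submodule.mem_bot] at hx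
      rw [hx, map_zero]; exact zero_mem _
  exact Quotient.out_equiv_out.1 hiso

theorem exists_irr (d : ℤ) (V : Type u) [AddCommGroup V] [Module K V] [Module 𝒯.mid V]
    [IsScalarTower K 𝒯.mid V] [IsSimpleModule 𝒯.mid V] :
    ∃ l : 𝒯.Irr, 𝒯.deg l = d ∧ Nonempty (𝒯.rep l ≃ₗ[𝒯.mid] V) := by
  let M : {M : 𝒯.TMod // M.IsSimple} := ⟨𝒯.conc d V, 𝒯.isSimple_conc d V⟩
  let l : 𝒯.Irr := Quotient.mk _ M
  obtain ⟨e⟩ : Nonempty (𝒯.rep l ≅ 𝒯.conc d V) := Quotient.mk_out (s := (isIsomorphicSetoid 𝒯.TMod).comap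
    (Subtype.val : {M : 𝒯.TMod // M.IsSimple} → 𝒯.TMod)) M
  refine ⟨l, deg_eq_of_forall_mem fun m => ?_, ⟨GrMod.isoEquiv e⟩⟩
  have := e.inv.map_mem d (e.hom.toLin m) (𝒯.mem_conc _)
  rwa [show e.inv.toLin (e.hom.toLin m) = m from
    LinearMap.congr_fun (congrArg GrMod.Hom.toLin e.hom_inv_id) m] at this

end Irr

/-! ### Top components and the simple objects `L(λ)`. -/

section Top

variable {𝒯}

/-- The morphism `Δ(M) → X` for `M` in degree `d`, if `X` has no component of degree above `d`. -/
noncomputable def descTop {M : 𝒯.TMod} {d : ℤ} (hM : ∀ m : M, m ∈ M.grading d) {X : GrMod 𝒜}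
    (hX : ∀ i, d < i → X.grading i = ⊥) (ι : M →ₗ[𝒯.mid] X) (hι : ∀ m, ι m ∈ X.grading d) :
    𝒯.standard M ⟶ X :=
  𝒯.desc (ι.restrictScalars K) (fun t m => ι.map_smul t m)
    (fun m => 𝒯.mem_posSoc_of_top hX (hι m)) (fun i m hm => by
      by_cases hi : i = d
      · subst hi; exact hι m
      · rw [𝒯.grading_eq_bot_of_forall_mem hM hi, Submodule.mem_bot] at hm
        rw [hm, map_zero]; exact zero_mem _)

theorem descTop_unit {M : 𝒯.TMod} {d : ℤ} (hM : ∀ m : M, m ∈ M.grading d) {X : GrMod 𝒜}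
    (hX : ∀ i, d < i → X.grading i = ⊥) (ι : M →ₗ[𝒯.mid] X) (hι : ∀ m, ι m ∈ X.grading d) (m : M) :
    (descTop hM hX ι hι).toLin (𝒯.unit M m) = ι m :=
  𝒯.descLin_unit (ι.restrictScalars K) (fun t m => ι.map_smul t m)
    (fun m => 𝒯.mem_posSoc_of_top hX (hι m)) m

theorem descTop_injective {M : 𝒯.TMod} {d : ℤ} (hM : ∀ m : M, m ∈ M.grading d) {X : GrMod 𝒜}
    (hX : ∀ i, d < i → X.grading i = ⊥) (ι : M →ₗ[𝒯.mid] X) (hι : ∀ m, ι m ∈ X.grading d)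
    (hF : 𝒯.IsFree X) (hinj : Function.Injective ι) :
    Function.Injective (descTop hM hX ι hι).toLin := by
  refine 𝒯.desc_injective _ _ _ _ hF hinj ((𝒯.disjoint_negRad_of_top hX).mono_left ?_)
  rintro _ ⟨m, rfl⟩
  exact hι m

/-- The top component of `X` is `l`. -/
structure TopIs (X : GrMod 𝒜) (l : 𝒯.Irr) : Prop where
  above : ∀ i, 𝒯.deg l < i → X.grading i = ⊥
  exists_map : ∃ ι : 𝒯.rep l →ₗ[𝒯.mid] X, Function.Injective ι ∧
    ∀ x, x ∈ X.grading (𝒯.deg l) ↔ x ∈ LinearMap.range ι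

theorem TopIs.grading_ne_bot {X : GrMod 𝒜} {l : 𝒯.Irr} (h : TopIs X l) :
    X.grading (𝒯.deg l) ≠ ⊥ := by
  obtain ⟨ι, hι, hr⟩ := h.exists_map
  intro hb
  obtain ⟨m, hm⟩ := exists_ne (0 : 𝒯.rep l)
  have := (hr (ι m)).2 ⟨m, rfl⟩
  rw [hb, Submodule.mem_bot] at this
  exact hm (hι (this.trans (map_zero ι).symm))

theorem TopIs.unique {X : GrMod 𝒜} {l m : 𝒯.Irr} (h : TopIs X l) (h' : TopIs X m) : l = m := by
  have hd : 𝒯.deg l = 𝒯.deg m := le_antisymm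
    (not_lt.1 fun hlt => h.grading_ne_bot (h'.above _ hlt))
    (not_lt.1 fun hlt => h'.grading_ne_bot (h.above _ hlt))
  obtain ⟨ι, hι, hr⟩ := h.exists_map
  obtain ⟨κ, hκ, hr'⟩ := h'.exists_map
  have hrange : LinearMap.range ι = LinearMap.range κ := by
    ext x
    rw [← hr, hd, hr']
  exact irr_ext hd ((LinearEquiv.ofInjective ι hι).trans ((LinearEquiv.ofEq _ _ hrange).trans
    (LinearEquiv.ofInjective κ hκ).symm))

theorem TopIs.of_iso {X Y : GrMod 𝒜} {l : 𝒯.Irr} (h : TopIs X l) (e : X ≅ Y) : TopIs Y l := by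
  obtain ⟨ι, hι, hr⟩ := h.exists_map
  refine ⟨fun i hi => GrMod.grading_eq_bot_of_surjective e.hom (GrMod.iso_bijective e).2
    (h.above i hi), (e.hom.toLin.restrictScalars 𝒯.mid) ∘ₗ ι,
    (GrMod.iso_bijective e).1.comp hι, fun y => ⟨fun hy => ?_, ?_⟩⟩
  · obtain ⟨x, hx, rfl⟩ := GrMod.exists_lift_grading e.hom (GrMod.iso_bijective e).2 hy
    obtain ⟨m, rfl⟩ := (hr x).1 hx
    exact ⟨m, rfl⟩
  · rintro ⟨m, rfl⟩
    exact e.hom.map_mem _ _ ((hr _).2 ⟨m, rfl⟩)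

variable (𝒯)

/-- The canonical map `l → Δ(l)`. -/
noncomputable def unitT (M : 𝒯.TMod) : M →ₗ[𝒯.mid] 𝒯.standard M where
  toFun := 𝒯.unit M
  map_add' := map_add _
  map_smul' t m := (𝒯.mid_smul_unit t m).symm

theorem rep_above (l : 𝒯.Irr) (i : ℤ) (hi : 𝒯.deg l < i) : (𝒯.rep l).grading i = ⊥ :=
  𝒯.grading_eq_bot_of_forall_mem mem_rep hi.ne'

/-- The canonical map `l → Δ(l)`. -/
noncomputable def unitD (l : 𝒯.Irr) : 𝒯.rep l →ₗ[𝒯.mid] 𝒯.Delta l := 𝒯.unitT (𝒯.rep l)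

theorem unitD_injective (l : 𝒯.Irr) : Function.Injective (𝒯.unitD l) := 𝒯.unit_injective

theorem unitD_mem (l : 𝒯.Irr) (m : 𝒯.rep l) : 𝒯.unitD l m ∈ (𝒯.Delta l).grading (𝒯.deg l) :=
  𝒯.unit_mem (mem_rep m)

theorem exists_unitD (l : 𝒯.Irr) {x : 𝒯.Delta l} (hx : x ∈ (𝒯.Delta l).grading (𝒯.deg l)) :
    ∃ m, 𝒯.unitD l m = x :=
  𝒯.standard_grading_le (𝒯.rep_above l) hx

theorem topIs_Delta (l : 𝒯.Irr) : TopIs (𝒯.Delta l) l :=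
  ⟨fun _ hi => 𝒯.standard_grading_eq_bot (𝒯.rep_above l) hi, 𝒯.unitD l, 𝒯.unitD_injective l,
    fun _ => ⟨𝒯.exists_unitD l, by rintro ⟨m, rfl⟩; exact 𝒯.unitD_mem l m⟩⟩

theorem Delta_induction (l : 𝒯.Irr) {p : 𝒯.Delta l → Prop} (h0 : p 0)
    (hadd : ∀ x y, p x → p y → p (x + y)) (h : ∀ (a : A) (m : 𝒯.rep l), p (a • 𝒯.unitD l m))
    (x : 𝒯.Delta l) : p x := by
  obtain ⟨z, rfl⟩ := (𝒯.act_unit_bijective (M := 𝒯.rep l)).2 x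
  induction z using TensorProduct.induction_on with
  | zero => rw [map_zero]; exact h0
  | tmul x m => exact h x m
  | add z z' h h' => rw [map_add]; exact hadd _ _ h h'

/-- `Δ(l)` is generated by any nonzero element of its top component. -/
theorem Delta_sub_eq_top (l : 𝒯.Irr) (N : Submodule A (𝒯.Delta l)) {m : 𝒯.rep l} (hm : m ≠ 0)
    (h : 𝒯.unitD l m ∈ N) : N = ⊤ := by
  let N' : Submodule 𝒯.mid (𝒯.rep l) := (N.restrictScalars 𝒯.mid).comap (𝒯.unitD l)
  have hN' : N' = ⊤ := (eq_bot_or_eq_top N').resolve_left fun hb => hm <| by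
    have : m ∈ N' := h
    rwa [hb, Submodule.mem_bot] at this
  refine Submodule.eq_top_iff'.2 fun v => ?_
  induction v using 𝒯.Delta_induction l with
  | h0 => exact zero_mem _
  | hadd x y hx hy => exact add_mem hx hy
  | h a m =>
    have : m ∈ N' := hN' ▸ Submodule.mem_top
    exact N.smul_mem a this

theorem Delta_nontrivial (l : 𝒯.Irr) : Nontrivial (𝒯.Delta l) :=
  (𝒯.unitD_injective l).nontrivial

/-- A nonzero element of the top component generates `Δ(l)`. So proper graded submodules vanish in
degree `deg l`, and two of them cannot add up to everything. -/
theorem Delta_isLocal (l : 𝒯.Irr) : (𝒯.Delta l).IsLocal := by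
  refine ⟨𝒯.Delta_nontrivial l, fun N N' h => ?_⟩
  by_contra hne
  rw [not_or] at hne
  have key : ∀ N : (𝒯.Delta l).GrSub, N.toSubmodule ≠ ⊤ → ∀ x ∈ N.toSubmodule,
      (𝒯.Delta l).proj (𝒯.deg l) x = 0 := by
    intro N hN x hx
    obtain ⟨m, hm⟩ := 𝒯.exists_unitD l ((𝒯.Delta l).proj_mem (𝒯.deg l) x)
    by_contra h0
    refine hN (𝒯.Delta_sub_eq_top l N.toSubmodule (m := m) ?_ ?_)
    · rintro rfl
      rw [map_zero] at hm
      exact h0 hm.symm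
    · rw [hm]; exact N.proj_mem _ hx
  obtain ⟨m, hm⟩ := exists_ne (0 : 𝒯.rep l)
  obtain ⟨x, hx, y, hy, hxy⟩ := Submodule.mem_sup.1
    (h ▸ Submodule.mem_top : 𝒯.unitD l m ∈ N.toSubmodule ⊔ N'.toSubmodule)
  have h0 := (𝒯.Delta l).proj_same (𝒯.unitD_mem l m)
  rw [← hxy, map_add, key N hne.1 x hx, key N' hne.2 y hy, add_zero, hxy] at h0
  exact hm (𝒯.unitD_injective l (h0.symm.trans (map_zero _).symm))

theorem L_isSimple (l : 𝒯.Irr) : (𝒯.L l).IsSimple := (𝒯.Delta_isLocal l).isSimple_head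

/-- The projection `Δ(l) → L(l)`. -/
noncomputable def toL (l : 𝒯.Irr) : 𝒯.Delta l ⟶ 𝒯.L l := GrMod.mkQ _

theorem toL_surjective (l : 𝒯.Irr) : Function.Surjective (𝒯.toL l).toLin := GrMod.mkQ_surjective _

theorem topIs_L (l : 𝒯.Irr) : TopIs (𝒯.L l) l := by
  refine ⟨fun i hi => GrMod.grading_eq_bot_of_surjective _ (𝒯.toL_surjective l)
    ((𝒯.topIs_Delta l).above i hi), ((𝒯.toL l).toLin.restrictScalars 𝒯.mid) ∘ₗ 𝒯.unitD l,
    ?_, fun x => ⟨fun hx => ?_, ?_⟩⟩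
  · rw [injective_iff_map_eq_zero]
    intro m hm
    by_contra hne
    refine (𝒯.Delta_isLocal l).radical_spec.1 (𝒯.Delta_sub_eq_top l _ hne ?_)
    exact (Submodule.Quotient.mk_eq_zero _).1 hm
  · obtain ⟨y, hy, rfl⟩ := GrMod.exists_lift_grading _ (𝒯.toL_surjective l) hx
    obtain ⟨m, rfl⟩ := 𝒯.exists_unitD l hy
    exact ⟨m, rfl⟩
  · rintro ⟨m, rfl⟩
    exact (𝒯.toL l).map_mem _ _ (𝒯.unitD_mem l m)

theorem L_injective {l m : 𝒯.Irr} (e : 𝒯.L l ≅ 𝒯.L m) : l = m :=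
  ((𝒯.topIs_L l).of_iso e).unique (𝒯.topIs_L m)

variable {𝒯}

/-- The map `ι` induces a nonzero, hence surjective, morphism from `Δ(l)` to the simple object `S`;
a local object has only one simple quotient. -/
theorem isSimple_iso_L {S : GrMod 𝒜} (hS : S.IsSimple) (l : 𝒯.Irr)
    (h : ∀ i, 𝒯.deg l < i → S.grading i = ⊥) (ι : 𝒯.rep l →ₗ[𝒯.mid] S) (h0 : ι ≠ 0)
    (hι : ∀ m, ι m ∈ S.grading (𝒯.deg l)) : Nonempty (𝒯.L l ≅ S) := by
  refine (𝒯.Delta_isLocal l).head_iso hS (descTop mem_rep h ι hι) (hS.surjective _ fun h1 => h0 ?_)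
  ext m
  rw [← descTop_unit mem_rep h ι hι m]
  exact LinearMap.congr_fun h1 _

theorem TopIs.iso_L {S : GrMod 𝒜} {l : 𝒯.Irr} (h : TopIs S l) (hS : S.IsSimple) :
    Nonempty (𝒯.L l ≅ S) := by
  obtain ⟨ι, hι, hr⟩ := h.exists_map
  refine isSimple_iso_L hS l h.above ι (fun h0 => ?_) fun m => (hr _).2 ⟨m, rfl⟩
  obtain ⟨m, hm⟩ := exists_ne (0 : 𝒯.rep l)
  exact hm (hι (by rw [h0]; rfl))

variable (𝒯)

/-- The homogeneous component of degree `d`, as a `T`-module. -/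
def compT (X : GrMod 𝒜) (d : ℤ) : Submodule 𝒯.mid X where
  carrier := X.grading d
  zero_mem' := zero_mem _
  add_mem' := add_mem
  smul_mem' t x hx := by
    have := X.smul_mem 0 d t x (𝒯.mid_le t t.2) hx
    rwa [zero_add] at this

/-- Every nonzero object has a simple `T`-module in its top component. -/
theorem exists_top_simple [IsSemisimpleRing 𝒯.mid] (X : GrMod 𝒜) [Nontrivial X] :
    ∃ (l : 𝒯.Irr) (ι : 𝒯.rep l →ₗ[𝒯.mid] X), (∀ i, 𝒯.deg l < i → X.grading i = ⊥) ∧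
      Function.Injective ι ∧ ∀ m, ι m ∈ X.grading (𝒯.deg l) := by
  obtain ⟨d, hd, hmax⟩ := X.exists_top_degree
  have : Nontrivial (𝒯.compT X d) := by
    rw [Submodule.nontrivial_iff_ne_bot]
    intro h
    refine hd (eq_bot_iff.2 fun x hx => ?_)
    have : x ∈ 𝒯.compT X d := hx
    rw [h] at this
    exact this
  obtain ⟨V, hV⟩ := IsSemisimpleModule.exists_simple_submodule 𝒯.mid (𝒯.compT X d)
  obtain ⟨l, rfl, ⟨e⟩⟩ := exists_irr (𝒯 := 𝒯) d V
  exact ⟨l, (𝒯.compT X _).subtype ∘ₗ V.subtype ∘ₗ e.toLinearMap, hmax,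
    Subtype.val_injective.comp (Subtype.val_injective.comp e.injective), fun m => (e m).1.2⟩

theorem exists_iso_L [IsSemisimpleRing 𝒯.mid] {S : GrMod 𝒜} (hS : S.IsSimple) :
    ∃ l : 𝒯.Irr, Nonempty (𝒯.L l ≅ S) := by
  have := hS.1
  obtain ⟨l, ι, h, hι, hm⟩ := 𝒯.exists_top_simple S
  refine ⟨l, isSimple_iso_L hS l h ι (fun h0 => ?_) hm⟩
  obtain ⟨m, hm⟩ := exists_ne (0 : 𝒯.rep l)
  exact hm (hι (by rw [h0]; rfl))

end Top

end PreTriangularDecomposition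

end GradedTilting

/-! ### Indecomposable projectives and their top components. -/

namespace GradedTilting

open Module

namespace GrMod

variable {K R : Type u} [Field K] [Ring R] [Algebra K R] {ℛ : ℤ → Submodule K R}
  [FiniteDimensional K R]

theorem IsLocal.surjective_of_comp {P S Q : GrMod ℛ} (hP : P.IsLocal) (f : P ⟶ S) (g : Q ⟶ P)
    [Nontrivial S] (hf : Function.Surjective f.toLin)
    (h : Function.Surjective (f.toLin ∘ₗ g.toLin)) : Function.Surjective g.toLin := by
  rcases hP.2 (rangeSub g) (kerSub f) (by
    refine eq_top_iff.2 fun x _ => ?_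
    obtain ⟨y, hy⟩ := h (f.toLin x)
    rw [← add_sub_cancel (g.toLin y) x]
    refine Submodule.add_mem_sup ⟨y, rfl⟩ ?_
    rw [kerSub_toSubmodule, LinearMap.mem_ker, map_sub, ← hy]
    exact sub_self _) with h' | h'
  · exact LinearMap.range_eq_top.1 h'
  · exfalso
    obtain ⟨s, hs⟩ := exists_ne (0 : S)
    obtain ⟨x, rfl⟩ := hf s
    exact hs (LinearMap.mem_ker.1 (h' ▸ Submodule.mem_top : x ∈ (kerSub f).toSubmodule))

/-- Uniqueness of projective covers: lifts in both directions are surjective by locality, and a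
surjective endomorphism of a noetherian module is injective. -/
theorem IsLocal.iso {P Q S : GrMod ℛ} (hP : P.IsLocal) (hQ : Q.IsLocal) (hP' : P.HasLifts)
    (hQ' : Q.HasLifts) [Nontrivial S] (f : P ⟶ S) (g : Q ⟶ S) (hf : Function.Surjective f.toLin)
    (hg : Function.Surjective g.toLin) : Nonempty (P ≅ Q) := by
  obtain ⟨a, ha⟩ := hP' g f hg
  obtain ⟨b, hb⟩ := hQ' f g hf
  have has : Function.Surjective a.toLin := hQ.surjective_of_comp g a hg fun s => by
    obtain ⟨x, rfl⟩ := hf s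
    exact ⟨x, ha x⟩
  have hbs : Function.Surjective b.toLin := hP.surjective_of_comp f b hf fun s => by
    obtain ⟨x, rfl⟩ := hg s
    exact ⟨x, hb x⟩
  refine ⟨isoOfBijective a ⟨?_, has⟩⟩
  exact Function.Injective.of_comp (IsNoetherian.injective_of_surjective_endomorphism
    (b.toLin ∘ₗ a.toLin) (hbs.comp has))

theorem IsLocal.isProjectiveCover {P S : GrMod ℛ} (hP : P.IsLocal) (hP' : P.HasLifts) (hS : S.IsSimple)
    (f : P ⟶ S) (hf : Function.Surjective f.toLin) : P.IsProjectiveCover S := by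
  have := hS.1
  refine ⟨hP'.projective, f, hf, fun N hN => ?_⟩
  refine (hP.2 N (kerSub f) hN).resolve_right fun h => ?_
  obtain ⟨s, hs⟩ := exists_ne (0 : S)
  obtain ⟨x, rfl⟩ := hf s
  exact hs (LinearMap.mem_ker.1 (h ▸ Submodule.mem_top : x ∈ (kerSub f).toSubmodule))

variable [GradedAlgebra ℛ]

variable (ℛ) in
/-- The regular module, with degrees shifted by `e`. -/
def reg (e : ℤ) : GrMod ℛ where
  carrier := R
  grading i := ℛ (i - e)
  isInternal := by
    refine isInternal_of_proj _ (fun i => GradedAlgebra.proj ℛ (i - e)) ?_ ?_ ?_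
    · exact fun i v hv => DirectSum.decompose_of_mem_same ℛ hv
    · exact fun i j hij v hv => DirectSum.decompose_of_mem_ne ℛ hv (by omega)
    · rw [eq_top_iff, ← (DirectSum.Decomposition.isInternal ℛ).submodule_iSup_eq_top]
      exact iSup_le fun i => le_iSup_of_le (i + e) (by rw [add_sub_cancel_right])
  smul_mem i j r m hr hm := by
    rw [add_sub_assoc]
    exact SetLike.GradedMul.mul_mem hr hm
  finite := inferInstance

/-- The morphism `R[e] → M` given by an element of degree `e`. -/
def regHom {M : GrMod ℛ} {e : ℤ} (x : M) (hx : x ∈ M.grading e) : reg ℛ e ⟶ M where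
  toLin := LinearMap.toSpanSingleton R M x
  map_mem i r hr := by
    have := M.smul_mem (i - e) e r x hr hx
    rwa [sub_add_cancel] at this

theorem regHom_apply {M : GrMod ℛ} {e : ℤ} (x : M) (hx : x ∈ M.grading e) (r : R) :
    (regHom x hx).toLin r = r • x := rfl

theorem hasLifts_reg (e : ℤ) : (reg ℛ e).HasLifts := by
  intro X Y q f hq
  have h1 : (show (reg ℛ e).carrier from (1 : R)) ∈ (reg ℛ e).grading e := by
    change (1 : R) ∈ ℛ (e - e)
    rw [sub_self]
    exact SetLike.GradedOne.one_mem
  obtain ⟨x, hx, hxy⟩ := exists_lift_grading q hq (f.map_mem e _ h1)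
  refine ⟨regHom x hx, fun (r : R) => ?_⟩
  rw [regHom_apply, map_smul, hxy, ← map_smul]
  exact congrArg f.toLin (mul_one r)

theorem hasExtensions_reg (hR : Module.Injective R R) (e : ℤ) : (reg ℛ e).HasExtensions :=
  hasExtensions_of_injective _ hR

/-- Indecomposable direct summands of shifted regular modules. -/
def IsPIM (P : GrMod ℛ) : Prop :=
  P.IsIndecomposable ∧ ∃ (e : ℤ) (i : P ⟶ reg ℛ e) (p : reg ℛ e ⟶ P), ∀ x, p.toLin (i.toLin x) = x

theorem IsPIM.hasLifts {P : GrMod ℛ} (hP : P.IsPIM) : P.HasLifts := by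
  obtain ⟨-, e, i, p, h⟩ := hP
  exact HasLifts.retract (hasLifts_reg e) i p h

theorem IsPIM.hasExtensions {P : GrMod ℛ} (hP : P.IsPIM) (hR : Module.Injective R R) :
    P.HasExtensions := by
  obtain ⟨-, e, i, p, h⟩ := hP
  exact HasExtensions.retract (hasExtensions_reg hR e) i p h

theorem IsPIM.isLocal {P : GrMod ℛ} (hP : P.IsPIM) : P.IsLocal := hP.1.isLocal hP.hasLifts

theorem IsPIM.isUniform {P : GrMod ℛ} (hP : P.IsPIM) (hR : Module.Injective R R) : P.IsUniform :=
  hP.1.isUniform (hP.hasExtensions hR)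

/-- A nonzero element of degree `e` in `S` gives a nonzero morphism from the regular module shifted
by `e`, and some indecomposable summand is not killed by it. -/
theorem exists_isPIM {S : GrMod ℛ} (hS : S.IsSimple) :
    ∃ P : GrMod ℛ, P.IsPIM ∧ ∃ f : P ⟶ S, Function.Surjective f.toLin := by
  have := hS.1
  obtain ⟨e, he⟩ := S.exists_grading_ne_bot
  obtain ⟨x, hx, hx0⟩ := Submodule.exists_mem_ne_zero_of_ne_bot he
  obtain ⟨P, i, p, hip, hP, hC⟩ := exists_indecomposable_summand (reg ℛ e)
    (fun f => (regHom x hx).toLin ∘ₗ f ≠ 0) (fun h => h (LinearMap.comp_zero _))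
    (fun h => hx0 (by
      have := LinearMap.congr_fun h (1 : R)
      rw [LinearMap.comp_id, regHom_apply, one_smul] at this
      exact this))
    (fun a b h => by
      by_contra! h'
      exact h (by rw [LinearMap.comp_add, h'.1, h'.2, add_zero]))
  refine ⟨P, ⟨hP, e, i, p, hip⟩, i ≫ regHom x hx, hS.surjective _ fun h => hC ?_⟩
  rw [← LinearMap.comp_assoc]
  exact (congrArg (· ∘ₗ p.toLin) h).trans (LinearMap.zero_comp _)

end GrMod

theorem eq_zero_of_tmul_eq_zero {K V W : Type*} [Field K] [AddCommGroup V] [Module K V]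
    [AddCommGroup W] [Module K W] {x : V} {y : W} (hx : x ≠ 0) (h : x ⊗ₜ[K] y = 0) : y = 0 := by
  obtain ⟨f, hf⟩ := Module.Projective.exists_dual_ne_zero K hx
  have h3 := congrArg (TensorProduct.lid K W ∘ f.rTensor W) h
  simp only [Function.comp_apply, LinearMap.rTensor_tmul, TensorProduct.lid_tmul, map_zero,
    smul_eq_zero] at h3
  exact h3.resolve_left hf

namespace PreTriangularDecomposition

variable {K A : Type u} [Field K] [Ring A] [Algebra K A] [FiniteDimensional K A]
  {𝒜 : ℤ → Submodule K A} [GradedAlgebra 𝒜] {𝒯 : PreTriangularDecomposition 𝒜}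

variable (𝒯) in
theorem isFree_of_isPIM {P : GrMod 𝒜} (hP : P.IsPIM) : 𝒯.IsFree P := by
  obtain ⟨-, e, i, p, h⟩ := hP
  exact IsFree.summand 𝒯 (X := GrMod.reg 𝒜 e) 𝒯.isFree_self i.toLin p.toLin h

theorem descTop_act {M : 𝒯.TMod} {d : ℤ} (hM : ∀ m : M, m ∈ M.grading d) {X : GrMod 𝒜}
    (hX : ∀ i, d < i → X.grading i = ⊥) (ι : M →ₗ[𝒯.mid] X) (hι : ∀ m, ι m ∈ X.grading d)
    (z : 𝒯.neg ⊗[K] M) :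
    (descTop hM hX ι hι).toLin (act 𝒯.neg (𝒯.unit M) z) = act 𝒯.neg (ι.restrictScalars K) z :=
  𝒯.descLin_act (ι.restrictScalars K) (fun t m => ι.map_smul t m)
    (fun m => 𝒯.mem_posSoc_of_top hX (hι m)) z

/-- The morphism `Δ(l) → X` determined by a map from `l` to the top component of `X`. -/
noncomputable def descD {l : 𝒯.Irr} {X : GrMod 𝒜} (hX : ∀ i, 𝒯.deg l < i → X.grading i = ⊥)
    (ι : 𝒯.rep l →ₗ[𝒯.mid] X) (hι : ∀ m, ι m ∈ X.grading (𝒯.deg l)) : 𝒯.Delta l ⟶ X :=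
  descTop mem_rep hX ι hι

theorem descD_unitD {l : 𝒯.Irr} {X : GrMod 𝒜} (hX : ∀ i, 𝒯.deg l < i → X.grading i = ⊥)
    (ι : 𝒯.rep l →ₗ[𝒯.mid] X) (hι : ∀ m, ι m ∈ X.grading (𝒯.deg l)) (m : 𝒯.rep l) :
    (descD hX ι hι).toLin (𝒯.unitD l m) = ι m := descTop_unit mem_rep hX ι hι m

theorem descD_injective {l : 𝒯.Irr} {X : GrMod 𝒜} (hX : ∀ i, 𝒯.deg l < i → X.grading i = ⊥)
    (ι : 𝒯.rep l →ₗ[𝒯.mid] X) (hι : ∀ m, ι m ∈ X.grading (𝒯.deg l)) (hF : 𝒯.IsFree X)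
    (hinj : Function.Injective ι) : Function.Injective (descD hX ι hι).toLin :=
  descTop_injective mem_rep hX ι hι hF hinj

theorem TopIs.exists_embedding {l : 𝒯.Irr} {X : GrMod 𝒜} (h : TopIs X l) (hF : 𝒯.IsFree X) :
    ∃ f : 𝒯.Delta l ⟶ X, Function.Injective f.toLin := by
  obtain ⟨ι, hι, hr⟩ := h.exists_map
  exact ⟨_, descD_injective h.above ι (fun m => (hr _).2 ⟨m, rfl⟩) hF hι⟩

theorem linearMap_injective_of_ne_zero {l : 𝒯.Irr} {V : Type*} [AddCommGroup V] [Module 𝒯.mid V]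
    (ι : 𝒯.rep l →ₗ[𝒯.mid] V) (h : ι ≠ 0) : Function.Injective ι := by
  rcases eq_bot_or_eq_top (LinearMap.ker ι) with h' | h'
  · exact LinearMap.ker_eq_bot.1 h'
  · exact absurd (LinearMap.ker_eq_top.1 h') h

instance (X : GrMod 𝒜) (V : Submodule 𝒯.mid X) : FiniteDimensional K V :=
  inferInstanceAs (FiniteDimensional K (V.restrictScalars K))

instance (X : GrMod 𝒜) (V : Submodule 𝒯.mid X) : Module.Finite 𝒯.mid V :=
  Module.Finite.of_restrictScalars_finite K 𝒯.mid V

/-- Independent subspaces on which the action of `S` is jointly free generate independent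
`S`-submodules. Projecting `S ⊗ (U × V)` to `S ⊗ U` separates them. -/
theorem eq_zero_of_act_inl_eq_act_inr {U V X : Type*} [AddCommGroup U] [Module K U]
    [AddCommGroup V] [Module K V] [AddCommGroup X] [Module K X] [Module A X] [IsScalarTower K A X]
    {S : Subalgebra K A} (φ : U × V →ₗ[K] X) (h : Function.Injective (act S φ)) {z : S ⊗[K] U}
    {w : S ⊗[K] V} (hzw : act S (φ ∘ₗ LinearMap.inl K U V) z = act S (φ ∘ₗ LinearMap.inr K U V) w) :
    z = 0 := by
  have e1 : act S (φ ∘ₗ LinearMap.inl K U V) = act S φ ∘ₗ (LinearMap.inl K U V).lTensor S :=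
    TensorProduct.ext' fun s m => rfl
  have e2 : act S (φ ∘ₗ LinearMap.inr K U V) = act S φ ∘ₗ (LinearMap.inr K U V).lTensor S :=
    TensorProduct.ext' fun s m => rfl
  rw [e1, e2] at hzw
  have e3 := congrArg ((LinearMap.fst K U V).lTensor S) (h hzw)
  rwa [← LinearMap.comp_apply, ← LinearMap.comp_apply, ← LinearMap.lTensor_comp,
    ← LinearMap.lTensor_comp, LinearMap.fst_comp_inl, LinearMap.fst_comp_inr,
    LinearMap.lTensor_zero, LinearMap.lTensor_id] at e3

/-- In a uniform object that is free over `A⁻`, the top component is a simple `T`-module. -/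
theorem topIs_of_isUniform [IsSemisimpleRing 𝒯.mid] {X : GrMod 𝒜} (hU : X.IsUniform)
    (hF : 𝒯.IsFree X) {l : 𝒯.Irr}
    (hX : ∀ i, 𝒯.deg l < i → X.grading i = ⊥) (ι : 𝒯.rep l →ₗ[𝒯.mid] X)
    (hι : ∀ m, ι m ∈ X.grading (𝒯.deg l)) (hinj : Function.Injective ι) : TopIs X l := by
  refine ⟨hX, ι, hinj, fun x => ⟨fun hx => ?_, by rintro ⟨m, rfl⟩; exact hι m⟩⟩
  have hle : LinearMap.range ι ≤ 𝒯.compT X (𝒯.deg l) := by rintro _ ⟨m, rfl⟩; exact hι m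
  obtain ⟨c, hc⟩ := exists_isCompl (LinearMap.range ι)
  -- `V` is a `T`-complement of `l` inside the top component. The images of `Δ(l)` and of the
  -- standard object of `V` are independent by freeness, so uniformity leaves room for only one of
  -- them, and that of `Δ(l)` is nonzero.
  let V : Submodule 𝒯.mid X := c ⊓ 𝒯.compT X (𝒯.deg l)
  have hV : LinearMap.range ι ⊔ V = 𝒯.compT X (𝒯.deg l) := by
    rw [sup_inf_assoc_of_le _ hle |>.symm, hc.sup_eq_top, top_inf_eq]
  have hdisj : Disjoint (LinearMap.range ι) V := hc.disjoint.mono_right inf_le_left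
  suffices hbot : V = ⊥ by
    rw [hbot, sup_bot_eq] at hV
    rw [hV]; exact hx
  let φ : 𝒯.rep l × V →ₗ[K] X := (ι.restrictScalars K).coprod (V.subtype.restrictScalars K)
  have hφ : Function.Injective φ := by
    rw [injective_iff_map_eq_zero]
    rintro ⟨m, v⟩ hmv
    have hmv' : ι m + v = 0 := hmv
    have hv : (v : X) = ι (-m) := by rw [map_neg]; exact (neg_eq_of_add_eq_zero_right hmv').symm
    have h0 := Submodule.disjoint_def.1 hdisj v ⟨-m, hv.symm⟩ v.2
    rw [h0, add_zero] at hmv'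
    exact Prod.ext (hinj (hmv'.trans (map_zero ι).symm)) (Subtype.ext h0)
  have hact : Function.Injective (act 𝒯.neg φ) := by
    refine 𝒯.act_injective hF φ hφ ((𝒯.disjoint_negRad_of_top hX).mono_left ?_)
    rintro _ ⟨⟨m, v⟩, rfl⟩
    exact add_mem (hι m) v.2.2
  rcases hU.2 (GrMod.rangeSub (descD hX ι hι)) (GrMod.rangeSub
    (descTop (M := 𝒯.conc (𝒯.deg l) V) 𝒯.mem_conc hX V.subtype fun v => v.2.2)) (by
      rw [eq_bot_iff]
      rintro _ ⟨⟨x, rfl⟩, ⟨y, hy⟩⟩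
      obtain ⟨z, rfl⟩ := (𝒯.act_unit_bijective (M := 𝒯.rep l)).2 x
      obtain ⟨w, rfl⟩ := (𝒯.act_unit_bijective (M := 𝒯.conc (𝒯.deg l) V)).2 y
      have e1 : (descD hX ι hι).toLin (act 𝒯.neg (𝒯.unit (𝒯.rep l)) z) =
          act 𝒯.neg (ι.restrictScalars K) z := descTop_act mem_rep hX ι hι z
      have e2 : (descTop (M := 𝒯.conc (𝒯.deg l) V) 𝒯.mem_conc hX V.subtype
          fun v => v.2.2).toLin (act 𝒯.neg (𝒯.unit (𝒯.conc (𝒯.deg l) V)) w) =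
          act 𝒯.neg (V.subtype.restrictScalars K) w :=
        descTop_act (M := 𝒯.conc (𝒯.deg l) V) 𝒯.mem_conc hX V.subtype (fun v => v.2.2) w
      have e3 : act 𝒯.neg (φ ∘ₗ LinearMap.inl K (𝒯.rep l) V) z =
          act 𝒯.neg (φ ∘ₗ LinearMap.inr K (𝒯.rep l) V) w := by
        rw [LinearMap.coprod_inl, LinearMap.coprod_inr, ← e1]
        exact hy.symm.trans e2
      rw [eq_zero_of_act_inl_eq_act_inr φ hact e3, map_zero]
      exact (Submodule.mem_bot A).2 (map_zero (descD hX ι hι).toLin)) with h | h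
  · exfalso
    have := 𝒯.Delta_nontrivial l
    have h2 : (descD hX ι hι).toLin = 0 := LinearMap.range_eq_bot.1 h
    obtain ⟨m, hm⟩ := exists_ne (0 : 𝒯.Delta l)
    exact hm (descD_injective hX ι hι hF hinj (by rw [h2]; rfl))
  · rw [eq_bot_iff]
    intro v hv
    have h2 := descTop_unit (M := 𝒯.conc (𝒯.deg l) V) 𝒯.mem_conc hX V.subtype (fun v => v.2.2)
      ⟨v, hv⟩
    rw [LinearMap.range_eq_bot.1 h] at h2
    exact (Submodule.mem_bot _).2 h2.symm

theorem exists_topIs [IsSemisimpleRing 𝒯.mid] {X : GrMod 𝒜} (hU : X.IsUniform)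
    (hF : 𝒯.IsFree X) : ∃ l : 𝒯.Irr, TopIs X l := by
  have := hU.1
  obtain ⟨l, ι, h1, h2, h3⟩ := 𝒯.exists_top_simple X
  exact ⟨l, topIs_of_isUniform hU hF h1 ι h3 h2⟩

variable (𝒯) in
/-- The largest degree of `A⁺` is the largest degree of `A`. -/
theorem exists_pos_top [Nontrivial A] : ∃ N : ℤ, (∃ y ∈ 𝒯.pos, y ∈ 𝒜 N ∧ y ≠ 0) ∧
    ∀ i, N < i → 𝒜 i = ⊥ := by
  let D : Set ℤ := {i | ∃ y ∈ 𝒯.pos, y ∈ 𝒜 i ∧ y ≠ 0}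
  obtain ⟨B, hB⟩ := exists_grading_bound 𝒜
  have hD : D.Finite := (Set.finite_Icc (-(B : ℤ)) B).subset fun i ⟨y, _, hyi, hyz⟩ =>
    abs_le.1 (hB i fun hb => hyz (by rwa [hb, Submodule.mem_bot] at hyi))
  obtain ⟨N, hN, hmax⟩ := Set.exists_max_image D id hD
    ⟨0, 1, one_mem _, SetLike.GradedOne.one_mem, one_ne_zero⟩
  refine ⟨N, hN, fun i hi => ?_⟩
  have hpos : ∀ j, N < j → ∀ y ∈ 𝒯.pos, (DirectSum.decompose 𝒜 y j : A) = 0 := by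
    intro j hj y hy
    by_contra h0
    exact absurd (hmax j ⟨_, 𝒯.pos_homogeneous j hy, (DirectSum.decompose 𝒜 y j).2, h0⟩)
      (not_le.2 hj)
  -- In a product from `A⁻`, `T` and `A⁺`, the first two factors cannot raise the degree.
  have key : ∀ a : A, ∀ j, N < j → (DirectSum.decompose 𝒜 a j : A) = 0 := by
    classical
    intro a
    obtain ⟨z, rfl⟩ := 𝒯.act_midPos_bijective.2 a
    induction z using TensorProduct.induction_on with
    | zero => intro j _; simp
    | add z z' h h' =>
      intro j hj
      rw [map_add, DirectSum.decompose_add, DirectSum.add_apply, Submodule.coe_add, h j hj, h' j hj,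
        add_zero]
    | tmul x w =>
      rw [act_tmul, smul_eq_mul]
      have hw : ∀ j, N < j → (DirectSum.decompose 𝒜 (𝒯.midPos w) j : A) = 0 := by
        induction w using TensorProduct.induction_on with
        | zero => intro j _; simp
        | add z z' h h' =>
          intro j hj
          rw [map_add, DirectSum.decompose_add, DirectSum.add_apply, Submodule.coe_add, h j hj,
            h' j hj, add_zero]
        | tmul t y =>
          intro j hj
          rw [midPos_tmul, DirectSum.coe_decompose_mul_of_left_mem_zero 𝒜 (𝒯.mid_le t t.2),
            hpos j hj y y.2, mul_zero]
      intro j hj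
      conv_lhs => rw [← DirectSum.sum_support_decompose 𝒜 (x : A), Finset.sum_mul]
      rw [DirectSum.decompose_sum, DFinsupp.finsetSum_apply, Submodule.coe_sum]
      refine Finset.sum_eq_zero fun k _ => ?_
      rcases le_or_gt k 0 with hk | hk
      · have := DirectSum.coe_decompose_mul_add_of_left_mem 𝒜 (j := j - k) (b := 𝒯.midPos w)
          (DirectSum.decompose 𝒜 (x : A) k).2
        rw [add_sub_cancel] at this
        rw [this, hw _ (by omega), mul_zero]
      · rw [𝒯.neg_supp k hk _ (𝒯.neg_homogeneous k x.2) (DirectSum.decompose 𝒜 (x : A) k).2, zero_mul]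
        simp
  rw [eq_bot_iff]
  intro a ha
  rw [Submodule.mem_bot, ← DirectSum.decompose_of_mem_same 𝒜 ha]
  exact key a i hi

/-- `T y` is `1 ⊗ T ⊗ y` inside `A⁻ ⊗ T ⊗ A⁺`, hence a copy of `T`. -/
theorem mul_injective [Nontrivial A] {y : A} (hy : y ∈ 𝒯.pos) (h0 : y ≠ 0) (t : 𝒯.mid)
    (h : (t : A) * y = 0) : t = 0 := by
  have h1 : (1 : 𝒯.neg) ≠ 0 := fun h => one_ne_zero (α := A) (congrArg Subtype.val h)
  have h2 : act 𝒯.neg 𝒯.midPos (1 ⊗ₜ (t ⊗ₜ ⟨y, hy⟩)) = 0 := by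
    rw [act_tmul, midPos_tmul, h, smul_zero]
  have h3 := eq_zero_of_tmul_eq_zero h1 (𝒯.act_midPos_bijective.1 (h2.trans (map_zero _).symm))
  have h4 := congrArg (TensorProduct.comm K _ _) h3
  rw [TensorProduct.comm_tmul, map_zero] at h4
  exact eq_zero_of_tmul_eq_zero (fun h => h0 (congrArg Subtype.val h)) h4

/-- For `y ∈ A⁺` of the largest degree, `T y` is a copy of `T` in the top component of `A`, so it
contains every simple `T`-module. The morphism from `Δ(l)` to a shift of `A` obtained this way is
nonzero on some indecomposable summand, whose top component is then `l`. This will give surjectivity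
of `h`. -/
theorem exists_isPIM_topIs [IsSemisimpleRing 𝒯.mid] (hA : Module.Injective A A) (l : 𝒯.Irr) :
    ∃ P : GrMod 𝒜, P.IsPIM ∧ TopIs P l := by
  have : Nontrivial A := by
    obtain ⟨m, hm⟩ := exists_ne (0 : 𝒯.rep l)
    refine ⟨0, 1, fun h => hm ?_⟩
    rw [← one_smul 𝒯.mid m, show (1 : 𝒯.mid) = 0 from Subtype.ext h.symm, zero_smul]
  obtain ⟨N, ⟨y, hy, hyN, hy0⟩, hN⟩ := 𝒯.exists_pos_top
  obtain ⟨I, ⟨e⟩⟩ := IsSemisimpleRing.exists_linearEquiv_ideal_of_isSimpleModule 𝒯.mid (𝒯.rep l)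
  -- The shift moves the largest degree `N` of `A` to `deg l`.
  let X := GrMod.reg 𝒜 (𝒯.deg l - N)
  have hgr : ∀ i, X.grading i = 𝒜 (i - (𝒯.deg l - N)) := fun _ => rfl
  have hX : ∀ i, 𝒯.deg l < i → X.grading i = ⊥ := fun i hi => hN _ (by omega)
  let ι : 𝒯.rep l →ₗ[𝒯.mid] X :=
    { toFun := fun m => ((e m : 𝒯.mid) : A) * y
      map_add' := fun m m' => by
        rw [map_add]
        exact add_mul (R := A) _ _ _
      map_smul' := fun t m => by
        rw [map_smul]
        exact mul_assoc (G := A) _ _ _ }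
  have hι : ∀ m, ι m ∈ X.grading (𝒯.deg l) := by
    intro m
    rw [hgr, sub_sub_cancel]
    have := SetLike.GradedMul.mul_mem (𝒯.mid_le _ (e m : 𝒯.mid).2) hyN
    rwa [zero_add] at this
  have hinj : Function.Injective ι := by
    rw [injective_iff_map_eq_zero]
    intro m hm
    have := mul_injective hy hy0 _ hm
    exact e.injective ((Subtype.ext this).trans (map_zero e).symm)
  let ψ := descD hX ι hι
  obtain ⟨P, i, p, hip, hP, hC⟩ := GrMod.exists_indecomposable_summand X
    (fun f => f ∘ₗ ψ.toLin ≠ 0) (fun h => h (LinearMap.zero_comp _))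
    (fun h => by
      obtain ⟨m, hm⟩ := exists_ne (0 : 𝒯.rep l)
      have h2 := LinearMap.congr_fun h (𝒯.unitD l m)
      rw [LinearMap.id_comp, descD_unitD] at h2
      exact hm (hinj (h2.trans (map_zero ι).symm)))
    (fun a b h => by
      by_contra! h'
      exact h (by rw [LinearMap.add_comp, h'.1, h'.2, add_zero]))
  have hPIM : P.IsPIM := ⟨hP, _, i, p, hip⟩
  have hPX : ∀ j, 𝒯.deg l < j → P.grading j = ⊥ := fun j hj =>
    GrMod.grading_eq_bot_of_injective i (Function.LeftInverse.injective hip) (hX j hj)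
  let κ : 𝒯.rep l →ₗ[𝒯.mid] P := (p.toLin.restrictScalars 𝒯.mid) ∘ₗ ι
  refine ⟨P, hPIM, topIs_of_isUniform (hPIM.isUniform hA) (𝒯.isFree_of_isPIM hPIM) hPX κ
    (fun m => p.map_mem _ _ (hι m)) (linearMap_injective_of_ne_zero κ fun h => hC ?_)⟩
  ext x
  induction x using 𝒯.Delta_induction l with
  | h0 => simp
  | hadd x y hx hy => rw [map_add, hx, hy, map_add]
  | h a m =>
    have h2 : p.toLin (ι m) = 0 := LinearMap.congr_fun h m
    rw [map_smul, LinearMap.comp_apply, descD_unitD, LinearMap.comp_apply, h2, map_zero, smul_zero,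
      LinearMap.zero_apply]

end PreTriangularDecomposition

end GradedTilting

namespace GradedTilting

open Module

namespace PreTriangularDecomposition

variable {K A : Type u} [Field K] [Ring A] [Algebra K A] [FiniteDimensional K A]
  {𝒜 : ℤ → Submodule K A} [GradedAlgebra 𝒜] (𝒯 : PreTriangularDecomposition 𝒜)

/-! ### Self-injectivity of `A` gives cofreeness over `A⁺`. -/

section SelfInjective

/-- A self-injective algebra is injective as a left module over `A⁺`. -/
theorem exists_mul_eq (hA : Module.Injective A A) (I : Ideal 𝒯.pos) (f : I →ₗ[𝒯.pos] A) :
    ∃ e : A, ∀ i : I, f i = ((i : 𝒯.pos) : A) * e := by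
  let fK : I →ₗ[K] A := f.restrictScalars K
  let ιK : I →ₗ[K] A := 𝒯.pos.val.toLinearMap ∘ₗ I.subtype.restrictScalars K
  -- The map `f` is to be extended to the left ideal `A I` by `a i ↦ a f(i)`. This is well defined
  -- because `A` is free as a right `A⁺`-module: `red` is the restriction to `(A⁻ ⊗ T) ⊗ I`, where
  -- `red ιK` is injective.
  let ext : (I →ₗ[K] A) → (A ⊗[K] I →ₗ[A] A) := fun g =>
    TensorProduct.AlgebraTensorModule.lift (LinearMap.toSpanSingleton A (I →ₗ[K] A) g)
  have ext_tmul : ∀ g a i, ext g (a ⊗ₜ i) = a * g i := fun _ _ _ => rfl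
  let mul2 : 𝒯.neg ⊗[K] 𝒯.mid →ₗ[K] A := act 𝒯.neg 𝒯.mid.val.toLinearMap
  let red : (I →ₗ[K] A) → ((𝒯.neg ⊗[K] 𝒯.mid) ⊗[K] I →ₗ[K] A) := fun g =>
    LinearMap.mul' K A ∘ₗ TensorProduct.map mul2 g
  have red_tmul : ∀ g c i, red g (c ⊗ₜ i) = mul2 c * g i := fun _ _ _ => rfl
  have hredι : Function.Injective (red ιK) := by
    have : red ιK = tripleMul 𝒯.neg 𝒯.mid 𝒯.pos ∘ₗ
        (I.subtype.restrictScalars K).lTensor (𝒯.neg ⊗[K] 𝒯.mid) :=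
      TensorProduct.ext_threefold fun x t i => rfl
    rw [this]
    exact 𝒯.mul_bijective.1.comp
      (Module.Flat.lTensor_preserves_injective_linearMap _ I.subtype_injective)
  have htriple : ∀ c (y : 𝒯.pos), tripleMul 𝒯.neg 𝒯.mid 𝒯.pos (c ⊗ₜ y) = mul2 c * y := by
    intro c y
    induction c using TensorProduct.induction_on with
    | zero => simp
    | tmul x t => rfl
    | add c c' h h' => rw [TensorProduct.add_tmul, map_add, h, h', map_add, add_mul]
  -- The factor from `A⁺` can be moved across the tensor sign without changing either extension.
  have key : ∀ z : A ⊗[K] I, ∃ w : (𝒯.neg ⊗[K] 𝒯.mid) ⊗[K] I,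
      ext ιK z = red ιK w ∧ ext fK z = red fK w := by
    intro z
    induction z using TensorProduct.induction_on with
    | zero => exact ⟨0, by simp, by simp⟩
    | add z z' h h' =>
      obtain ⟨w, h1, h2⟩ := h
      obtain ⟨w', h1', h2'⟩ := h'
      exact ⟨w + w', by rw [map_add, map_add, h1, h1'], by rw [map_add, map_add, h2, h2']⟩
    | tmul a i =>
      obtain ⟨v, rfl⟩ := 𝒯.mul_bijective.2 a
      induction v using TensorProduct.induction_on with
      | zero => exact ⟨0, by simp, by simp⟩
      | add z z' h h' =>
        obtain ⟨w, h1, h2⟩ := h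
        obtain ⟨w', h1', h2'⟩ := h'
        exact ⟨w + w', by rw [map_add, TensorProduct.add_tmul, map_add, map_add, h1, h1'],
          by rw [map_add, TensorProduct.add_tmul, map_add, map_add, h2, h2']⟩
      | tmul c y =>
        refine ⟨c ⊗ₜ (y • i), ?_, ?_⟩
        · rw [ext_tmul, red_tmul]
          rw [htriple c y, mul_assoc]
          rfl
        · rw [ext_tmul, red_tmul]
          rw [htriple c y, mul_assoc]
          congr 1
          exact (f.map_smul y i).symm
  have hker : LinearMap.ker (ext ιK) ≤ LinearMap.ker (ext fK) := by
    intro z hz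
    obtain ⟨w, h1, h2⟩ := key z
    rw [LinearMap.mem_ker] at hz ⊢
    rw [h2, hredι ((h1.symm.trans hz).trans (map_zero _).symm), map_zero]
  -- The quotient of `A ⊗ I` by the kernel of `ext ιK` embeds in `A` with image `A I`. Injectivity
  -- extends the induced map to `A`, and `e` is the image of `1`.
  obtain ⟨h, hh⟩ := hA.out ((LinearMap.ker (ext ιK)).liftQ (ext ιK) le_rfl)
    (LinearMap.ker_eq_bot.1 (Submodule.ker_liftQ_eq_bot _ _ _ le_rfl))
    ((LinearMap.ker (ext ιK)).liftQ (ext fK) hker)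
  refine ⟨h 1, fun i => ?_⟩
  have h1 : h (ext ιK (1 ⊗ₜ i)) = ext fK (1 ⊗ₜ i) := hh (Submodule.Quotient.mk (1 ⊗ₜ i))
  rw [ext_tmul, ext_tmul, one_mul, one_mul] at h1
  rw [← smul_eq_mul, ← map_smul, smul_eq_mul, mul_one]
  exact h1.symm

/-- The augmentation ideal of `A⁺`. -/
def posAug : Submodule K 𝒯.pos := Submodule.span K {y | ∃ i > 0, (y : A) ∈ 𝒜 i}

theorem exists_sub_mem_posAug (y : 𝒯.pos) : ∃ c : K, y - algebraMap K 𝒯.pos c ∈ 𝒯.posAug := by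
  classical
  obtain ⟨c, hc⟩ := Algebra.mem_bot.1 (𝒯.pos_zero _ (𝒯.pos_homogeneous 0 y.2)
    (DirectSum.decompose 𝒜 (y : A) 0).2)
  refine ⟨c, ?_⟩
  set z := y - algebraMap K 𝒯.pos c with hz
  have hz0 : (DirectSum.decompose 𝒜 (z : A) 0 : A) = 0 := by
    have h1 : (z : A) = y - algebraMap K A c := rfl
    have h2 : algebraMap K A c ∈ 𝒜 0 := SetLike.algebraMap_mem_graded 𝒜 c
    rw [h1, DirectSum.decompose_sub, DirectSum.sub_apply, AddSubgroupClass.coe_sub,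
      DirectSum.decompose_of_mem_same 𝒜 h2, hc, sub_self]
  have hsum : z = ∑ k ∈ (DirectSum.decompose 𝒜 (z : A)).support,
      (⟨DirectSum.decompose 𝒜 (z : A) k, 𝒯.pos_homogeneous k z.2⟩ : 𝒯.pos) := by
    apply Subtype.ext
    rw [AddSubmonoidClass.coe_finsetSum]
    exact (DirectSum.sum_support_decompose 𝒜 (z : A)).symm
  rw [hsum]
  refine Submodule.sum_mem _ fun k _ => ?_
  have hk1 := 𝒯.pos_homogeneous k z.2
  have hk2 := (DirectSum.decompose 𝒜 (z : A) k).2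
  rcases lt_trichotomy k 0 with h | h | h
  · rw [show (⟨_, hk1⟩ : 𝒯.pos) = 0 from Subtype.ext (𝒯.pos_supp k h _ hk1 hk2)]; exact zero_mem _
  · subst h
    rw [show (⟨_, hk1⟩ : 𝒯.pos) = 0 from Subtype.ext hz0]; exact zero_mem _
  · exact Submodule.subset_span ⟨k, h, hk2⟩

theorem posAug_smul {X : Type*} [AddCommGroup X] [Module K X] [Module A X] [IsScalarTower K A X]
    {y : 𝒯.pos} (hy : y ∈ 𝒯.posAug) {x : X} (hx : x ∈ 𝒯.posSoc X) : y • x = 0 := by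
  change y ∈ Submodule.span K _ at hy
  induction hy using Submodule.span_induction with
  | mem y h => obtain ⟨i, hi, h⟩ := h; exact hx i hi y y.2 h
  | zero => exact zero_smul _ _
  | add a b _ _ h h' => rw [add_smul, h, h', add_zero]
  | smul c a _ h => rw [smul_assoc, h, smul_zero]

/-- The subspace `A⁺_{>0} I` is proper, because otherwise elements of `I` would have no component in
any degree. A functional vanishing on it makes `I` surject onto the trivial `A⁺`-module `K`. -/
theorem exists_functional (I : Ideal 𝒯.pos) (hI : I ≠ ⊥) : ∃ ξ : I →ₗ[K] K, ξ ≠ 0 ∧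
    ∀ y ∈ 𝒯.posAug, ∀ i : I, ξ (y • i) = 0 := by
  classical
  let J : Submodule K I := Submodule.span K {j | ∃ y : 𝒯.pos, (∃ k > 0, (y : A) ∈ 𝒜 k) ∧
    ∃ i : I, y • i = j}
  have hJ : J ≠ ⊤ := by
    intro hJ
    refine hI (eq_bot_iff.2 fun i hi => ?_)
    have key : ∀ n : ℕ, ∀ i : I, ∀ k : ℤ, k < n →
        (DirectSum.decompose 𝒜 ((i : 𝒯.pos) : A) k : A) = 0 := by
      intro n
      induction n with
      | zero => exact fun i k hk => 𝒯.pos_supp k (by simpa using hk) _ (𝒯.pos_homogeneous k (i : 𝒯.pos).2) (DirectSum.decompose 𝒜 _ k).2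
      | succ n ih =>
        intro i
        have hi : i ∈ J := hJ ▸ Submodule.mem_top
        change i ∈ Submodule.span K _ at hi
        induction hi using Submodule.span_induction with
        | mem i h =>
          obtain ⟨y, ⟨m, hm, hym⟩, i, rfl⟩ := h
          intro k hk
          have h1 := DirectSum.coe_decompose_mul_add_of_left_mem 𝒜 (j := k - m)
            (b := ((i : 𝒯.pos) : A)) hym
          rw [add_sub_cancel] at h1
          refine h1.trans ?_
          rw [ih i (k - m) (by push_cast at hk; omega), mul_zero]
        | zero => intro k _; simp
        | add i j _ _ h h' =>
          intro k hk
          have := congrArg₂ (· + ·) (h k hk) (h' k hk)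
          simpa [DirectSum.decompose_add] using this
        | smul c i _ h =>
          intro k hk
          have := congrArg (c • ·) (h k hk)
          simp only [smul_zero] at this
          rw [← this]
          change (DirectSum.decompose 𝒜 (c • ((i : 𝒯.pos) : A)) k : A) = _
          rw [DirectSum.decompose_smul]
          rfl
    have h0 : (i : A) = 0 := by
      rw [← DirectSum.sum_support_decompose 𝒜 (i : A)]
      exact Finset.sum_eq_zero fun k _ => key (k.toNat + 1) ⟨i, hi⟩ k (by push_cast; omega)
    exact (Submodule.mem_bot _).2 (Subtype.ext h0)
  obtain ⟨ξ, hξ, hle⟩ := Submodule.exists_le_ker_of_lt_top J (lt_top_iff_ne_top.2 hJ)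
  refine ⟨ξ, hξ, fun y hy i => ?_⟩
  change y ∈ Submodule.span K _ at hy
  induction hy using Submodule.span_induction with
  | mem y h => exact hle (Submodule.subset_span ⟨y, h, i, rfl⟩)
  | zero => rw [zero_smul, map_zero]
  | add y z _ _ h h' => rw [add_smul, map_add, h, h', add_zero]
  | smul c y _ h => rw [smul_assoc, map_smul, h, smul_zero]

/-- The right annihilator in `A` of a left ideal of `A⁺`. -/
def posAnn (I : Ideal 𝒯.pos) : Submodule K A where
  carrier := {a | ∀ y ∈ I, (y : A) * a = 0}
  zero_mem' _ _ := mul_zero _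
  add_mem' h h' y hy := by rw [mul_add, h y hy, h' y hy, add_zero]
  smul_mem' c a h y hy := by rw [mul_smul_comm, h y hy, smul_zero]

/-- Induction along ideals `I' = ker ξ` of codimension one in `I`. For `z ∈ posSoc A` the map `i ↦
ξ(i) z` is `A⁺`-linear, hence right multiplication by some `e`, with `I' e = 0` and `i0 e = z` where
`ξ(i0) = 1`. So left multiplication by `i0` sends the annihilator of `I'` onto a space containing
`posSoc A` and kills the annihilator of `I`. The case `I = A⁺` is the inequality needed for
cofreeness. -/
theorem finrank_posAnn_le (hA : Module.Injective A A) (n : ℕ) : ∀ I : Ideal 𝒯.pos, finrank K I = n →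
    finrank K (𝒯.posSoc A) * n + finrank K (𝒯.posAnn I) ≤ finrank K A := by
  induction n with
  | zero => intro I _; rw [mul_zero, zero_add]; exact Submodule.finrank_le _
  | succ n ih =>
    intro I hI
    have hI0 : I ≠ ⊥ := by
      rintro rfl
      rw [finrank_eq_zero_of_subsingleton] at hI
      omega
    obtain ⟨ξ, hξ0, hξ⟩ := 𝒯.exists_functional I hI0
    have hsmul : ∀ y : 𝒯.pos, ∃ c : K, (∀ i, ξ (y • i) = c * ξ i) ∧
        ∀ x ∈ 𝒯.posSoc A, (y : A) * x = c • x := by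
      intro y
      obtain ⟨c, hc⟩ := 𝒯.exists_sub_mem_posAug y
      refine ⟨c, fun i => ?_, fun x hx => ?_⟩
      · have h1 : (y - algebraMap K 𝒯.pos c) • i = y • i - c • i :=
          (sub_smul y (algebraMap K 𝒯.pos c) i).trans (by rw [algebraMap_smul])
        have h2 := hξ _ hc i
        rwa [h1, map_sub, ξ.map_smul c i, sub_eq_zero, smul_eq_mul] at h2
      · have := 𝒯.posAug_smul hc hx
        rwa [sub_smul, algebraMap_smul, sub_eq_zero] at this
    let I' : Ideal 𝒯.pos :=
      { carrier := {y | ∃ h : y ∈ I, ξ ⟨y, h⟩ = 0}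
        zero_mem' := ⟨zero_mem _, map_zero ξ⟩
        add_mem' := by
          rintro x y ⟨hx, hx'⟩ ⟨hy, hy'⟩
          refine ⟨add_mem hx hy, ?_⟩
          have := map_add ξ ⟨x, hx⟩ ⟨y, hy⟩
          rwa [hx', hy', add_zero] at this
        smul_mem' := by
          rintro y x ⟨hx, hx'⟩
          refine ⟨I.smul_mem y hx, ?_⟩
          obtain ⟨c, hc, -⟩ := hsmul y
          have := hc ⟨x, hx⟩
          rwa [hx', mul_zero] at this }
    obtain ⟨i0, hi0⟩ : ∃ i0, ξ i0 = 1 := LinearMap.surjective hξ0 1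
    have hI' : finrank K I' = n := by
      have h1 := LinearMap.finrank_range_add_finrank_ker ξ
      rw [LinearMap.range_eq_top.2 (LinearMap.surjective hξ0), finrank_top, finrank_self, hI] at h1
      have h2 : (I'.restrictScalars K) = (LinearMap.ker ξ).map (I.subtype.restrictScalars K) := by
        ext y
        constructor
        · rintro ⟨h, h'⟩
          exact ⟨⟨y, h⟩, h', rfl⟩
        · rintro ⟨i, hi, rfl⟩
          exact ⟨i.2, hi⟩
      have h3 : finrank K I' = finrank K (LinearMap.ker ξ) := by
        rw [← finrank_map_of_injective (f := I.subtype.restrictScalars K) (LinearMap.ker ξ)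
          I.subtype_injective, ← h2]
        rfl
      omega
    have hle := ih I' hI'
    let φ : A →ₗ[K] A := LinearMap.mulLeft K ((i0 : 𝒯.pos) : A)
    have h1 := finrank_map_add_finrank_inf_ker φ (𝒯.posAnn I')
    have h2 : 𝒯.posSoc A ≤ (𝒯.posAnn I').map φ := by
      intro z hz
      obtain ⟨e, he⟩ := 𝒯.exists_mul_eq hA I
        { toFun := fun i => ξ i • z
          map_add' := fun i j => by rw [map_add, add_smul]
          map_smul' := fun y i => by
            obtain ⟨c, h1, h2⟩ := hsmul y
            rw [h1, mul_smul, smul_comm, ← h2 z hz]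
            exact (mul_smul_comm _ _ _).symm }
      refine ⟨e, ?_, ?_⟩
      · rintro y ⟨hy, hy'⟩
        exact (he ⟨y, hy⟩).symm.trans (by
          change ξ ⟨y, hy⟩ • z = 0
          rw [hy', zero_smul])
      · exact (he i0).symm.trans (by
          change ξ i0 • z = z
          rw [hi0, one_smul])
    have h3 : 𝒯.posAnn I ≤ 𝒯.posAnn I' ⊓ LinearMap.ker φ :=
      fun a ha => ⟨fun y hy => ha y hy.1, ha i0 i0.2⟩
    have h4 := Submodule.finrank_mono h2
    have h5 := Submodule.finrank_mono h3
    rw [mul_add, mul_one]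
    omega

/-- A self-injective algebra is cofree over `A⁺`. -/
theorem isCofree_self (hA : Module.Injective A A) : 𝒯.IsCofree A := by
  refine le_antisymm 𝒯.finrank_le_posSoc ?_
  have h := 𝒯.finrank_posAnn_le hA _ ⊤ rfl
  have h2 : finrank K (⊤ : Ideal 𝒯.pos) = finrank K 𝒯.pos := finrank_top K 𝒯.pos
  rw [h2, mul_comm] at h
  omega

theorem isCofree_of_isPIM (hA : Module.Injective A A) {P : GrMod 𝒜} (hP : P.IsPIM) :
    𝒯.IsCofree P := by
  obtain ⟨-, e, i, p, h⟩ := hP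
  exact IsCofree.summand 𝒯 (X := GrMod.reg 𝒜 e) (𝒯.isCofree_self hA) i.toLin p.toLin h

end SelfInjective

/-! ### Duality between freeness and cofreeness; morphisms to `∇(λ)`. -/

section Duality

/-- The standard duality `𝒢(A) → 𝒢(Aᵒᵖ)`. -/
def dualA (X : GrMod 𝒜) : GrMod (opGrading 𝒜) :=
  GrMod.dual (AlgHom.id K Aᵐᵒᵖ) (fun _ _ h => h) X

/-- `posSoc X` is the annihilator in `X` of the radical of `X^*`, so the two dimensions add up to
`dim X`. -/
theorem isFree_dualA {X : GrMod 𝒜} (hX : 𝒯.IsCofree X) : 𝒯.op.IsFree (dualA X) := by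
  let N : Submodule K (Module.Dual K X) := 𝒯.op.negRad (dualA X)
  have h1 : N.dualCoannihilator = 𝒯.posSoc X := by
    ext x
    rw [Submodule.mem_dualCoannihilator]
    constructor
    · intro h i hi a ha hai
      by_contra hne
      obtain ⟨f, hf⟩ := Module.Projective.exists_dual_ne_zero K hne
      have hai' : MulOpposite.op a ∈ opGrading 𝒜 (-i) := by
        rw [mem_opGrading, neg_neg]
        exact hai
      exact hf (h _ (𝒯.op.smul_mem_negRad (by omega) (a := MulOpposite.op a) ha hai'
        (show dualA X from f)))
    · intro hx f hf
      have : N ≤ LinearMap.ker (Module.Dual.eval K X x) := by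
        refine Submodule.span_le.2 ?_
        rintro _ ⟨i, hi, a, ha, hai, f, rfl⟩
        change (show Module.Dual K X from f) (a.unop • x) = 0
        rw [hx (-i) (by omega) a.unop ha hai]
        exact map_zero (show Module.Dual K X from f)
      exact this hf
  have h2 := Subspace.finrank_add_finrank_dualCoannihilator_eq N
  rw [h1] at h2
  have h3 : finrank K 𝒯.op.neg = finrank K 𝒯.pos := (opLinEquiv 𝒯.pos).finrank_eq
  have h4 : finrank K (dualA X) = finrank K X := Subspace.dual_finrank_eq
  have h5 : finrank K X = finrank K 𝒯.pos * finrank K (𝒯.posSoc X) := hX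
  have h6 : finrank K (𝒯.op.negRad (dualA X)) + finrank K (𝒯.posSoc X) = finrank K X := h2
  unfold IsFree
  rw [h3, h4, ← h6, mul_add, h6]
  omega

theorem isCofree_dualOp {W : GrMod (opGrading 𝒜)} (hW : 𝒯.op.IsFree W) :
    𝒯.IsCofree (dualOp W) := by
  let N : Submodule K (Module.Dual K W) := 𝒯.posSoc (dualOp W)
  have h1 : N = (𝒯.op.negRad W).dualAnnihilator := by
    ext f
    rw [Submodule.mem_dualAnnihilator]
    constructor
    · intro hf w hw
      have : 𝒯.op.negRad W ≤ LinearMap.ker f := by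
        refine Submodule.span_le.2 ?_
        rintro _ ⟨i, hi, a, ha, hai, w, rfl⟩
        exact LinearMap.congr_fun (hf (-i) (by omega) a.unop ha hai) w
      exact this hw
    · intro hf i hi a ha hai
      refine LinearMap.ext fun w => hf _ ?_
      refine 𝒯.op.smul_mem_negRad (i := -i) (by omega) (a := MulOpposite.op a) ha ?_ w
      rw [mem_opGrading, neg_neg]
      exact hai
  have h2 := Subspace.finrank_add_finrank_dualAnnihilator_eq (𝒯.op.negRad W)
  rw [← h1] at h2
  have h3 : finrank K 𝒯.op.neg = finrank K 𝒯.pos := (opLinEquiv 𝒯.pos).finrank_eq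
  have h4 : finrank K (dualOp W) = finrank K W := Subspace.dual_finrank_eq
  have h5 : finrank K W + finrank K 𝒯.op.neg * finrank K (𝒯.op.negRad W) =
    finrank K 𝒯.op.neg * finrank K W := hW
  have h6 : finrank K (𝒯.op.negRad W) + finrank K (𝒯.posSoc (dualOp W)) = finrank K W := h2
  unfold IsCofree
  rw [h4]
  rw [h3, ← h6, mul_add, h6] at h5
  omega

theorem finrank_Nabla (l : 𝒯.Irr) :
    finrank K (𝒯.Nabla l) = finrank K 𝒯.pos * finrank K (𝒯.rep l) := by
  have h1 : finrank K (𝒯.Nabla l) = finrank K (𝒯.op.standard (𝒯.dualT (𝒯.rep l))) :=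
    Subspace.dual_finrank_eq
  have h2 : finrank K (𝒯.dualT (𝒯.rep l)) = finrank K (𝒯.rep l) := Subspace.dual_finrank_eq
  have h3 : finrank K 𝒯.op.neg = finrank K 𝒯.pos := (opLinEquiv 𝒯.pos).finrank_eq
  rw [h1, finrank_standard, h2, h3]

theorem isCofree_Nabla (l : 𝒯.Irr) : 𝒯.IsCofree (𝒯.Nabla l) :=
  𝒯.isCofree_dualOp (𝒯.op.isFree_standard (𝒯.dualT (𝒯.rep l)))

variable {𝒯}

section ToNabla

variable {X : GrMod 𝒜} {l : 𝒯.Irr}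

/-- The dual of a map from `X` to `l`. -/
noncomputable def dualMap (π : X →ₗ[𝒯.mid] 𝒯.rep l) : 𝒯.dualT (𝒯.rep l) →ₗ[𝒯.op.mid] dualA X where
  toFun ξ := (π.restrictScalars K).dualMap ξ
  map_add' ξ η := map_add (π.restrictScalars K).dualMap ξ η
  map_smul' t ξ := LinearMap.ext fun x =>
    congrArg (show Module.Dual K (𝒯.rep l) from ξ) (π.map_smul (⟨t.1.unop, t.2⟩ : 𝒯.mid) x).symm

theorem mem_dualT_rep (ξ : 𝒯.dualT (𝒯.rep l)) :
    ξ ∈ (𝒯.dualT (𝒯.rep l)).grading (𝒯.deg l) := by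
  intro j hj m hm
  rw [𝒯.grading_eq_bot_of_forall_mem mem_rep hj, Submodule.mem_bot] at hm
  rw [hm]
  exact map_zero (show Module.Dual K (𝒯.rep l) from ξ)

theorem dualA_above (hX : ∀ i, 𝒯.deg l < i → X.grading i = ⊥) (i : ℤ) (hi : 𝒯.deg l < i) : (dualA X).grading i = ⊥ := by
  rw [eq_bot_iff]
  intro f hf
  let f' : Module.Dual K X := f
  have h0 : f' = 0 := by
    ext x
    induction x using GrMod.homogeneous_induction with
    | h0 => simp
    | ha x y h h' => rw [map_add, map_add, h, h']
    | hh j x hx =>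
      by_cases hj : j = i
      · subst hj
        rw [hX j hi, Submodule.mem_bot] at hx
        rw [hx, map_zero, map_zero]
      · exact hf j hj x hx
  exact h0

/-- The morphism `Δ(l^*) → X^*` that is dual to `X → ∇(l)`. -/
noncomputable def toNablaDual (hX : ∀ i, 𝒯.deg l < i → X.grading i = ⊥) (π : X →ₗ[𝒯.mid] 𝒯.rep l)
    (hπ : ∀ i, i ≠ 𝒯.deg l → ∀ x ∈ X.grading i, π x = 0) :
    𝒯.op.standard (𝒯.dualT (𝒯.rep l)) ⟶ dualA X :=
  descTop (𝒯 := 𝒯.op) mem_dualT_rep (dualA_above hX) (dualMap π)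
    fun ξ j hj x hx => (congrArg (show Module.Dual K (𝒯.rep l) from ξ) (hπ j hj x hx)).trans
      (map_zero (show Module.Dual K (𝒯.rep l) from ξ))

theorem toNablaDual_unit (hX : ∀ i, 𝒯.deg l < i → X.grading i = ⊥) (π : X →ₗ[𝒯.mid] 𝒯.rep l)
    (hπ : ∀ i, i ≠ 𝒯.deg l → ∀ x ∈ X.grading i, π x = 0)
    (ξ : 𝒯.dualT (𝒯.rep l)) :
    (toNablaDual hX π hπ).toLin (𝒯.op.unit _ ξ) = dualMap π ξ :=
  descTop_unit (𝒯 := 𝒯.op) mem_dualT_rep (dualA_above hX) (dualMap π) _ ξ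

theorem toNablaDual_injective (hX : ∀ i, 𝒯.deg l < i → X.grading i = ⊥) (π : X →ₗ[𝒯.mid] 𝒯.rep l)
    (hπ : ∀ i, i ≠ 𝒯.deg l → ∀ x ∈ X.grading i, π x = 0)
    (hC : 𝒯.IsCofree X) (hs : Function.Surjective π) :
    Function.Injective (toNablaDual hX π hπ).toLin :=
  descTop_injective (𝒯 := 𝒯.op) mem_dualT_rep (dualA_above hX) (dualMap π) _
    (𝒯.isFree_dualA hC) (LinearMap.dualMap_injective_of_surjective hs)

/-- The morphism `X → ∇(l)` determined by a map from the top component of `X` to `l`. -/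
noncomputable def toNabla (hX : ∀ i, 𝒯.deg l < i → X.grading i = ⊥) (π : X →ₗ[𝒯.mid] 𝒯.rep l)
    (hπ : ∀ i, i ≠ 𝒯.deg l → ∀ x ∈ X.grading i, π x = 0) :
    X ⟶ 𝒯.Nabla l where
  toLin :=
    { toFun := fun x => (((toNablaDual hX π hπ).toLin.restrictScalars K).dualMap
        (Module.Dual.eval K X x) : Module.Dual K (𝒯.op.standard (𝒯.dualT (𝒯.rep l))))
      map_add' := fun x y => LinearMap.ext fun w =>
        map_add (show Module.Dual K X from (toNablaDual hX π hπ).toLin w) x y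
      map_smul' := fun a x => LinearMap.ext fun w => by
        have h := (toNablaDual hX π hπ).toLin.map_smul (MulOpposite.op a) w
        exact (LinearMap.congr_fun h x).symm }
  map_mem i x hx := fun j hj w hw =>
    (toNablaDual hX π hπ).map_mem j w hw i hj.symm x hx

theorem toNabla_surjective (hX : ∀ i, 𝒯.deg l < i → X.grading i = ⊥) (π : X →ₗ[𝒯.mid] 𝒯.rep l)
    (hπ : ∀ i, i ≠ 𝒯.deg l → ∀ x ∈ X.grading i, π x = 0)
    (hC : 𝒯.IsCofree X) (hs : Function.Surjective π) :
    Function.Surjective (toNabla hX π hπ).toLin :=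
  (LinearMap.dualMap_surjective_of_injective
    (f := (toNablaDual hX π hπ).toLin.restrictScalars K)
    (toNablaDual_injective hX π hπ hC hs)).comp (Module.evalEquiv K X).surjective

theorem toNabla_apply (hX : ∀ i, 𝒯.deg l < i → X.grading i = ⊥) (π : X →ₗ[𝒯.mid] 𝒯.rep l)
    (hπ : ∀ i, i ≠ 𝒯.deg l → ∀ x ∈ X.grading i, π x = 0)
    (x : X) (ξ : 𝒯.dualT (𝒯.rep l)) :
    (show Module.Dual K (𝒯.op.standard (𝒯.dualT (𝒯.rep l))) from (toNabla hX π hπ).toLin x)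
      (𝒯.op.unit _ ξ) = (show Module.Dual K (𝒯.rep l) from ξ) (π x) :=
  LinearMap.congr_fun (toNablaDual_unit hX π hπ ξ) x

/-- Evaluating on the elements `1 ⊗ ξ` of `Δ(l^*)` recovers `ξ (π x)` for every functional `ξ`. So
`π` can be read off from the morphism to `∇(l)`. -/
theorem eq_of_toNabla_eq (hX : ∀ i, 𝒯.deg l < i → X.grading i = ⊥) (π : X →ₗ[𝒯.mid] 𝒯.rep l)
    (hπ : ∀ i, i ≠ 𝒯.deg l → ∀ x ∈ X.grading i, π x = 0)
    {Y : GrMod 𝒜} (hY : ∀ i, 𝒯.deg l < i → Y.grading i = ⊥)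
    (ρ : Y →ₗ[𝒯.mid] 𝒯.rep l) (hρ : ∀ i, i ≠ 𝒯.deg l → ∀ y ∈ Y.grading i, ρ y = 0)
    {x : X} {y : Y} (h : (toNabla hX π hπ).toLin x = (toNabla hY ρ hρ).toLin y) : π x = ρ y := by
  by_contra hne
  obtain ⟨ξ, hξ⟩ := Module.Projective.exists_dual_ne_zero K (sub_ne_zero.2 hne)
  refine hξ ?_
  rw [map_sub, sub_eq_zero]
  exact (toNabla_apply hX π hπ x ξ).symm.trans ((LinearMap.congr_fun h _).trans
    (toNabla_apply hY ρ hρ y ξ))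

end ToNabla

end Duality

end PreTriangularDecomposition

end GradedTilting

/-! ### Chains of graded submodules as reflexive transitive closures. -/

namespace GradedTilting

open Module

theorem exists_chain_of_reflTransGen {α : Type*} {r : α → α → Prop} {a b : α}
    (h : Relation.ReflTransGen r a b) : ∃ (s : ℕ) (F : Fin (s + 1) → α),
      F 0 = a ∧ F (Fin.last s) = b ∧ ∀ i : Fin s, r (F i.castSucc) (F i.succ) := by
  induction h using Relation.ReflTransGen.head_induction_on with
  | refl => exact ⟨0, fun _ => b, rfl, rfl, fun i => i.elim0⟩
  | @head a c hac _ ih =>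
    obtain ⟨s, F, h0, h1, h2⟩ := ih
    refine ⟨s + 1, Fin.cons a F, rfl, ?_, fun i => ?_⟩
    · rw [← Fin.succ_last, Fin.cons_succ, h1]
    · refine Fin.cases ?_ (fun i => ?_) i
      · rw [Fin.castSucc_zero, Fin.cons_zero, Fin.cons_succ, h0]
        exact hac
      · rw [← Fin.succ_castSucc, Fin.cons_succ, Fin.cons_succ]
        exact h2 i

theorem reflTransGen_of_chain {α : Type*} {r : α → α → Prop} (s : ℕ) (F : Fin (s + 1) → α)
    (h : ∀ i : Fin s, r (F i.castSucc) (F i.succ)) :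
    Relation.ReflTransGen r (F 0) (F (Fin.last s)) := by
  have : ∀ i : Fin (s + 1), Relation.ReflTransGen r (F 0) (F i) := fun i => by
    induction i using Fin.induction with
    | zero => exact .refl
    | succ i ih => exact ih.tail (h i)
  exact this _

/-- A monotone sequence of propositions that changes from false to true does so exactly once. -/
theorem existsUnique_jump {n : ℕ} (Q : Fin (n + 1) → Prop) (h0 : ¬ Q 0) (h1 : Q (Fin.last n))
    (hm : ∀ i : Fin n, Q i.castSucc → Q i.succ) : ∃! i : Fin n, ¬ Q i.castSucc ∧ Q i.succ := by
  have hmono : ∀ i j : Fin (n + 1), i ≤ j → Q i → Q j := by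
    intro i j hij hi
    induction j using Fin.induction with
    | zero => rwa [Fin.le_zero_iff.1 hij] at hi
    | succ j ih =>
      rcases eq_or_lt_of_le hij with h | h
      · rwa [← h]
      · exact hm j (ih (Fin.le_castSucc_iff.2 h))
  have hex : ∃ i : Fin n, ¬ Q i.castSucc ∧ Q i.succ := by
    by_contra! h
    have : ∀ i : Fin (n + 1), ¬ Q i := fun i => by
      induction i using Fin.induction with
      | zero => exact h0
      | succ i ih => exact h i ih
    exact this _ h1
  obtain ⟨i, hi⟩ := hex
  refine ⟨i, hi, fun j hj => ?_⟩
  rcases lt_trichotomy j i with h | h | h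
  · exact absurd (hmono j.succ i.castSucc (by rw [Fin.le_castSucc_iff]; exact Fin.succ_lt_succ_iff.2 h) hj.2) hi.1
  · exact h
  · exact absurd (hmono i.succ j.castSucc (by rw [Fin.le_castSucc_iff]; exact Fin.succ_lt_succ_iff.2 h) hi.2) hj.1

namespace GrMod

variable {K R : Type u} [Field K] [Ring R] [Algebra K R] {ℛ : ℤ → Submodule K R}
  [FiniteDimensional K R]

/-- A step of a filtration with a prescribed type of factors. -/
def FiltStep (D : GrMod ℛ → Prop) {M : GrMod ℛ} (N N' : M.GrSub) : Prop :=
  N.toSubmodule ≤ N'.toSubmodule ∧ D (subquot N' N)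

theorem subquot_comap_iso {M Y : GrMod ℛ} (N : M.GrSub) (j : Y ⟶ quot N)
    (hj : Function.Injective j.toLin) :
    Nonempty (subquot (comapSub (mkQ N) (rangeSub j)) N ≅ Y) := by
  let N' := comapSub (mkQ N) (rangeSub j)
  let f : ofSub N' ⟶ ofSub (rangeSub j) := codRestrict _ (incl N' ≫ mkQ N) fun m => m.2
  have hf : Function.Surjective f.toLin := by
    rintro ⟨y, hy⟩
    obtain ⟨x, rfl⟩ := mkQ_surjective N y
    exact ⟨⟨x, hy⟩, rfl⟩
  refine ⟨subquotIso N' N f hf (fun x => ?_) ≪≫ (isoRange j hj).symm⟩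
  rw [← (incl_injective (rangeSub j)).eq_iff, map_zero]
  exact Submodule.Quotient.mk_eq_zero _

theorem finrank_quot_add {M : GrMod ℛ} (N : M.GrSub) :
    Module.finrank K (quot N) + Module.finrank K (ofSub N) = Module.finrank K M :=
  PreTriangularDecomposition.finrank_quotient_add (K := K) N.toSubmodule

theorem finrank_pos_of_nontrivial (M : GrMod ℛ) [Nontrivial M] : 0 < Module.finrank K M :=
  Module.finrank_pos

theorem finrank_iso {M N : GrMod ℛ} (e : M ≅ N) : Module.finrank K M = Module.finrank K N :=
  ((isoEquiv e).restrictScalars K).finrank_eq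

theorem quot_comap_iso {M : GrMod ℛ} (N : M.GrSub) (S : (quot N).GrSub) :
    Nonempty (quot (comapSub (mkQ N) S) ≅ quot S) := by
  have h : (comapSub (mkQ N) S).toSubmodule = LinearMap.ker (mkQ N ≫ mkQ S).toLin :=
    Submodule.ext fun x => (Submodule.Quotient.mk_eq_zero S.toSubmodule
      (x := (mkQ N).toLin x)).symm
  exact ⟨quotIso _ (mkQ N ≫ mkQ S) h ((mkQ_surjective S).comp (mkQ_surjective N))⟩

/-- Construction of filtrations by repeatedly taking subobjects of quotients. -/
theorem reflTransGen_filtStep_top {M : GrMod ℛ} (D C : GrMod ℛ → Prop)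
    (hD : ∀ {X Y : GrMod ℛ}, (X ≅ Y) → D X → D Y) (hC : ∀ {X Y : GrMod ℛ}, (X ≅ Y) → C X → C Y)
    (h : ∀ Y : GrMod ℛ, Nontrivial Y → C Y → ∃ (S : GrMod ℛ) (j : S ⟶ Y),
      Function.Injective j.toLin ∧ Nontrivial S ∧ D S ∧ C (quot (rangeSub j))) (n : ℕ) :
    ∀ N : M.GrSub, Module.finrank K (quot N) = n → C (quot N) →
      Relation.ReflTransGen (FiltStep D) N M.topSub := by
  induction n using Nat.strong_induction_on with
  | _ n ih =>
    intro N hn hN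
    by_cases htop : N.toSubmodule = ⊤
    · rw [show N = M.topSub from GrSub.ext' htop]
    · obtain ⟨S, j, hj, hS, hDS, hCS⟩ := h (quot N) (Submodule.Quotient.nontrivial_iff.2 htop) hN
      obtain ⟨e⟩ := subquot_comap_iso N j hj
      obtain ⟨e'⟩ := quot_comap_iso N (rangeSub j)
      refine .head (b := comapSub (mkQ N) (rangeSub j)) ⟨fun x hx => ?_, hD e.symm hDS⟩
        (ih _ ?_ _ rfl (hC e'.symm hCS))
      · have : (mkQ N).toLin x = 0 := (Submodule.Quotient.mk_eq_zero _).2 hx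
        rw [comapSub_toSubmodule, Submodule.mem_comap, this]
        exact zero_mem _
      · have h1 := finrank_quot_add (rangeSub j)
        have h2 := finrank_iso (isoRange j hj)
        have h3 := finrank_pos_of_nontrivial S
        have h4 := finrank_iso e'
        omega

/-- Properties closed under extensions pass from the factors of a filtration to the object. -/
theorem of_reflTransGen_filtStep {M : GrMod ℛ} (D C : GrMod ℛ → Prop)
    (hC : ∀ {X Y : GrMod ℛ}, (X ≅ Y) → C X → C Y) (hDC : ∀ {X : GrMod ℛ}, D X → C X)
    (hext : ∀ {X : GrMod ℛ} (N : X.GrSub), C (ofSub N) → C (quot N) → C X) {N N' : M.GrSub}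
    (h : Relation.ReflTransGen (FiltStep D) N N') (hN : C (ofSub N)) : C (ofSub N') := by
  induction h with
  | refl => exact hN
  | @tail N1 N2 _ h ih =>
    refine hext (N1.within N2) (hC (isoOfBijective (M := ofSub N1)
      (N := ofSub (N1.within N2)) ⟨?_, ?_⟩ ?_) ih) (hDC h.2)
    · exact (Submodule.comapSubtypeEquivOfLe h.1).symm.toLinearMap
    · exact fun i m hm => hm
    · exact (Submodule.comapSubtypeEquivOfLe h.1).symm.bijective

theorem ofSub_topSub_iso (M : GrMod ℛ) : Nonempty (ofSub M.topSub ≅ M) :=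
  ⟨isoOfBijective (incl M.topSub) ⟨incl_injective _, fun x => ⟨⟨x, trivial⟩, rfl⟩⟩⟩

theorem nonempty_compSeries (M : GrMod ℛ) : Nonempty M.CompSeries := by
  have h := reflTransGen_filtStep_top (M := M) IsSimple (fun _ => True) (fun e h => h.of_iso e)
    (fun _ _ => trivial) (fun Y _ _ => by
      obtain ⟨N, hN⟩ := Y.exists_simple_sub
      exact ⟨ofSub N, incl N, incl_injective N, hN.1, hN, trivial⟩) _ M.botSub rfl trivial
  obtain ⟨s, F, h0, h1, h2⟩ := exists_chain_of_reflTransGen h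
  exact ⟨⟨s, F, by rw [h0]; rfl, by rw [h1]; rfl, fun i => (h2 i).1, fun i => (h2 i).2⟩⟩

end GrMod

namespace PreTriangularDecomposition

variable {K A : Type u} [Field K] [Ring A] [Algebra K A] [FiniteDimensional K A]
  {𝒜 : ℤ → Submodule K A} [GradedAlgebra 𝒜] (𝒯 : PreTriangularDecomposition 𝒜)

theorem IsFree.of_iso {X Y : GrMod 𝒜} (e : X ≅ Y) (h : 𝒯.IsFree X) : 𝒯.IsFree Y :=
  IsFree.summand 𝒯 h (GrMod.isoEquiv e).symm.toLinearMap (GrMod.isoEquiv e).toLinearMap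
    (GrMod.isoEquiv e).apply_symm_apply

theorem IsCofree.of_iso {X Y : GrMod 𝒜} (e : X ≅ Y) (h : 𝒯.IsCofree X) : 𝒯.IsCofree Y :=
  IsCofree.summand 𝒯 h (GrMod.isoEquiv e).symm.toLinearMap (GrMod.isoEquiv e).toLinearMap
    (GrMod.isoEquiv e).apply_symm_apply

theorem isFree_of_subsingleton (X : GrMod 𝒜) [Subsingleton X] : 𝒯.IsFree X := by
  have h : finrank K X = 0 := finrank_zero_of_subsingleton
  have h' : finrank K (𝒯.negRad X) = 0 := finrank_zero_of_subsingleton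
  rw [IsFree, h, h', zero_add]

theorem isCofree_of_subsingleton (X : GrMod 𝒜) [Subsingleton X] : 𝒯.IsCofree X := by
  have h : finrank K X = 0 := finrank_zero_of_subsingleton
  have h' : finrank K (𝒯.posSoc X) = 0 := finrank_zero_of_subsingleton
  rw [IsCofree, h, h', mul_zero]

instance (X : GrMod 𝒜) : Subsingleton (GrMod.ofSub X.botSub) :=
  inferInstanceAs (Subsingleton (⊥ : Submodule A X))

/-! ### Standard filtrations and freeness, costandard filtrations and cofreeness. -/

section Filtrations

theorem isFree_of_isStandardlyFiltered {X : GrMod 𝒜} (hX : 𝒯.IsStandardlyFiltered X) :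
    𝒯.IsFree X := by
  obtain ⟨s, F, h0, h1, h2⟩ := hX
  -- Standard filtrations are decreasing, whereas `FiltStep` is increasing, hence the swap.
  have h := reflTransGen_of_chain
    (r := Function.swap (GrMod.FiltStep fun Y => ∃ l, Nonempty (Y ≅ 𝒯.Delta l))) s F h2
  rw [Relation.reflTransGen_swap] at h
  rw [show F 0 = X.topSub from GrMod.GrSub.ext' h0,
    show F (Fin.last s) = X.botSub from GrMod.GrSub.ext' h1] at h
  obtain ⟨e⟩ := X.ofSub_topSub_iso
  refine IsFree.of_iso 𝒯 e (GrMod.of_reflTransGen_filtStep _ (fun Y => 𝒯.IsFree Y)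
    (fun e h => IsFree.of_iso 𝒯 e h) ?_ (fun N h h' => IsFree.extension 𝒯 N.toSubmodule h h') h
      (𝒯.isFree_of_subsingleton _))
  rintro Y ⟨l, ⟨e⟩⟩
  exact IsFree.of_iso 𝒯 e.symm (𝒯.isFree_standard (𝒯.rep l))

theorem isCofree_of_isCostandardlyFiltered {X : GrMod 𝒜} (hX : 𝒯.IsCostandardlyFiltered X) :
    𝒯.IsCofree X := by
  obtain ⟨s, F, h0, h1, h2⟩ := hX
  have h := reflTransGen_of_chain
    (r := GrMod.FiltStep fun Y => ∃ l, Nonempty (Y ≅ 𝒯.Nabla l)) s F h2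
  rw [show F 0 = X.botSub from GrMod.GrSub.ext' h0,
    show F (Fin.last s) = X.topSub from GrMod.GrSub.ext' h1] at h
  obtain ⟨e⟩ := X.ofSub_topSub_iso
  refine IsCofree.of_iso 𝒯 e (GrMod.of_reflTransGen_filtStep _ (fun Y => 𝒯.IsCofree Y)
    (fun e h => IsCofree.of_iso 𝒯 e h) ?_ (fun N h h' => IsCofree.extension 𝒯 N.toSubmodule h h') h
      (𝒯.isCofree_of_subsingleton _))
  rintro Y ⟨l, ⟨e⟩⟩
  exact IsCofree.of_iso 𝒯 e.symm (𝒯.isCofree_Nabla l)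

theorem finrank_Delta (l : 𝒯.Irr) :
    finrank K (𝒯.Delta l) = finrank K 𝒯.neg * finrank K (𝒯.rep l) := 𝒯.finrank_standard (𝒯.rep l)

/-- A simple `T`-submodule of the top component yields an embedded `Δ(l)` whose quotient is free by
`IsFree.quotient`; the filtration is built by repeating this on the quotient. -/
theorem isStandardlyFiltered_of_isFree [IsSemisimpleRing 𝒯.mid] {X : GrMod 𝒜} (hX : 𝒯.IsFree X) :
    𝒯.IsStandardlyFiltered X := by
  have h := GrMod.reflTransGen_filtStep_top (M := X) (fun Y => ∃ l, Nonempty (Y ≅ 𝒯.Delta l))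
    (fun Y => 𝒯.IsFree Y) (fun e ⟨l, ⟨e'⟩⟩ => ⟨l, ⟨e.symm ≪≫ e'⟩⟩)
    (fun e h => IsFree.of_iso 𝒯 e h) (fun Y hY hF => by
      obtain ⟨l, ι, h1, h2, h3⟩ := 𝒯.exists_top_simple Y
      refine ⟨𝒯.Delta l, descD h1 ι h3, descD_injective h1 ι h3 hF h2, 𝒯.Delta_nontrivial l,
        ⟨l, ⟨Iso.refl _⟩⟩, ?_⟩
      refine IsFree.quotient 𝒯 hF (ι.restrictScalars K) h2
        ((𝒯.disjoint_negRad_of_top h1).mono_left (by rintro _ ⟨m, rfl⟩; exact h3 m))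
        (GrMod.rangeSub (descD h1 ι h3)).toSubmodule
        (fun w => ⟨𝒯.unitD l w, descD_unitD h1 ι h3 w⟩) ?_
      rw [← 𝒯.finrank_Delta l]
      exact (GrMod.finrank_iso (GrMod.isoRange _ (descD_injective h1 ι h3 hF h2))).symm)
    _ X.botSub rfl (IsFree.summand 𝒯 hX (Submodule.quotEquivOfEqBot ⊥ rfl).toLinearMap
      (Submodule.quotEquivOfEqBot ⊥ rfl).symm.toLinearMap
      (Submodule.quotEquivOfEqBot (⊥ : Submodule A X) rfl).symm_apply_apply)
  rw [← Relation.reflTransGen_swap] at h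
  obtain ⟨s, F, h0, h1, h2⟩ := exists_chain_of_reflTransGen h
  exact ⟨s, F, by rw [h0]; rfl, by rw [h1]; rfl, h2⟩

/-- The projection onto a homogeneous component is `T`-linear. -/
noncomputable def projT (X : GrMod 𝒜) (d : ℤ) : X →ₗ[𝒯.mid] X where
  toFun := X.proj d
  map_add' := map_add _
  map_smul' t x := by
    have := GrMod.proj_smul_of_mem (𝒯.mid_le t t.2) d x
    rwa [zero_add] at this

theorem exists_retraction [IsSemisimpleRing 𝒯.mid] {X : GrMod 𝒜} {l : 𝒯.Irr}
    (ι : 𝒯.rep l →ₗ[𝒯.mid] X) (hι : Function.Injective ι)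
    (hm : ∀ m, ι m ∈ X.grading (𝒯.deg l)) : ∃ π : X →ₗ[𝒯.mid] 𝒯.rep l, (∀ m, π (ι m) = m) ∧
      ∀ i, i ≠ 𝒯.deg l → ∀ x ∈ X.grading i, π x = 0 := by
  obtain ⟨r, hr⟩ := IsSemisimpleModule.extension_property ι hι LinearMap.id
  refine ⟨r ∘ₗ 𝒯.projT X (𝒯.deg l), fun m => ?_, fun i hi x hx => ?_⟩
  · exact (congrArg r (X.proj_same (hm m))).trans (LinearMap.congr_fun hr m)
  · exact (congrArg r (X.proj_ne hx hi)).trans (map_zero r)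

theorem isCofree_ker_toNabla {X : GrMod 𝒜} {l : 𝒯.Irr}
    (hX : ∀ i, 𝒯.deg l < i → X.grading i = ⊥) (ι : 𝒯.rep l →ₗ[𝒯.mid] X)
    (hm : ∀ m, ι m ∈ X.grading (𝒯.deg l)) (π : X →ₗ[𝒯.mid] 𝒯.rep l) (hπι : ∀ m, π (ι m) = m)
    (hπ : ∀ i, i ≠ 𝒯.deg l → ∀ x ∈ X.grading i, π x = 0) (hC : 𝒯.IsCofree X) :
    𝒯.IsCofree (GrMod.ofSub (GrMod.kerSub (toNabla hX π hπ))) := by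
  have hs : Function.Surjective π := fun m => ⟨ι m, hπι m⟩
  refine IsCofree.kernel 𝒯 hC (π.restrictScalars K) ?_ (LinearMap.ker (toNabla hX π hπ).toLin) ?_ ?_
  · refine Submodule.eq_top_iff'.2 fun m => ⟨ι m, 𝒯.mem_posSoc_of_top hX (hm m), hπι m⟩
  · intro x hx
    have := eq_of_toNabla_eq hX π hπ hX π hπ (x := x) (y := 0)
      ((LinearMap.mem_ker.1 hx).trans (map_zero _).symm)
    exact this.trans (map_zero π)
  · rw [← 𝒯.finrank_Nabla l]
    have h1 := GrMod.finrank_quot_add (GrMod.kerSub (toNabla hX π hπ))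
    have h2 := GrMod.finrank_iso (GrMod.quotIso (GrMod.kerSub _) _ rfl (toNabla_surjective hX π hπ hC hs))
    rw [h2, add_comm] at h1
    exact h1

/-- A simple summand of the top component gives a surjection onto `∇(l)`. Its kernel is cofree and
of smaller dimension, so induction runs downwards through graded submodules. -/
theorem isCostandardlyFiltered_of_isCofree [IsSemisimpleRing 𝒯.mid] {X : GrMod 𝒜}
    (hX : 𝒯.IsCofree X) : 𝒯.IsCostandardlyFiltered X := by
  have key : ∀ (n : ℕ) (N : X.GrSub), finrank K (GrMod.ofSub N) = n → 𝒯.IsCofree (GrMod.ofSub N) →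
      Relation.ReflTransGen (GrMod.FiltStep fun Y => ∃ l, Nonempty (Y ≅ 𝒯.Nabla l)) X.botSub N := by
    intro n
    induction n using Nat.strong_induction_on with
    | _ n ih =>
      intro N hn hN
      by_cases hbot : N.toSubmodule = ⊥
      · rw [show N = X.botSub from GrMod.GrSub.ext' hbot]
      · have : Nontrivial (GrMod.ofSub N) := Submodule.nontrivial_iff_ne_bot.2 hbot
        obtain ⟨l, ι, h1, h2, h3⟩ := 𝒯.exists_top_simple (GrMod.ofSub N)
        obtain ⟨π, hπι, hπ⟩ := 𝒯.exists_retraction ι h2 h3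
        have hs := toNabla_surjective h1 π hπ hN fun m => ⟨ι m, hπι m⟩
        let p := toNabla h1 π hπ
        let N1 : X.GrSub := GrMod.mapSub (GrMod.incl N) (GrMod.kerSub p)
        have hker := 𝒯.isCofree_ker_toNabla h1 ι h3 π hπι hπ hN
        let e : GrMod.ofSub (GrMod.kerSub p) ≅ GrMod.ofSub N1 := GrMod.isoOfBijective
          (GrMod.codRestrict N1 (GrMod.incl _ ≫ GrMod.incl N) fun x => ⟨_, x.2, rfl⟩)
          ⟨GrMod.codRestrict_injective _ _ _
            ((GrMod.incl_injective N).comp (GrMod.incl_injective _)), by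
            rintro ⟨_, x, hx, rfl⟩; exact ⟨⟨x, hx⟩, rfl⟩⟩
        refine .tail (b := N1) (ih _ ?_ N1 rfl (IsCofree.of_iso 𝒯 e hker)) ⟨?_, l, ⟨?_⟩⟩
        · have h4 := GrMod.finrank_quot_add (GrMod.kerSub p)
          have h5 := GrMod.finrank_iso e
          have h6 := GrMod.finrank_iso (GrMod.quotIso (GrMod.kerSub p) p rfl hs)
          have : Nontrivial (𝒯.Nabla l) := by
            obtain ⟨m, hm⟩ := exists_ne (0 : 𝒯.rep l)
            refine ⟨p.toLin (ι m), 0, fun h => hm ?_⟩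
            have := eq_of_toNabla_eq h1 π hπ h1 π hπ (x := ι m) (y := 0)
              (h.trans (map_zero _).symm)
            rwa [hπι, map_zero] at this
          have h7 := (𝒯.Nabla l).finrank_pos_of_nontrivial
          omega
        · rintro _ ⟨x, _, rfl⟩
          exact x.2
        · refine GrMod.subquotIso N N1 p hs fun x => ⟨fun h => ⟨x, h, rfl⟩, ?_⟩
          rintro ⟨y, hy, hyx⟩
          rw [← GrMod.incl_injective N hyx]
          exact hy
  obtain ⟨e⟩ := X.ofSub_topSub_iso
  obtain ⟨s, F, h0, h1, h2⟩ := exists_chain_of_reflTransGen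
    (key _ X.topSub rfl (IsCofree.of_iso 𝒯 e.symm hX))
  exact ⟨s, F, by rw [h0]; rfl, by rw [h1]; rfl, h2⟩

end Filtrations

/-! ### The highest weight is the top component. -/

section HighestWeight

variable {𝒯}

/-- As `l` is simple, it enters a composition series in exactly one step. The factor of that step is
`L(l)`, and all other factors vanish in degrees at least `deg l`. -/
theorem TopIs.count {X : GrMod 𝒜} {l : 𝒯.Irr} (h : TopIs X l) (c : X.CompSeries) :
    (∀ m : 𝒯.Irr, c.count (𝒯.L m) ≠ 0 → m ≤ l) ∧ c.count (𝒯.L l) = 1 := by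
  obtain ⟨ι, hι, hr⟩ := h.exists_map
  have hιm : ∀ m, ι m ∈ X.grading (𝒯.deg l) := fun m => (hr _).2 ⟨m, rfl⟩
  let Q : Fin (c.length + 1) → Prop := fun i => ∀ m, ι m ∈ (c.F i).toSubmodule
  have hQ : ∀ i m, m ≠ 0 → ι m ∈ (c.F i).toSubmodule → Q i := by
    intro i m hm hmi n
    let V : Submodule 𝒯.mid (𝒯.rep l) := ((c.F i).toSubmodule.restrictScalars 𝒯.mid).comap ι
    have hV : V = ⊤ := (eq_bot_or_eq_top V).resolve_left fun hb => hm <| by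
      have : m ∈ V := hmi
      rwa [hb, Submodule.mem_bot] at this
    exact (hV ▸ Submodule.mem_top : n ∈ V)
  let S : Fin c.length → GrMod 𝒜 := fun i => GrMod.subquot (c.F i.succ) (c.F i.castSucc)
  have habove : ∀ i j, 𝒯.deg l < j → (S i).grading j = ⊥ := fun i j hj =>
    GrMod.grading_eq_bot_of_surjective (GrMod.toSubquot _ _) (GrMod.toSubquot_surjective _ _)
      (GrMod.grading_eq_bot_of_injective (GrMod.incl _) (GrMod.incl_injective _) (h.above j hj))
  have hA : ∀ i, ¬ Q i.castSucc ∧ Q i.succ → Nonempty (S i ≅ 𝒯.L l) := by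
    rintro i ⟨h1, h2⟩
    let κ : 𝒯.rep l →ₗ[𝒯.mid] S i :=
      ((GrMod.toSubquot (c.F i.succ) (c.F i.castSucc)).toLin.restrictScalars 𝒯.mid) ∘ₗ
        ι.codRestrict ((c.F i.succ).toSubmodule.restrictScalars 𝒯.mid) h2
    have hκ : Function.Injective κ := by
      rw [injective_iff_map_eq_zero]
      intro m hm
      by_contra hne
      exact h1 (hQ _ m hne ((GrMod.toSubquot_eq_zero _ _ _).1 hm))
    obtain ⟨e⟩ := isSimple_iso_L (c.simple i) l (habove i) κ
      (fun h0 => by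
        obtain ⟨m, hm⟩ := exists_ne (0 : 𝒯.rep l)
        exact hm (hκ (by rw [h0]; rfl)))
      (fun m => (GrMod.toSubquot _ _).map_mem _ _ (hιm m))
    exact ⟨e.symm⟩
  -- A factor `L(m)` is nonzero in degree `deg m`. If this equals `deg l`, the factor contains the
  -- image of an element of the top component, so `l` enters there.
  have hB : ∀ i m, (S i ≅ 𝒯.L m) → 𝒯.deg m < 𝒯.deg l ∨
      (¬ Q i.castSucc ∧ Q i.succ) := by
    intro i m e
    have hne : (S i).grading (𝒯.deg m) ≠ ⊥ := ((𝒯.topIs_L m).of_iso e.symm).grading_ne_bot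
    rcases lt_trichotomy (𝒯.deg m) (𝒯.deg l) with hlt | heq | hgt
    · exact Or.inl hlt
    · right
      rw [heq] at hne
      obtain ⟨s, hs, hs0⟩ := Submodule.exists_mem_ne_zero_of_ne_bot hne
      obtain ⟨x, hx, rfl⟩ := GrMod.exists_lift_grading (GrMod.toSubquot (c.F i.succ) (c.F i.castSucc))
        (GrMod.toSubquot_surjective _ _) hs
      obtain ⟨n, hn⟩ := (hr _).1 ((GrMod.incl (c.F i.succ)).map_mem _ _ hx)
      have hn1 : ι n ∉ (c.F i.castSucc).toSubmodule := fun h' => hs0 <| by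
        rw [GrMod.toSubquot_eq_zero, ← hn]
        exact h'
      refine ⟨fun h' => hn1 (h' n), hQ _ n ?_ ?_⟩
      · rintro rfl
        rw [map_zero] at hn1
        exact hn1 (zero_mem _)
      · rw [hn]; exact x.2
    · exact absurd (habove i _ hgt) hne
  have hJ := existsUnique_jump Q (by
      intro h0
      obtain ⟨m, hm⟩ := exists_ne (0 : 𝒯.rep l)
      have := h0 m
      rw [c.bot, Submodule.mem_bot] at this
      exact hm (hι (this.trans (map_zero ι).symm)))
    (fun m => by rw [c.top]; trivial) (fun i hi m => c.le i (hi m))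
  refine ⟨fun m hm => ?_, ?_⟩
  · obtain ⟨⟨i, ⟨e⟩⟩⟩ : Nonempty {i : Fin c.length // Nonempty (S i ≅ 𝒯.L m)} :=
      (Nat.card_ne_zero.1 hm).1
    rcases hB i m e with h' | h'
    · exact Or.inr h'
    · obtain ⟨e'⟩ := hA i h'
      exact Or.inl (𝒯.L_injective (e.symm ≪≫ e'))
  · obtain ⟨i, hi, hu⟩ := hJ
    refine Nat.card_eq_one_iff_exists.2 ⟨⟨i, hA i hi⟩, ?_⟩
    rintro ⟨j, ⟨e⟩⟩
    exact Subtype.ext (hu j ((hB j l e).resolve_left (lt_irrefl _)))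

theorem TopIs.hasHighestWeight {X : GrMod 𝒜} {l : 𝒯.Irr} (h : TopIs X l) :
    𝒯.HasHighestWeight X l := by
  have hm : ∀ S, X.multiplicity S = X.nonempty_compSeries.some.count S := fun S =>
    dif_pos X.nonempty_compSeries
  unfold HasHighestWeight
  simp only [hm]
  exact h.count _

end HighestWeight

end PreTriangularDecomposition

end GradedTilting

/-! ### Finiteness of the set of simple `T`-modules, and shifts of degree. -/

namespace GradedTilting

open Module

/-- A self-map that induces an injective map on a finite quotient induces a surjective one. -/
theorem exists_eq_of_finite {α C : Type*} [Finite C] (f : α → C) (σ : α → α)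
    (h : ∀ a b, f (σ a) = f (σ b) → f a = f b) (m : α) : ∃ a, f (σ a) = f m := by
  choose sec hsec using fun c : Set.range f => c.2
  let g : Set.range f → Set.range f := fun c => ⟨f (σ (sec c)), ⟨_, rfl⟩⟩
  have hg : Function.Injective g := fun c c' hcc => Subtype.ext (by
    rw [← hsec c, ← hsec c']
    exact h _ _ (congrArg Subtype.val hcc))
  obtain ⟨c, hc⟩ := Finite.injective_iff_surjective.1 hg ⟨f m, ⟨m, rfl⟩⟩
  exact ⟨sec c, congrArg Subtype.val hc⟩

/-- A simple module embeds in its isotypic component of the regular module, where all simple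
submodules are isomorphic. Simple modules are thus counted by the finite set of isotypic components.
-/
theorem nonempty_equiv_of_isotypicComponent_eq {R S S' : Type*} [Ring R] [IsSemisimpleRing R]
    [AddCommGroup S] [Module R S] [IsSimpleModule R S] [AddCommGroup S'] [Module R S']
    [IsSimpleModule R S'] (h : isotypicComponent R R S = isotypicComponent R R S') :
    Nonempty (S ≃ₗ[R] S') := by
  obtain ⟨I, ⟨e⟩⟩ := IsSemisimpleRing.exists_linearEquiv_ideal_of_isSimpleModule R S
  have : IsSimpleModule R I := IsSimpleModule.congr e.symm
  have hI : I ≤ isotypicComponent R R S' := h ▸ le_sSup ⟨e.symm⟩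
  obtain ⟨e'⟩ := isIsotypicOfType_submodule_iff.1 (IsIsotypicOfType.isotypicComponent R R S') I hI
  exact ⟨e.trans e'⟩

theorem isotypicComponent_mem {R S : Type*} [Ring R] [IsSemisimpleRing R]
    [AddCommGroup S] [Module R S] [IsSimpleModule R S] :
    isotypicComponent R R S ∈ isotypicComponents R R := by
  obtain ⟨I, ⟨e⟩⟩ := IsSemisimpleRing.exists_linearEquiv_ideal_of_isSimpleModule R S
  exact ⟨I, IsSimpleModule.congr e.symm, e.isotypicComponent_eq⟩

namespace GrMod

variable {K R : Type u} [Field K] [Ring R] [Algebra K R] {ℛ : ℤ → Submodule K R}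
  [FiniteDimensional K R]

/-- Shift of the degrees by `n`. -/
def shift (X : GrMod ℛ) (n : ℤ) : GrMod ℛ where
  carrier := X
  grading i := X.grading (i - n)
  isInternal := by
    refine isInternal_of_proj _ (fun i => X.proj (i - n)) ?_ ?_ ?_
    · exact fun i v hv => X.proj_same hv
    · exact fun i j hij v hv => X.proj_ne hv (by omega)
    · rw [eq_top_iff, ← X.isInternal.submodule_iSup_eq_top]
      exact iSup_le fun i => le_iSup_of_le (i + n) (by rw [add_sub_cancel_right])
  smul_mem i j r m hr hm := by
    rw [add_sub_assoc]
    exact X.smul_mem i _ r m hr hm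
  finite := X.finite

def shiftHom {X Y : GrMod ℛ} (f : X ⟶ Y) (n : ℤ) : X.shift n ⟶ Y.shift n :=
  ⟨f.toLin, fun i m hm => f.map_mem (i - n) m hm⟩

theorem mem_grading_shift {X : GrMod ℛ} {i j n : ℤ} (h : i = j + n) {x : X} :
    x ∈ (X.shift n).grading i ↔ x ∈ X.grading j := by
  change x ∈ X.grading (i - n) ↔ _
  rw [h, add_sub_cancel_right]

theorem IsSimple.shift {X : GrMod ℛ} (hX : X.IsSimple) (n : ℤ) : (X.shift n).IsSimple := by
  refine ⟨hX.1, fun N => hX.2 (GrSub.mk' N.toSubmodule fun i x hx => ?_)⟩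
  have h := N.proj_mem (i + n) hx
  have : (X.shift n).proj (i + n) x = X.proj i x := by
    have := map_proj_shift (M := X) (N := X.shift n) LinearMap.id n
      (fun i m hm => (mem_grading_shift rfl).2 hm) i x
    exact this.symm
  rwa [this] at h

end GrMod

namespace PreTriangularDecomposition

variable {K A : Type u} [Field K] [Ring A] [Algebra K A] [FiniteDimensional K A]
  {𝒜 : ℤ → Submodule K A} [GradedAlgebra 𝒜] {𝒯 : PreTriangularDecomposition 𝒜}

/-! ### Shifts of `Δ(λ)` and `L(λ)`, and surjectivity of `†`. -/

section Shift

theorem TopIs.shift {X : GrMod 𝒜} {l m : 𝒯.Irr} (h : TopIs X l) (n : ℤ)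
    (hd : 𝒯.deg m = 𝒯.deg l + n) (e : 𝒯.rep m ≃ₗ[𝒯.mid] 𝒯.rep l) : TopIs (X.shift n) m := by
  obtain ⟨ι, hι, hr⟩ := h.exists_map
  refine ⟨fun i hi => h.above (i - n) (by omega), ι ∘ₗ e.toLinearMap, hι.comp e.injective,
    fun x => (GrMod.mem_grading_shift hd).trans ((hr x).trans ?_)⟩
  constructor
  · rintro ⟨y, rfl⟩
    exact ⟨e.symm y, congrArg ι (e.apply_symm_apply y)⟩
  · rintro ⟨y, rfl⟩
    exact ⟨e y, rfl⟩

theorem Delta_shift_iso {l m : 𝒯.Irr} {n : ℤ} (hd : 𝒯.deg m = 𝒯.deg l + n)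
    (e : 𝒯.rep m ≃ₗ[𝒯.mid] 𝒯.rep l) : Nonempty (𝒯.Delta m ≅ (𝒯.Delta l).shift n) := by
  obtain ⟨f, hf⟩ := ((𝒯.topIs_Delta l).shift n hd e).exists_embedding
    (𝒯.isFree_standard (𝒯.rep l))
  refine ⟨GrMod.isoOfBijective f ⟨hf, ?_⟩⟩
  have h : finrank K (𝒯.Delta m) = finrank K ((𝒯.Delta l).shift n) := by
    have h1 : finrank K ((𝒯.Delta l).shift n) = finrank K (𝒯.Delta l) := rfl
    rw [h1, finrank_Delta, finrank_Delta, (e.restrictScalars K).finrank_eq]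
  exact (LinearMap.injective_iff_surjective_of_finrank_eq_finrank
    (f := f.toLin.restrictScalars K) h).1 hf

theorem L_shift_iso {l m : 𝒯.Irr} {n : ℤ} (hd : 𝒯.deg m = 𝒯.deg l + n)
    (e : 𝒯.rep m ≃ₗ[𝒯.mid] 𝒯.rep l) : Nonempty (𝒯.L m ≅ (𝒯.L l).shift n) :=
  ((𝒯.topIs_L l).shift n hd e).iso_L ((𝒯.L_isSimple l).shift n)

theorem eq_of_L_embeddings {X : GrMod 𝒜} (hX : X.IsUniform) {l m : 𝒯.Irr} (i : 𝒯.L l ⟶ X)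
    (j : 𝒯.L m ⟶ X) (hi : Function.Injective i.toLin) (hj : Function.Injective j.toLin) : l = m := by
  obtain ⟨e⟩ := hX.soc_iso (𝒯.L_isSimple l) i hi
  obtain ⟨e'⟩ := hX.soc_iso (𝒯.L_isSimple m) j hj
  exact 𝒯.L_injective (e.symm ≪≫ e')

/-- If `l ↦ dag l` is injective, where `L(dag l)` is the socle of `Δ(l)`, then it is surjective. -/
theorem dag_surjective [IsSemisimpleRing 𝒯.mid] (dag : 𝒯.Irr → 𝒯.Irr)
    (hU : ∀ l, (𝒯.Delta l).IsUniform)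
    (hdag : ∀ l, ∃ i : 𝒯.L (dag l) ⟶ 𝒯.Delta l, Function.Injective i.toLin)
    (hinj : Function.Injective dag) : Function.Surjective dag := by
  have hex : ∀ (l : 𝒯.Irr) (n : ℤ), ∃ m : 𝒯.Irr, 𝒯.deg m = 𝒯.deg l + n ∧
      Nonempty (𝒯.rep m ≃ₗ[𝒯.mid] 𝒯.rep l) := fun l n => exists_irr _ _
  choose sh hshd hshe using hex
  have hsh : ∀ l m, Nonempty (𝒯.rep m ≃ₗ[𝒯.mid] 𝒯.rep l) → m = sh l (𝒯.deg m - 𝒯.deg l) := by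
    rintro l m ⟨e⟩
    obtain ⟨e'⟩ := hshe l (𝒯.deg m - 𝒯.deg l)
    exact irr_ext (by rw [hshd]; ring) (e.trans e'.symm)
  -- Shifting the socle of `Δ(l)` gives a simple subobject of the shifted standard object, and a
  -- uniform object has only one.
  have hcomm : ∀ l n, dag (sh l n) = sh (dag l) n := by
    intro l n
    obtain ⟨e1⟩ := hshe l n
    obtain ⟨e2⟩ := hshe (dag l) n
    obtain ⟨f1⟩ := Delta_shift_iso (hshd l n) e1
    obtain ⟨f2⟩ := L_shift_iso (hshd (dag l) n) e2
    obtain ⟨i, hi⟩ := hdag l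
    obtain ⟨j, hj⟩ := hdag (sh l n)
    refine eq_of_L_embeddings (hU _) j (f2.hom ≫ GrMod.shiftHom i n ≫ f1.inv) hj ?_
    exact (GrMod.iso_bijective f1.symm).1.comp (hi.comp (GrMod.iso_bijective f2).1)
  let cl : 𝒯.Irr → isotypicComponents 𝒯.mid 𝒯.mid := fun l =>
    ⟨isotypicComponent 𝒯.mid 𝒯.mid (𝒯.rep l), isotypicComponent_mem⟩
  have hcl : ∀ l m, cl l = cl m → Nonempty (𝒯.rep l ≃ₗ[𝒯.mid] 𝒯.rep m) := fun l m h =>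
    nonempty_equiv_of_isotypicComponent_eq (congrArg Subtype.val h)
  have hcl' : ∀ l n, cl (sh l n) = cl l := fun l n => by
    obtain ⟨e⟩ := hshe l n
    exact Subtype.ext e.isotypicComponent_eq
  intro m
  -- If `dag a` and `dag b` agree up to shift, so do `a` and `b`, by `hcomm` and injectivity. Hence
  -- `dag` permutes the finitely many classes of simple `T`-modules and reaches that of `m`; a shift
  -- then corrects the degree.
  obtain ⟨l, hl⟩ := exists_eq_of_finite cl dag (fun a b h => by
    have h1 := hsh _ _ (hcl _ _ h)
    rw [← hcomm] at h1
    rw [hinj h1, hcl']) m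
  refine ⟨sh l (𝒯.deg m - 𝒯.deg (dag l)), ?_⟩
  rw [hcomm]
  exact (hsh _ _ (hcl _ _ hl.symm)).symm

end Shift

/-! ### Classification of indecomposable tilting objects. -/

section Tilting

variable [IsSemisimpleRing 𝒯.mid]

theorem TopIs.exists_toNabla {X : GrMod 𝒜} {l : 𝒯.Irr} (h : TopIs X l) (hC : 𝒯.IsCofree X) :
    ∃ g : X ⟶ 𝒯.Nabla l, Function.Surjective g.toLin := by
  obtain ⟨ι, hι, hr⟩ := h.exists_map
  obtain ⟨π, hπι, hπ⟩ := 𝒯.exists_retraction ι hι fun m => (hr _).2 ⟨m, rfl⟩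
  exact ⟨_, toNabla_surjective h.above π hπ hC fun m => ⟨ι m, hπι m⟩⟩

/-- Freeness of `X` provides morphisms from `X` into the injective object `Q`, cofreeness provides
morphisms from the projective object `Q` into `X`. They are matched on the component `l`, so their
composite on `Q` is not nilpotent. -/
theorem exists_iso_of_isTilting (hA : Module.Injective A A) {X : GrMod 𝒜}
    (hX : X.IsIndecomposable) (hF : 𝒯.IsFree X) (hC : 𝒯.IsCofree X) :
    ∃ l : 𝒯.Irr, ∀ Q : GrMod 𝒜, Q.IsPIM → TopIs Q l → Nonempty (X ≅ Q) := by
  have := hX.1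
  obtain ⟨l, ι, hX1, hι, hιm⟩ := 𝒯.exists_top_simple X
  obtain ⟨π, hπι, hπ⟩ := 𝒯.exists_retraction ι hι hιm
  refine ⟨l, fun Q hQ hQl => ?_⟩
  have := hQ.1.1
  obtain ⟨κ, hκ, hr⟩ := hQl.exists_map
  have hκm : ∀ m, κ m ∈ Q.grading (𝒯.deg l) := fun m => (hr _).2 ⟨m, rfl⟩
  obtain ⟨ρ, hρκ, hρ⟩ := 𝒯.exists_retraction κ hκ hκm
  let V := 𝒯.compT X (𝒯.deg l)
  let M := 𝒯.conc (𝒯.deg l) V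
  let j : 𝒯.standard M ⟶ X := descTop 𝒯.mem_conc hX1 V.subtype fun v => v.2
  have hj : Function.Injective j.toLin :=
    descTop_injective (M := M) 𝒯.mem_conc hX1 V.subtype (fun v => v.2) hF V.subtype_injective
  -- The whole top component of `X` is used, not only `l`, so that the extension `f` is known on all
  -- of it; the image of `l` under `g` need not be the chosen copy of `l`.
  let f0 : 𝒯.standard M ⟶ Q :=
    descTop 𝒯.mem_conc hQl.above (κ ∘ₗ π ∘ₗ V.subtype) fun v => hκm _
  obtain ⟨f, hf⟩ := hQ.hasExtensions hA j f0 hj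
  have hfv : ∀ x ∈ X.grading (𝒯.deg l), f.toLin x = κ (π x) := by
    intro x hx
    have h1 := hf (𝒯.unit M ⟨x, hx⟩)
    have h2 := descTop_unit (M := M) 𝒯.mem_conc hX1 V.subtype (fun v => v.2) ⟨x, hx⟩
    have h3 := descTop_unit (M := M) 𝒯.mem_conc hQl.above (κ ∘ₗ π ∘ₗ V.subtype) (fun v => hκm _)
      ⟨x, hx⟩
    exact (congrArg f.toLin h2).symm.trans (h1.trans h3)
  -- As `g` lifts `Q → ∇(l)` through `X → ∇(l)`, it satisfies `π ∘ g = ρ`.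
  obtain ⟨g, hg⟩ := hQ.hasLifts (toNabla hX1 π hπ) (toNabla hQl.above ρ hρ)
    (toNabla_surjective hX1 π hπ hC fun m => ⟨ι m, hπι m⟩)
  have hfg : ∀ m, (g ≫ f).toLin (κ m) = κ m := by
    intro m
    have h1 := eq_of_toNabla_eq hX1 π hπ hQl.above ρ hρ (hg (κ m))
    rw [hρκ] at h1
    exact (hfv _ (g.map_mem _ _ (hκm m))).trans (congrArg κ h1)
  have hb : Function.Bijective (g ≫ f).toLin := by
    refine (hQ.1.bijective_or_nilpotent (g ≫ f)).resolve_right ?_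
    rintro ⟨n, hn⟩
    have hpow : ∀ (k : ℕ) m, ((g ≫ f).toLin ^ k) (κ m) = κ m := by
      intro k m
      induction k with
      | zero => rfl
      | succ k ih => rw [pow_succ, Module.End.mul_apply, hfg, ih]
    obtain ⟨m, hm⟩ := exists_ne (0 : 𝒯.rep l)
    have h0 := hpow n m
    rw [hn, LinearMap.zero_apply] at h0
    exact hm (hκ (h0.symm.trans (map_zero κ).symm))
  exact ⟨(GrMod.isoOfBijective g (hX.bijective_of_comp g f hb)).symm⟩

/-- `Δ(h l)` sits in the uniform injective object `P l`, so it is itself uniform and has the same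
socle. This gives `nu` as `h` followed by `dag`, and reduces injectivity of `h` and `dag` to
uniqueness of injective hulls. -/
theorem exists_tilting_data (hA : Module.Injective A A) :
    ∃ P : 𝒯.Irr → GrMod 𝒜, (∀ l, (P l).IsPIM ∧ (P l).IsProjectiveCover (𝒯.L l)) ∧
    ∃ nu dag h : Equiv.Perm 𝒯.Irr,
      (∀ l, Nonempty ((P l).soc ≅ 𝒯.L (nu l))) ∧
      (∀ l, Nonempty ((𝒯.Delta l).soc ≅ 𝒯.L (dag l))) ∧
      (∀ l, TopIs (P l) (h l)) ∧ (∀ l, nu.symm (dag l) = h.symm l) := by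
  choose P hP p hp using fun l => GrMod.exists_isPIM (𝒯.L_isSimple l)
  choose h hh using fun l => exists_topIs ((hP l).isUniform hA) (𝒯.isFree_of_isPIM (hP l))
  have hiso : ∀ {l m}, (P l ≅ P m) → l = m := by
    intro l m e
    obtain ⟨e1⟩ := (hP l).isLocal.head_iso (𝒯.L_isSimple l) (p l) (hp l)
    obtain ⟨e2⟩ := (hP l).isLocal.head_iso (𝒯.L_isSimple m) (e.hom ≫ p m)
      ((hp m).comp (GrMod.iso_bijective e).2)
    exact 𝒯.L_injective (e1.symm ≪≫ e2)
  choose emb hemb using fun l => (hh l).exists_embedding (𝒯.isFree_of_isPIM (hP l))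
  have hinj : Function.Injective h := by
    intro l m hlm
    have hm := (hh m).exists_embedding (𝒯.isFree_of_isPIM (hP m))
    rw [← hlm] at hm
    obtain ⟨i, hi⟩ := hm
    have := 𝒯.Delta_nontrivial (h l)
    obtain ⟨e⟩ := ((hP l).isUniform hA).iso ((hP m).isUniform hA) ((hP l).hasExtensions hA)
      ((hP m).hasExtensions hA) (emb l) i (hemb l) hi
    exact hiso e
  -- An indecomposable projective with top component `k` has a head of the form `L l`, and is
  -- therefore isomorphic to `P l`.
  have hsurj : Function.Surjective h := by
    intro k
    obtain ⟨Q, hQ, hk⟩ := exists_isPIM_topIs hA k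
    obtain ⟨l, ⟨e⟩⟩ := 𝒯.exists_iso_L hQ.isLocal.isSimple_head
    have := (𝒯.L_isSimple l).1
    obtain ⟨e'⟩ := (hP l).isLocal.iso hQ.isLocal (hP l).hasLifts hQ.hasLifts (p l)
      (GrMod.mkQ Q.radical ≫ e.inv) (hp l)
      ((GrMod.iso_bijective e.symm).2.comp (GrMod.mkQ_surjective _))
    exact ⟨l, ((hh l).of_iso e').unique hk⟩
  let hperm : Equiv.Perm 𝒯.Irr := Equiv.ofBijective h ⟨hinj, hsurj⟩
  have hU : ∀ l, (𝒯.Delta l).IsUniform := by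
    intro l
    obtain ⟨k, rfl⟩ := hsurj l
    have := 𝒯.Delta_nontrivial (h k)
    exact ((hP k).isUniform hA).of_injective (emb k) (hemb k)
  have hsoc : ∀ l, ∃ (m : 𝒯.Irr) (i : 𝒯.L m ⟶ 𝒯.Delta l), Function.Injective i.toLin := by
    intro l
    have := 𝒯.Delta_nontrivial l
    obtain ⟨N, hN⟩ := (𝒯.Delta l).exists_simple_sub
    obtain ⟨m, ⟨e⟩⟩ := 𝒯.exists_iso_L hN
    exact ⟨m, e.hom ≫ GrMod.incl N, (GrMod.incl_injective N).comp (GrMod.iso_bijective e).1⟩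
  choose dag i hi using hsoc
  have hdag : Function.Injective dag := by
    intro l m hlm
    obtain ⟨k, rfl⟩ := hsurj l
    obtain ⟨k', rfl⟩ := hsurj m
    have hm : ∃ j : 𝒯.L (dag (h k')) ⟶ 𝒯.Delta (h k'), Function.Injective j.toLin := ⟨_, hi _⟩
    rw [← hlm] at hm
    obtain ⟨j, hj⟩ := hm
    have := (𝒯.L_isSimple (dag (h k))).1
    obtain ⟨e⟩ := ((hP k).isUniform hA).iso ((hP k').isUniform hA) ((hP k).hasExtensions hA)
      ((hP k').hasExtensions hA) (i (h k) ≫ emb k) (j ≫ emb k') ((hemb k).comp (hi _))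
      ((hemb k').comp hj)
    rw [hiso e]
  let dperm : Equiv.Perm 𝒯.Irr := Equiv.ofBijective dag
    ⟨hdag, dag_surjective dag hU (fun l => ⟨i l, hi l⟩) hdag⟩
  refine ⟨P, fun l => ⟨hP l, (hP l).isLocal.isProjectiveCover (hP l).hasLifts (𝒯.L_isSimple l)
    (p l) (hp l)⟩, hperm.trans dperm, dperm, hperm, fun l => ?_, fun l => ?_, hh, fun l => ?_⟩
  · exact ((hP l).isUniform hA).soc_iso (𝒯.L_isSimple _) (i (h l) ≫ emb l) ((hemb l).comp (hi _))
  · exact (hU l).soc_iso (𝒯.L_isSimple _) (i l) (hi l)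
  · exact congrArg hperm.symm (dperm.symm_apply_apply l)

end Tilting

end PreTriangularDecomposition

end GradedTilting

/-! ### The main theorem. -/

open GradedTilting PreTriangularDecomposition in
theorem mainTheorem3 {K A : Type u} [Field K] [Ring A] [Algebra K A] [FiniteDimensional K A]
    (𝒜 : ℤ → Submodule K A) [GradedAlgebra 𝒜] (𝒯 : TriangularDecomposition 𝒜)
    (hT : IsSemisimpleRing 𝒯.mid) (hA : Module.Injective A A) :
    ∃ P : 𝒯.Irr → GrMod 𝒜, (∀ l, (P l).IsProjectiveCover (𝒯.L l)) ∧
    ∃ nu dag h : Equiv.Perm 𝒯.Irr,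
      (∀ l, Nonempty ((P l).soc ≅ 𝒯.L (nu l))) ∧
      (∀ l, Nonempty ((𝒯.Delta l).soc ≅ 𝒯.L (dag l))) ∧
      (∀ l, 𝒯.HasHighestWeight (P l) (h l)) ∧
    ∃ T : 𝒯.Irr → GrMod 𝒜,
      (∀ l, T l = P (nu.symm (dag l)) ∧ T l = P (h.symm l)) ∧
      (∀ l, (T l).IsIndecomposable ∧ 𝒯.IsTilting (T l) ∧ 𝒯.HasHighestWeight (T l) l ∧
        (∃ f : 𝒯.Delta l ⟶ T l, Function.Injective f.toLin) ∧
        (∃ g : T l ⟶ 𝒯.Nabla l, Function.Surjective g.toLin)) ∧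
      Set.BijOn (fun l => (Quotient.mk (isIsomorphicSetoid (GrMod 𝒜)) (T l)))
        Set.univ
        ((fun X => Quotient.mk (isIsomorphicSetoid (GrMod 𝒜)) X) ''
          {X : GrMod 𝒜 | X.IsIndecomposable ∧ 𝒯.IsTilting X}) ∧
      (∀ (l : 𝒯.Irr) (X : GrMod 𝒜), X.IsIndecomposable → 𝒯.IsTilting X →
        𝒯.HasHighestWeight X l → Nonempty (X ≅ T l)) := by
  obtain ⟨P, hP, nu, dag, h, h1, h2, h3, h4⟩ :=
    exists_tilting_data (𝒯 := 𝒯.toPreTriangularDecomposition) hA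
  have hPT : ∀ l, TopIs (P (h.symm l)) l := fun l => by
    have := h3 (h.symm l)
    rwa [h.apply_symm_apply] at this
  have hfree := fun l => 𝒯.isFree_of_isPIM (hP l).1
  have hcofree := fun l => 𝒯.isCofree_of_isPIM hA (hP l).1
  have htilt : ∀ l, 𝒯.IsTilting (P l) := fun l =>
    ⟨𝒯.isStandardlyFiltered_of_isFree (hfree l), 𝒯.isCostandardlyFiltered_of_isCofree (hcofree l)⟩
  have huniq : ∀ X : GrMod 𝒜, X.IsIndecomposable → 𝒯.IsTilting X →
      ∃ l, Nonempty (X ≅ P (h.symm l)) := fun X hX hX' => by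
    obtain ⟨l, hl⟩ := exists_iso_of_isTilting hA hX (𝒯.isFree_of_isStandardlyFiltered hX'.1)
      (𝒯.isCofree_of_isCostandardlyFiltered hX'.2)
    exact ⟨l, hl _ (hP _).1 (hPT l)⟩
  refine ⟨P, fun l => (hP l).2, nu, dag, h, h1, h2, fun l => (h3 l).hasHighestWeight,
    fun l => P (h.symm l), fun l => ⟨by rw [h4], rfl⟩, fun l => ⟨(hP _).1.1, htilt _,
      (hPT l).hasHighestWeight, (hPT l).exists_embedding (hfree _),
      (hPT l).exists_toNabla (hcofree _)⟩, ⟨?_, ?_, ?_⟩, ?_⟩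
  · exact fun l _ => ⟨_, ⟨(hP _).1.1, htilt _⟩, rfl⟩
  · intro l _ m _ hlm
    obtain ⟨e⟩ := Quotient.exact hlm
    exact ((hPT l).of_iso e).unique (hPT m)
  · rintro _ ⟨X, ⟨hX, hX'⟩, rfl⟩
    obtain ⟨l, ⟨e⟩⟩ := huniq X hX hX'
    exact ⟨l, trivial, Quotient.sound ⟨e.symm⟩⟩
  · intro l X hX hX' hw
    obtain ⟨m, ⟨e⟩⟩ := huniq X hX hX'
    have hw' := ((hPT m).of_iso e.symm).hasHighestWeight
    -- An object has at most one highest weight: each of the two has nonzero multiplicity, so it is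
    -- bounded by the other.
    have : l = m := le_antisymm (hw'.1 l (by rw [hw.2]; exact one_ne_zero))
      (hw.1 m (by rw [hw'.2]; exact one_ne_zero))
    rw [this]
    exact ⟨e⟩
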